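/- Let $A$ be a C*-algebra, let $E$ be a full right Hilbert $A$-module, and let $\varphi : A \to \mathcal L(E)$ be an injective $*$-homomorphism into the adjointable operators such that $\varphi(A) \cap \mathcal K(E) = \{0\}$, where $\mathcal K(E)$ is the closed linear span of the operators $\theta_{\xi,\eta}(\zeta) = \xi\langle \eta, \zeta\rangle$. Put $E^{\otimes 0} = A$, let $E^{\otimes n} = E \otimes_A \cdots \otimes_A E$ ($n$ factors, interior tensor product along $\varphi$), and let $\mathcal E_+ = \bigoplus_{n \ge 0} E^{\otimes n}$ be the Fock space, a Hilbert $A$-module with left action of $A$ given by $a(\xi_1 \otimes \cdots \otimes \xi_n) = \varphi(a)\xi_1 \otimes \cdots \otimes \xi_n$ (and by left multiplication on $E^{\otimes 0}$). For $\xi \in E^{\otimes k}$, $k \ge 1$, let $T_\xi \in \mathcal L(\mathcal E_+)$ be the creation operator $T_\xi(\zeta) = \xi \otimes \zeta$ (with $T_\xi(a) = \xi a$ for $a \in A$); for $a \in E^{\otimes 0} = A$ let $T_a$ be the left action of $a$. Let $\mathcal T_E$ be the C*-subalgebra of $\mathcal L(\mathcal E_+)$ generated by the $T_\xi$, $\xi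 \in E$; let $\iota_k : \mathcal K(E^{\otimes k}) \to \mathcal T_E$ be the embedding with $\iota_k(\theta_{\xi,\eta}) = T_\xi T_\eta^*$; let $C_n$ be the C*-algebra generated by the $T_\xi T_\eta^*$ with $\xi, \eta \in E^{\otimes k}$, $k \le n$; and let $\mathcal F_E = \overline{\bigcup_n C_n} \subseteq \mathcal T_E$. For $n \in \mathbb N = \{0, 1, 2, \dots\}$ let $J_n$ be the C*-subalgebra generated by the $\iota_k(\mathcal K(E^{\otimes k}))$ with $k \ge n$. Then each $J_n$ is an essential ideal of $\mathcal F_E$, and $$\mathcal F_E = J_0 \supseteq J_1 \supseteq J_2 \supseteq \cdots, \qquad \bigcap_n J_n = \{0\}.$$ For every $n$ one has $J_n / J_{n+1} \cong \mathcal K(E^{\otimes n})$. This quotient is strongly Morita equivalent to $A$ if $n \le 1$, and for every $n$ if $\varphi$ is nondegenerate (that is, if $\varphi(A)E$ spans a dense subspace of $E$). Moreover, for every $n$ the restriction to $C_n$ of the quotient map $\mathcal F_E \to \mathcal F_E / J_{n+1}$ is an isomorphism $C_n \cong \mathcal F_E / J_{n+1}$. -/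

import Mathlib

open scoped TensorProduct

universe u

noncomputable section

set_option linter.unusedSectionVars false

namespace CuntzPimsner

/-- A (right) semi-inner-product module over the C*-algebra `A`: a complex vector space `V` with a
bilinear right `A`-action, `ract a x = x a`, and an `A`-valued form `ip x y = ⟨x, y⟩`, linear in the
second variable, which satisfies the axioms of a right pre-Hilbert `A`-module except possibly
definiteness. -/
class PreHilbertModule (A V : Type*) [NonUnitalCStarAlgebra A] [PartialOrder A]
    [AddCommGroup V] [Module ℂ V] where
  ract : A →ₗ[ℂ] V →ₗ[ℂ] V
  ract_mul : ∀ (a b : A) (x : V), ract (a * b) x = ract b (ract a x)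
  ip : V →ₗ⋆[ℂ] V →ₗ[ℂ] A
  ip_ract : ∀ (a : A) (x y : V), ip x (ract a y) = ip x y * a
  star_ip : ∀ x y : V, star (ip x y) = ip y x
  ip_self_nonneg : ∀ x : V, 0 ≤ ip x x

/-- A right Hilbert `A`-module: a right pre-Hilbert module which is a Banach space for the norm
`‖x‖ = ‖⟨x, x⟩‖ ^ (1 / 2)`.  In particular `⟨x, x⟩ = 0` only if `x = 0`. -/
class HilbertModule (A E : Type*) [NonUnitalCStarAlgebra A] [PartialOrder A]
    [NormedAddCommGroup E] [NormedSpace ℂ E] [CompleteSpace E] extends PreHilbertModule A E where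
  norm_sq_eq : ∀ x : E, ‖x‖ ^ 2 = ‖ip x x‖

section Basic

variable {A V : Type*} [NonUnitalCStarAlgebra A] [PartialOrder A]
  [AddCommGroup V] [Module ℂ V] [PreHilbertModule A V]

/-- The `A`-valued inner product `⟨x, y⟩`. -/
def ip (A : Type*) {V : Type*} [NonUnitalCStarAlgebra A] [PartialOrder A]
    [AddCommGroup V] [Module ℂ V] [PreHilbertModule A V] (x y : V) : A :=
  PreHilbertModule.ip x y

/-- The right action `x a`. -/
def rmul {A V : Type*} [NonUnitalCStarAlgebra A] [PartialOrder A]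
    [AddCommGroup V] [Module ℂ V] [PreHilbertModule A V] (x : V) (a : A) : V :=
  PreHilbertModule.ract a x

@[simp] theorem ip_add_left (x y z : V) : ip A (x + y) z = ip A x z + ip A y z := by simp [ip]
@[simp] theorem ip_add_right (x y z : V) : ip A x (y + z) = ip A x y + ip A x z := by simp [ip]
@[simp] theorem ip_sub_left (x y z : V) : ip A (x - y) z = ip A x z - ip A y z := by simp [ip]
@[simp] theorem ip_sub_right (x y z : V) : ip A x (y - z) = ip A x y - ip A x z := by simp [ip]
@[simp] theorem ip_zero_left (x : V) : ip A 0 x = 0 := by simp [ip]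
@[simp] theorem ip_zero_right (x : V) : ip A x 0 = 0 := by simp [ip]
@[simp] theorem ip_smul_left (c : ℂ) (x y : V) : ip A (c • x) y = star c • ip A x y := by simp [ip]
@[simp] theorem ip_smul_right (c : ℂ) (x y : V) : ip A x (c • y) = c • ip A x y := by simp [ip]

theorem ip_sum_left {ι : Type*} (s : Finset ι) (f : ι → V) (y : V) :
    ip A (∑ i ∈ s, f i) y = ∑ i ∈ s, ip A (f i) y := by
  simp [ip, LinearMap.sum_apply]

theorem ip_sum_right {ι : Type*} (s : Finset ι) (f : ι → V) (y : V) :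
    ip A y (∑ i ∈ s, f i) = ∑ i ∈ s, ip A y (f i) := by
  simp [ip]

@[simp] theorem star_ip (x y : V) : star (ip A x y) = ip A y x := PreHilbertModule.star_ip x y

@[simp] theorem ip_rmul_right (a : A) (x y : V) : ip A x (rmul y a) = ip A x y * a :=
  PreHilbertModule.ip_ract a x y

@[simp] theorem ip_rmul_left (a : A) (x y : V) : ip A (rmul x a) y = star a * ip A x y := by
  rw [← star_ip, ip_rmul_right, star_mul, star_ip]

theorem ip_self_nonneg (x : V) : 0 ≤ ip A x x := PreHilbertModule.ip_self_nonneg x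

end Basic

section PreHilbert

variable {A V : Type*} [NonUnitalCStarAlgebra A] [PartialOrder A] [StarOrderedRing A]
  [AddCommGroup V] [Module ℂ V] [PreHilbertModule A V]

/-- The Cauchy-Schwarz inequality. -/
theorem norm_ip_sq_le (x y : V) : ‖ip A x y‖ ^ 2 ≤ ‖ip A x x‖ * ‖ip A y y‖ := by
  set a := ip A x y with ha
  have hyx : ip A y x = star a := (star_ip x y).symm
  have key : ∀ t : ℝ, (2 * t - t ^ 2 * ‖ip A x x‖) • (star a * a) ≤ ip A y y := by
    intro t
    have h0 : 0 ≤ ip A (rmul x (t • a) - y) (rmul x (t • a) - y) :=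
      ip_self_nonneg _
    have h1 : ip A (rmul x (t • a) - y) (rmul x (t • a) - y)
        = t ^ 2 • (star a * ip A x x * a) - (2 * t) • (star a * a) + ip A y y := by
      have e3 : star (t • a) = t • star a := by simp [star_smul]
      simp only [ip_sub_left, ip_sub_right, ip_rmul_left, ip_rmul_right, e3, hyx, ← ha]
      simp only [smul_mul_assoc, mul_smul_comm, sub_mul, mul_assoc]
      module
    have h2 : star a * ip A x x * a ≤ ‖ip A x x‖ • (star a * a) :=
      CStarAlgebra.star_left_conjugate_le_norm_smul
        (show IsSelfAdjoint (ip A x x) from star_ip x x)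
    rw [h1] at h0
    have h3 : t ^ 2 • (star a * ip A x x * a) ≤ t ^ 2 • (‖ip A x x‖ • (star a * a)) :=
      smul_le_smul_of_nonneg_left h2 (sq_nonneg t)
    rw [← sub_nonneg]
    refine h0.trans ?_
    rw [← sub_nonneg] at h3 ⊢
    convert h3 using 1
    module
  have key2 : ∀ t : ℝ, 0 ≤ 2 * t - t ^ 2 * ‖ip A x x‖ →
      (2 * t - t ^ 2 * ‖ip A x x‖) * ‖a‖ ^ 2 ≤ ‖ip A y y‖ := by
    intro t ht
    have := CStarAlgebra.norm_le_norm_of_nonneg_of_le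
      (smul_nonneg ht (star_mul_self_nonneg a)) (key t)
    rwa [norm_smul, CStarRing.norm_star_mul_self, Real.norm_of_nonneg ht, ← sq] at this
  rcases (norm_nonneg (ip A x x)).eq_or_lt with h | h
  · rw [← h] at key2 ⊢
    by_contra hc
    simp only [zero_mul, not_le] at hc
    have := key2 ((‖ip A y y‖ + 1) / ‖a‖ ^ 2) (by
      simp only [mul_zero, sub_zero]; positivity)
    simp only [mul_zero, sub_zero] at this
    rw [mul_assoc, div_mul_cancel₀ _ hc.ne'] at this
    linarith [norm_nonneg (ip A y y)]
  · have := key2 (‖ip A x x‖⁻¹) (by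
      field_simp; norm_num)
    have e : 2 * ‖ip A x x‖⁻¹ - ‖ip A x x‖⁻¹ ^ 2 * ‖ip A x x‖ = ‖ip A x x‖⁻¹ := by
      field_simp; norm_num
    rw [e, inv_mul_le_iff₀ h] at this
    exact this

variable (A V) in
/-- The space `V` with the seminorm `‖⟨x, x⟩‖ ^ (1 / 2)`. -/
def Semi (A V : Type*) [NonUnitalCStarAlgebra A] [PartialOrder A]
  [AddCommGroup V] [Module ℂ V] [PreHilbertModule A V] : Type _ := V

instance : AddCommGroup (Semi A V) := inferInstanceAs (AddCommGroup V)
instance : Module ℂ (Semi A V) := inferInstanceAs (Module ℂ V)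
instance : PreHilbertModule A (Semi A V) := inferInstanceAs (PreHilbertModule A V)

instance : Norm (Semi A V) := ⟨fun x => √‖ip A x x‖⟩

theorem semi_norm_sq (x : Semi A V) : ‖x‖ ^ 2 = ‖ip A x x‖ := Real.sq_sqrt (norm_nonneg _)

theorem semi_norm_nonneg (x : Semi A V) : 0 ≤ ‖x‖ := Real.sqrt_nonneg _

theorem semi_norm_ip_le (x y : Semi A V) : ‖ip A x y‖ ≤ ‖x‖ * ‖y‖ := by
  refine (sq_le_sq₀ (norm_nonneg _)
    (mul_nonneg (semi_norm_nonneg x) (semi_norm_nonneg y))).1 ?_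
  rw [mul_pow, semi_norm_sq, semi_norm_sq]
  exact norm_ip_sq_le x y

theorem semi_core : SeminormedSpace.Core ℂ (Semi A V) where
  norm_nonneg := semi_norm_nonneg
  norm_smul c x := by
    have : ‖c • x‖ ^ 2 = (‖c‖ * ‖x‖) ^ 2 := by
      rw [semi_norm_sq, mul_pow, semi_norm_sq]
      simp [norm_smul]; ring
    exact (pow_left_inj₀ (semi_norm_nonneg _)
      (mul_nonneg (norm_nonneg _) (semi_norm_nonneg _)) two_ne_zero).1 this
  norm_triangle x y := by
    have h := semi_norm_ip_le x y
    have h' := semi_norm_ip_le y x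
    refine (sq_le_sq₀ (semi_norm_nonneg _)
      (add_nonneg (semi_norm_nonneg x) (semi_norm_nonneg y))).1 ?_
    rw [semi_norm_sq]
    have e : ip A (x + y) (x + y) = ip A x x + ip A x y + (ip A y x + ip A y y) := by
      simp; abel
    have h1 := semi_norm_sq x
    have h2 := semi_norm_sq y
    rw [e]
    have := norm_add_le (ip A x x + ip A x y) (ip A y x + ip A y y)
    have := norm_add_le (ip A x x) (ip A x y)
    have := norm_add_le (ip A y x) (ip A y y)
    nlinarith

instance : SeminormedAddCommGroup (Semi A V) := SeminormedAddCommGroup.ofCore semi_core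
instance : NormedSpace ℂ (Semi A V) where
  norm_smul_le c x := (semi_core.norm_smul c x).le

/-- The inner product as a bounded sesquilinear map. -/
def semiIp : Semi A V →L⋆[ℂ] Semi A V →L[ℂ] A :=
  LinearMap.mkContinuous₂ (PreHilbertModule.ip (A := A) (V := Semi A V)) 1
    fun x y => (semi_norm_ip_le x y).trans_eq (by rw [one_mul])

theorem semi_norm_ract_le (a : A) (x : Semi A V) : ‖rmul x a‖ ≤ ‖a‖ * ‖x‖ := by
  refine (sq_le_sq₀ (semi_norm_nonneg _)
    (mul_nonneg (norm_nonneg _) (semi_norm_nonneg _))).1 ?_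
  have e : ip A (rmul x a) (rmul x a) = star a * ip A x x * a := by
    rw [ip_rmul_left, ip_rmul_right, mul_assoc]
  rw [semi_norm_sq, mul_pow, semi_norm_sq, e]
  calc _ ≤ ‖star a * ip A x x‖ * ‖a‖ := norm_mul_le _ _
    _ ≤ ‖star a‖ * ‖ip A x x‖ * ‖a‖ := by gcongr; exact norm_mul_le _ _
    _ = _ := by rw [norm_star]; ring

/-- The right action as a bounded bilinear map. -/
def semiRact : A →L[ℂ] Semi A V →L[ℂ] Semi A V :=
  LinearMap.mkContinuous₂ (PreHilbertModule.ract (A := A) (V := Semi A V)) 1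
    fun a x => (semi_norm_ract_le a x).trans_eq (by rw [one_mul])

/-- The completion of a semi-inner-product module: vectors of length zero are divided out, and the
quotient is completed. -/
def Compl (A V : Type*) [NonUnitalCStarAlgebra A] [PartialOrder A] [StarOrderedRing A]
    [AddCommGroup V] [Module ℂ V] [PreHilbertModule A V] : Type _ :=
  UniformSpace.Completion (Semi A V)

instance : NormedAddCommGroup (Compl A V) :=
  inferInstanceAs (NormedAddCommGroup (UniformSpace.Completion (Semi A V)))
instance : NormedSpace ℂ (Compl A V) :=
  inferInstanceAs (NormedSpace ℂ (UniformSpace.Completion (Semi A V)))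
instance : CompleteSpace (Compl A V) :=
  inferInstanceAs (CompleteSpace (UniformSpace.Completion (Semi A V)))

/-- The canonical map into the completion, as an isometry. -/
def semiToCompl (A V : Type*) [NonUnitalCStarAlgebra A] [PartialOrder A] [StarOrderedRing A]
    [AddCommGroup V] [Module ℂ V] [PreHilbertModule A V] : Semi A V →ₗᵢ[ℂ] Compl A V :=
  UniformSpace.Completion.toComplₗᵢ (𝕜 := ℂ) (E := Semi A V)

/-- The canonical map from a semi-inner-product module to its completion. -/
def toCompl (A : Type*) {V : Type*} [NonUnitalCStarAlgebra A] [PartialOrder A] [StarOrderedRing A]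
    [AddCommGroup V] [Module ℂ V] [PreHilbertModule A V] : V →ₗ[ℂ] Compl A V :=
  (semiToCompl A V).toLinearMap

theorem denseRange_toCompl : DenseRange (toCompl A (V := V)) :=
  UniformSpace.Completion.denseRange_coe (α := Semi A V)

theorem norm_toCompl (x : V) : ‖toCompl A x‖ = ‖(show Semi A V from x)‖ :=
  (semiToCompl A V).norm_map x

/-- Extension of a bounded (semi)linear map to the completion. -/
def complExt {σ : ℂ →+* ℂ} {F : Type*} [NormedAddCommGroup F] [NormedSpace ℂ F] [CompleteSpace F]
    (f : Semi A V →SL[σ] F) : Compl A V →SL[σ] F :=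
  f.toLinearMap.extendOfNorm (semiToCompl A V).toLinearMap

theorem complExt_toCompl {σ : ℂ →+* ℂ} [RingHomIsometric σ]
    {F : Type*} [NormedAddCommGroup F] [NormedSpace ℂ F]
    [CompleteSpace F] (f : Semi A V →SL[σ] F) (x : V) :
    complExt f (toCompl A x) = f x :=
  LinearMap.extendOfNorm_eq (e := (semiToCompl A V).toLinearMap) (f := f.toLinearMap)
    (denseRange_toCompl (A := A) (V := V))
    ⟨‖f‖, fun x => by simpa using f.le_opNorm x⟩ x

theorem complExt_unique {σ : ℂ →+* ℂ} [RingHomIsometric σ]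
    {F : Type*} [NormedAddCommGroup F] [NormedSpace ℂ F] {f g : Compl A V →SL[σ] F}
    (h : ∀ v : V, f (toCompl A v) = g (toCompl A v)) : f = g := by
  ext x
  exact denseRange_toCompl.induction_on (p := fun x => f x = g x) x
    (isClosed_eq f.continuous g.continuous) h

/-- The inner product, extended in the second variable. -/
def complIpAux : Semi A V →L⋆[ℂ] Compl A V →L[ℂ] A :=
  LinearMap.mkContinuous
    { toFun := fun x => complExt (semiIp x)
      map_add' := fun x y => complExt_unique fun v => by
        simp only [add_apply, complExt_toCompl, map_add]
        rfl
      map_smul' := fun c x => complExt_unique fun v => by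
        rw [smul_apply, complExt_toCompl, complExt_toCompl, map_smulₛₗ]
        rfl }
    1 fun x => by
      refine ContinuousLinearMap.opNorm_le_bound _ (by positivity) fun y => ?_
      refine denseRange_toCompl.induction_on (p := fun y =>
        ‖complExt (semiIp x) y‖ ≤ 1 * ‖x‖ * ‖y‖) y (isClosed_le (by fun_prop) (by fun_prop))
        fun v => ?_
      rw [complExt_toCompl, norm_toCompl, one_mul]
      exact semi_norm_ip_le (A := A) (V := V) x v

/-- The inner product on the completion. -/
def complIp : Compl A V →L⋆[ℂ] Compl A V →L[ℂ] A :=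
  complExt complIpAux

theorem complIp_toCompl (x y : V) : complIp (toCompl A x) (toCompl A y) = ip A x y := by
  rw [complIp, complExt_toCompl]
  exact complExt_toCompl (semiIp (A := A) (V := V) x) y

/-- The right action on the completion. -/
def complRact : A →L[ℂ] Compl A V →L[ℂ] Compl A V :=
  (complExt ((ContinuousLinearMap.compL ℂ (Semi A V) (Semi A V) (Compl A V)
    (semiToCompl A V).toContinuousLinearMap).comp (semiRact (A := A) (V := V))).flip).flip

theorem complRact_toCompl (a : A) (x : V) :
    complRact a (toCompl A x) = toCompl A (rmul x a) := by
  simp only [complRact, ContinuousLinearMap.flip_apply, complExt_toCompl]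
  rfl

instance : HilbertModule A (Compl A V) where
  ract := (ContinuousLinearMap.coeLM ℂ).comp (complRact (A := A) (V := V)).toLinearMap
  ract_mul a b x := by
    refine denseRange_toCompl.induction_on (p := fun x =>
      complRact (a * b) x = complRact b (complRact a x)) x
      (isClosed_eq (by fun_prop) (by fun_prop)) fun v => ?_
    simp only [complRact_toCompl]
    exact congrArg _ (PreHilbertModule.ract_mul a b v)
  ip := (ContinuousLinearMap.coeLM ℂ).comp (complIp (A := A) (V := V)).toLinearMap
  ip_ract a x y := by
    refine denseRange_toCompl.induction_on₂ (p := fun x y : Compl A V =>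
      complIp x (complRact a y) = complIp x y * a) ?_ (fun v w => ?_) x y
    · exact isClosed_eq (by fun_prop) (by fun_prop)
    · simp only [complRact_toCompl, complIp_toCompl]
      exact PreHilbertModule.ip_ract a v w
  star_ip x y := by
    refine denseRange_toCompl.induction_on₂ (p := fun x y : Compl A V =>
      star (complIp x y) = complIp y x) ?_ (fun v w => ?_) x y
    · exact isClosed_eq (by fun_prop) (by fun_prop)
    · simp only [complIp_toCompl]
      exact PreHilbertModule.star_ip v w
  ip_self_nonneg x := by
    refine denseRange_toCompl.induction_on (p := fun x : Compl A V => 0 ≤ complIp x x) x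
      ?_ fun v => ?_
    · exact CStarAlgebra.isClosed_nonneg.preimage
        (f := fun x : Compl A V => complIp x x) (by fun_prop)
    · simp only [complIp_toCompl]
      exact PreHilbertModule.ip_self_nonneg v
  norm_sq_eq x := by
    refine denseRange_toCompl.induction_on (p := fun x : Compl A V =>
      ‖x‖ ^ 2 = ‖complIp x x‖) x
      (isClosed_eq (by fun_prop) (by fun_prop)) fun v => ?_
    rw [complIp_toCompl, norm_toCompl]
    exact semi_norm_sq (A := A) (V := V) v

theorem ip_toCompl (x y : V) : ip A (toCompl A x) (toCompl A y) = ip A x y :=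
  complIp_toCompl x y

end PreHilbert

section Hilbert

variable {A X : Type*} [NonUnitalCStarAlgebra A] [PartialOrder A] [StarOrderedRing A]
  [NormedAddCommGroup X] [NormedSpace ℂ X] [CompleteSpace X] [HilbertModule A X]

variable (A) in
theorem norm_sq_eq_ip (x : X) : ‖x‖ ^ 2 = ‖ip A x x‖ := HilbertModule.norm_sq_eq x

theorem norm_ip_le (x y : X) : ‖ip A x y‖ ≤ ‖x‖ * ‖y‖ := by
  refine (sq_le_sq₀ (norm_nonneg _) (by positivity)).1 ?_
  rw [mul_pow, norm_sq_eq_ip A x, norm_sq_eq_ip A y]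
  exact norm_ip_sq_le x y

theorem ip_ext {x y : X} (h : ∀ z : X, ip A z x = ip A z y) : x = y := by
  have h1 : ‖x - y‖ ^ 2 = 0 := by
    have e : ip A (x - y) (x - y) = 0 := by
      rw [ip_sub_right, h, sub_self]
    rw [norm_sq_eq_ip A, e, norm_zero]
  exact sub_eq_zero.1 (norm_eq_zero.1 (pow_eq_zero_iff two_ne_zero |>.1 h1))

/-- The inner product of a Hilbert module as a bounded sesquilinear map. -/
def ipL (A X : Type*) [NonUnitalCStarAlgebra A] [PartialOrder A] [StarOrderedRing A]
    [NormedAddCommGroup X] [NormedSpace ℂ X] [CompleteSpace X] [HilbertModule A X] :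
    X →L⋆[ℂ] X →L[ℂ] A :=
  LinearMap.mkContinuous₂ (PreHilbertModule.ip (A := A) (V := X)) 1
    fun x y => (norm_ip_le (A := A) x y).trans_eq (by rw [one_mul])

theorem ipL_apply (x y : X) : ipL A X x y = ip A x y := rfl

theorem continuous_ip : Continuous fun p : X × X => ip A p.1 p.2 := by
  have : Continuous fun p : X × X => ipL A X p.1 p.2 := by fun_prop
  exact this

variable (A X) in
/-- The bounded operators `T` on `X` which have an adjoint: a bounded operator `S` with
`⟨T x, y⟩ = ⟨x, S y⟩`. -/
def adjointable : Subalgebra ℂ (X →L[ℂ] X) where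
  carrier := {T | ∃ S : X →L[ℂ] X, ∀ x y : X, ip A (T x) y = ip A x (S y)}
  mul_mem' := by
    rintro T T' ⟨S, h⟩ ⟨S', h'⟩
    exact ⟨S' * S, fun x y => by
      rw [mul_apply_eq_comp, h, h', mul_apply_eq_comp]⟩
  add_mem' := by
    rintro T T' ⟨S, h⟩ ⟨S', h'⟩
    refine ⟨S + S', fun x y => ?_⟩
    simp [h x y, h' x y]
  algebraMap_mem' c := by
    refine ⟨algebraMap ℂ _ (star c), fun x y => ?_⟩
    simp [Algebra.algebraMap_eq_smul_one]

/-- The algebra `L(X)` of bounded adjointable operators on the Hilbert module `X`. -/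
def Adj (A X : Type*) [NonUnitalCStarAlgebra A] [PartialOrder A]
    [NormedAddCommGroup X] [NormedSpace ℂ X] [CompleteSpace X] [HilbertModule A X] : Type _ :=
  adjointable A X

namespace Adj

instance : NormedRing (Adj A X) := inferInstanceAs (NormedRing (adjointable A X))
instance : NormedAlgebra ℂ (Adj A X) := inferInstanceAs (NormedAlgebra ℂ (adjointable A X))

/-- The underlying bounded operator. -/
def toCLM : Adj A X →ₐ[ℂ] X →L[ℂ] X := (adjointable A X).val

instance : CoeFun (Adj A X) (fun _ => X → X) := ⟨fun T => toCLM T⟩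

theorem norm_toCLM (T : Adj A X) : ‖toCLM T‖ = ‖T‖ := rfl

theorem ext {T S : Adj A X} (h : ∀ x : X, T x = S x) : T = S :=
  Subtype.ext (ContinuousLinearMap.ext h)

@[simp] theorem mul_apply (T S : Adj A X) (x : X) : (T * S) x = T (S x) := rfl
@[simp] theorem add_apply (T S : Adj A X) (x : X) : (T + S) x = T x + S x := rfl
@[simp] theorem smul_apply (c : ℂ) (T : Adj A X) (x : X) : (c • T) x = c • T x := rfl
@[simp] theorem zero_apply (x : X) : (0 : Adj A X) x = 0 := rfl
@[simp] theorem one_apply (x : X) : (1 : Adj A X) x = x := rfl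

/-- The operator with the given underlying map and adjoint. -/
def mk (T S : X →L[ℂ] X) (h : ∀ x y : X, ip A (T x) y = ip A x (S y)) : Adj A X := ⟨T, S, h⟩

@[simp] theorem mk_apply (T S : X →L[ℂ] X) (h : ∀ x y : X, ip A (T x) y = ip A x (S y)) (x : X) :
    mk T S h x = T x := rfl

/-- The adjoint. -/
instance : Star (Adj A X) where
  star T := ⟨T.2.choose, toCLM T, fun x y => by
    have h := congrArg star (T.2.choose_spec y x)
    rw [star_ip, star_ip] at h
    exact h.symm⟩

theorem ip_star_right (T : Adj A X) (x y : X) : ip A x (star T y) = ip A (T x) y :=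
  (T.2.choose_spec x y).symm

theorem ip_star_left (T : Adj A X) (x y : X) : ip A (star T x) y = ip A x (T y) := by
  rw [← star_ip, ip_star_right, star_ip]

theorem star_eq_of {T S : Adj A X} (h : ∀ x y : X, ip A (T x) y = ip A x (S y)) : star T = S :=
  ext fun y => ip_ext fun x => by rw [ip_star_right, h]

theorem star_mk (T S : X →L[ℂ] X) (h : ∀ x y : X, ip A (T x) y = ip A x (S y)) (y : X) :
    star (mk T S h) y = S y :=
  ip_ext fun x => by rw [ip_star_right]; exact h x y

/-- Adjointable operators are `A`-linear. -/
theorem map_rmul (T : Adj A X) (x : X) (a : A) : T (rmul x a) = rmul (T x) a :=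
  ip_ext fun z => by
    rw [← ip_star_left, ip_rmul_right, ip_rmul_right, ip_star_left]

instance : StarRing (Adj A X) where
  star_involutive T := star_eq_of fun x y => ip_star_left T x y
  star_mul T S := star_eq_of fun x y => by
    rw [mul_apply, mul_apply, ip_star_right, ip_star_right]
  star_add T S := star_eq_of fun x y => by
    rw [add_apply, add_apply, ip_add_left, ip_add_right, ip_star_right, ip_star_right]

instance : StarModule ℂ (Adj A X) where
  star_smul c T := star_eq_of fun x y => by
    rw [smul_apply, smul_apply, ip_smul_left, ip_smul_right, ip_star_right]

instance : CStarRing (Adj A X) where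
  norm_mul_self_le T := by
    have h : ‖T‖ ≤ √‖star T * T‖ := by
      refine ContinuousLinearMap.opNorm_le_bound (toCLM T) (by positivity) fun x => ?_
      refine (sq_le_sq₀ (by positivity) (by positivity)).1 ?_
      rw [mul_pow, Real.sq_sqrt (norm_nonneg _), norm_sq_eq_ip A (T x)]
      have e : ip A (T x) (T x) = ip A x ((star T * T) x) := by
        rw [mul_apply, ip_star_right]
      calc ‖ip A (T x) (T x)‖ ≤ ‖x‖ * ‖(star T * T) x‖ := by rw [e]; exact norm_ip_le _ _
        _ ≤ ‖x‖ * (‖star T * T‖ * ‖x‖) := by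
          gcongr; exact (toCLM (star T * T)).le_opNorm x
        _ = _ := by ring
    calc ‖T‖ * ‖T‖ ≤ √‖star T * T‖ * √‖star T * T‖ := by gcongr
      _ = _ := Real.mul_self_sqrt (norm_nonneg _)

instance : CompleteSpace (Adj A X) := by
  refine Metric.complete_of_cauchySeq_tendsto fun u hu => ?_
  have hs : CauchySeq fun n => star (u n) := star_isometry.uniformContinuous.comp_cauchySeq hu
  have hi : Isometry (toCLM (A := A) (X := X)) := isometry_subtype_coe
  obtain ⟨T, hT⟩ := cauchySeq_tendsto_of_complete (hi.uniformContinuous.comp_cauchySeq hu)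
  obtain ⟨S, hS⟩ := cauchySeq_tendsto_of_complete (hi.uniformContinuous.comp_cauchySeq hs)
  have h : ∀ x y : X, ip A (T x) y = ip A x (S y) := fun x y => by
    have h1 : Filter.Tendsto (fun n => ipL A X (u n x) y) Filter.atTop (nhds (ipL A X (T x) y)) :=
      ((ipL A X).flip y).continuous.tendsto _ |>.comp
        (((ContinuousLinearMap.apply ℂ X x).continuous.tendsto _).comp hT)
    have h2 : Filter.Tendsto (fun n => ipL A X x (star (u n) y)) Filter.atTop
        (nhds (ipL A X x (S y))) :=
      (ipL A X x).continuous.tendsto _ |>.comp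
        (((ContinuousLinearMap.apply ℂ X y).continuous.tendsto _).comp hS)
    refine tendsto_nhds_unique h1 (h2.congr fun n => ?_)
    exact ip_star_right (u n) x y
  exact ⟨mk T S h, (hi.isEmbedding.tendsto_nhds_iff).2 hT⟩

instance : CStarAlgebra (Adj A X) where

end Adj

end Hilbert

section Positivity

variable {A V : Type*} [NonUnitalCStarAlgebra A] [PartialOrder A] [StarOrderedRing A]
  [AddCommGroup V] [Module ℂ V] [PreHilbertModule A V]

/-- The decomposition of a self-adjoint element into its positive and negative parts. -/
theorem exists_posPart_negPart {B : Type*} [NonUnitalCStarAlgebra B] [PartialOrder B]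
    [StarOrderedRing B] (G : B) (hG : IsSelfAdjoint G) :
    ∃ p c : B, star p * p - star c * c = G ∧ star c * c * (star p * p) = 0 := by
  obtain ⟨p, hp⟩ := CStarAlgebra.nonneg_iff_eq_star_mul_self.1 (CFC.posPart_nonneg G)
  obtain ⟨c, hc⟩ := CStarAlgebra.nonneg_iff_eq_star_mul_self.1 (CFC.negPart_nonneg G)
  exact ⟨p, c, by rw [← hp, ← hc, CFC.posPart_sub_negPart G hG],
    by rw [← hp, ← hc, CFC.negPart_mul_posPart G]⟩

/-- A Gram matrix `(⟨ξ i, ξ j⟩)` is positive, that is, of the form `b* b`. -/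
theorem gram_eq {ι : Type*} [Fintype ι] [DecidableEq ι] (ξ : ι → V) :
    ∃ b : ι → ι → A, ∀ i j, ip A (ξ i) (ξ j) = ∑ k, star (b k i) * b k j := by
  let G : CStarMatrix ι ι A := CStarMatrix.ofMatrix fun i j => ip A (ξ i) (ξ j)
  have hG : IsSelfAdjoint G := by
    ext i j
    exact star_ip (ξ j) (ξ i)
  obtain ⟨p, c, hdec, hPN⟩ := exists_posPart_negPart G hG
  obtain ⟨N, hc⟩ : ∃ N, N = star c * c := ⟨_, rfl⟩
  rw [← hc] at hdec hPN
  have hNs : star N = N := by rw [hc, star_mul, star_star]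
  have h3 : N * G * N = -(star (c * N) * (c * N)) := by
    rw [← hdec, mul_sub, hPN, zero_sub, star_mul, hNs, neg_mul]
    congr 1
    conv_lhs => rw [mul_assoc]; enter [2, 1]; rw [hc]
    simp only [mul_assoc]
  have hdiag : ∀ i, 0 ≤ (N * G * N) i i := fun i => by
    have : (N * G * N) i i = ip A (∑ j, rmul (ξ j) (N j i)) (∑ j, rmul (ξ j) (N j i)) := by
      have hs : ∀ j, N i j = star (N j i) := fun j => by
        conv_lhs => rw [← hNs]
        rfl
      simp only [ip_sum_left, ip_sum_right, ip_rmul_left, ip_rmul_right, CStarMatrix.mul_apply,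
        Finset.sum_mul, hs]
      simp only [mul_assoc]
      rfl
    rw [this]
    exact ip_self_nonneg _
  have hd0 : ∀ i k, (c * N) k i = 0 := fun i => by
    have h1 := hdiag i
    rw [h3] at h1
    have h2 : (-(star (c * N) * (c * N))) i i = -∑ k, star ((c * N) k i) * (c * N) k i := rfl
    rw [h2, neg_nonneg] at h1
    have hpos : ∀ k ∈ Finset.univ, 0 ≤ star ((c * N) k i) * (c * N) k i :=
      fun k _ => star_mul_self_nonneg _
    have h4 := (Finset.sum_eq_zero_iff_of_nonneg hpos).1
      (le_antisymm h1 (Finset.sum_nonneg hpos))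
    exact fun k => CStarRing.star_mul_self_eq_zero_iff _ |>.1 (h4 k (Finset.mem_univ k))
  have hcN : c * N = 0 := by
    ext k i
    exact hd0 i k
  have hN0 : N = 0 := by
    have : star N * N = 0 := by
      rw [hNs]
      conv_lhs => enter [1]; rw [hc]
      rw [mul_assoc, hcN, mul_zero]
    exact CStarRing.star_mul_self_eq_zero_iff _ |>.1 this
  refine ⟨fun k i => p k i, fun i j => ?_⟩
  have : G i j = (star p * p) i j := by rw [← hdec, hN0, sub_zero]
  exact this

end Positivity

section Correspondence

variable {A : Type u} [NonUnitalCStarAlgebra A] [PartialOrder A] [StarOrderedRing A]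

/-- A right semi-inner-product module over `A` together with a left action of `A` by adjointable
maps, `⟨a x, y⟩ = ⟨x, a* y⟩`. -/
structure PreCorr (A : Type u) [NonUnitalCStarAlgebra A] [PartialOrder A] where
  carrier : Type u
  [addCommGroup : AddCommGroup carrier]
  [module : Module ℂ carrier]
  [preHilbert : PreHilbertModule A carrier]
  lact : A →ₗ[ℂ] carrier →ₗ[ℂ] carrier
  lact_mul : ∀ (a b : A) (x : carrier), lact (a * b) x = lact a (lact b x)
  ip_lact : ∀ (a : A) (x y : carrier), ip A (lact a x) y = ip A x (lact (star a) y)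

namespace PreCorr

attribute [instance] PreCorr.addCommGroup PreCorr.module PreCorr.preHilbert

theorem ip_lact_right (P : PreCorr A) (a : A) (x y : P.carrier) :
    ip A x (P.lact a y) = ip A (P.lact (star a) x) y := by
  rw [P.ip_lact, star_star]

/-- The algebra `A` as a module over itself: `⟨a, b⟩ = a* b`. -/
def self (A : Type u) [NonUnitalCStarAlgebra A] [PartialOrder A] [StarOrderedRing A] :
    PreCorr A where
  carrier := A
  preHilbert :=
    { ract := (LinearMap.mul ℂ A).flip
      ract_mul := fun a b x => (mul_assoc x a b).symm
      ip := (LinearMap.mul ℂ A).comp (starLinearEquiv ℂ (A := A)).toLinearMap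
      ip_ract := fun a x y => (mul_assoc (star x) y a).symm
      star_ip := fun x y => by simp
      ip_self_nonneg := fun x => star_mul_self_nonneg x }
  lact := LinearMap.mul ℂ A
  lact_mul a b x := mul_assoc a b x
  ip_lact a x y := by
    change star (a * x) * y = star x * (star a * y)
    rw [star_mul, mul_assoc]

variable {E : Type u} [NormedAddCommGroup E] [NormedSpace ℂ E] [CompleteSpace E]
  [HilbertModule A E]

/-- The linear functional `η ⊗ y ↦ ⟨x, ⟨ξ, η⟩ y⟩` on `E ⊗ P`. -/
def tensorIp (E : Type u) [NormedAddCommGroup E] [NormedSpace ℂ E] [CompleteSpace E]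
    [HilbertModule A E] (P : PreCorr A) :
    E ⊗[ℂ] P.carrier →ₗ⋆[ℂ] E ⊗[ℂ] P.carrier →ₗ[ℂ] A :=
  TensorProduct.lift (LinearMap.mk₂'ₛₗ (starRingEnd ℂ) (starRingEnd ℂ)
    (fun (ξ : E) (x : P.carrier) => TensorProduct.lift (LinearMap.mk₂ ℂ
      (fun (η : E) (y : P.carrier) => ip A x (P.lact (ip A ξ η) y))
      (fun _ _ _ => by simp) (fun _ _ _ => by simp) (fun _ _ _ => by simp)
      (fun _ _ _ => by simp)))
    (fun _ _ _ => TensorProduct.ext' fun _ _ => by simp)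
    (fun _ _ _ => TensorProduct.ext' fun _ _ => by simp)
    (fun _ _ _ => TensorProduct.ext' fun _ _ => by simp)
    (fun _ _ _ => TensorProduct.ext' fun _ _ => by simp))

theorem tensorIp_tmul (P : PreCorr A) (ξ η : E) (x y : P.carrier) :
    tensorIp E P (ξ ⊗ₜ x) (η ⊗ₜ y) = ip A x (P.lact (ip A ξ η) y) := by
  simp [tensorIp]

theorem tensorIp_self_nonneg (P : PreCorr A) (u : E ⊗[ℂ] P.carrier) : 0 ≤ tensorIp E P u u := by
  classical
  obtain ⟨S, rfl⟩ := TensorProduct.exists_finset u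
  obtain ⟨b, hb⟩ := gram_eq (A := A) (fun i : S => i.1.1)
  have h : tensorIp E P (∑ i ∈ S, i.1 ⊗ₜ i.2) (∑ i ∈ S, i.1 ⊗ₜ i.2) =
      ∑ k : S, ip A (∑ i : S, P.lact (b k i) i.1.2) (∑ i : S, P.lact (b k i) i.1.2) := by
    rw [← Finset.sum_coe_sort S]
    simp only [map_sum, LinearMap.sum_apply, tensorIp_tmul, hb, ip_sum_left, ip_sum_right,
      P.lact_mul, P.ip_lact]
    conv_rhs => rw [Finset.sum_comm]
    exact Finset.sum_congr rfl fun x _ => Finset.sum_comm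
  rw [h]
  exact Finset.sum_nonneg fun k _ => ip_self_nonneg _

/-- `E ⊗ P` with the semi-inner product `⟨ξ ⊗ x, η ⊗ y⟩ = ⟨x, ⟨ξ, η⟩ y⟩`, right action
`(ξ ⊗ x) a = ξ ⊗ x a` and left action `a (ξ ⊗ x) = φ(a) ξ ⊗ x`.  The vectors
`ξ a ⊗ x - ξ ⊗ a x` have length zero, so that its completion is the interior tensor product
`E ⊗_A P`. -/
def tensor (φ : A →⋆ₙₐ[ℂ] Adj A E) (P : PreCorr A) : PreCorr A where
  carrier := E ⊗[ℂ] P.carrier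
  preHilbert :=
    { ract := (LinearMap.lTensorHom E).comp PreHilbertModule.ract
      ract_mul := fun a b u => by
        induction u with
        | zero => simp
        | tmul ξ x => simp [PreHilbertModule.ract_mul]
        | add u v hu hv => simp only [map_add, hu, hv]
      ip := tensorIp E P
      ip_ract := fun a u v => by
        induction u with
        | zero => simp
        | add u u' hu hu' => simp only [map_add, LinearMap.add_apply, hu, hu', add_mul]
        | tmul ξ x =>
          induction v with
          | zero => simp
          | add v v' hv hv' => simp only [map_add, hv, hv', add_mul]
          | tmul η y =>
            change tensorIp E P (ξ ⊗ₜ x) (η ⊗ₜ rmul y a) = _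
            rw [tensorIp_tmul, tensorIp_tmul, P.ip_lact_right, P.ip_lact_right, ip_rmul_right]
      star_ip := fun u v => by
        induction u with
        | zero => simp
        | add u u' hu hu' => simp only [map_add, LinearMap.add_apply, star_add, hu, hu']
        | tmul ξ x =>
          induction v with
          | zero => simp
          | add v v' hv hv' => simp only [map_add, LinearMap.add_apply, star_add, hv, hv']
          | tmul η y => rw [tensorIp_tmul, tensorIp_tmul, star_ip, P.ip_lact, star_ip]
      ip_self_nonneg := tensorIp_self_nonneg P }
  lact := (LinearMap.rTensorHom P.carrier).comp
    ((ContinuousLinearMap.coeLM ℂ).comp (Adj.toCLM.toLinearMap.comp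
      (φ : A →ₗ[ℂ] Adj A E)))
  lact_mul a b u := by
    induction u with
    | zero => simp
    | tmul ξ x => simp [map_mul]
    | add u v hu hv => simp only [map_add, hu, hv]
  ip_lact a u v := by
    induction u with
    | zero => simp
    | add u u' hu hu' => simp only [map_add, ip_add_left, hu, hu']
    | tmul ξ x =>
      induction v with
      | zero => simp
      | add v v' hv hv' => simp only [map_add, ip_add_right, hv, hv']
      | tmul η y =>
        change tensorIp E P (φ a ξ ⊗ₜ x) (η ⊗ₜ y) = tensorIp E P (ξ ⊗ₜ x) (φ (star a) η ⊗ₜ y)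
        rw [tensorIp_tmul, tensorIp_tmul, map_star, Adj.ip_star_right]


theorem tensor_ip_tmul (φ : A →⋆ₙₐ[ℂ] Adj A E) (P : PreCorr A) (ξ η : E) (x y : P.carrier) :
    @ip A (P.tensor φ).carrier _ _ _ _ _ (ξ ⊗ₜ[ℂ] x : E ⊗[ℂ] P.carrier)
      (η ⊗ₜ[ℂ] y : E ⊗[ℂ] P.carrier) = ip A x (P.lact (ip A ξ η) y) :=
  tensorIp_tmul P ξ η x y

theorem tensor_lact_tmul (φ : A →⋆ₙₐ[ℂ] Adj A E) (P : PreCorr A) (a : A) (ξ : E) (x : P.carrier) :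
    (P.tensor φ).lact a (ξ ⊗ₜ[ℂ] x : E ⊗[ℂ] P.carrier) = (φ a ξ ⊗ₜ[ℂ] x : E ⊗[ℂ] P.carrier) :=
  rfl

/-- The algebraic `n`-fold tensor power `E ⊗ (E ⊗ ⋯ ⊗ (E ⊗ A))`; for `n = 0` it is `A`. -/
def tpow (φ : A →⋆ₙₐ[ℂ] Adj A E) : ℕ → PreCorr A
  | 0 => self A
  | n + 1 => (tpow φ n).tensor φ

/-- The semi-inner product on an algebraic direct sum, `⟨x, y⟩ = ∑ n, ⟨x n, y n⟩`. -/
def dirSumIp (P : ℕ → PreCorr A) :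
    (DirectSum ℕ fun n => (P n).carrier) →ₗ⋆[ℂ] (DirectSum ℕ fun n => (P n).carrier) →ₗ[ℂ] A where
  toFun x := DirectSum.toModule ℂ ℕ A fun n => PreHilbertModule.ip (x n)
  map_add' x y := by
    refine DirectSum.linearMap_ext ℂ fun n => LinearMap.ext fun v => ?_
    simp
  map_smul' c x := by
    refine DirectSum.linearMap_ext ℂ fun n => LinearMap.ext fun v => ?_
    simp [DirectSum.smul_apply]

theorem dirSumIp_lof (P : ℕ → PreCorr A) (x : DirectSum ℕ fun n => (P n).carrier) (n : ℕ)
    (v : (P n).carrier) : dirSumIp P x (DirectSum.lof ℂ ℕ _ n v) = ip A (x n) v :=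
  DirectSum.toModule_lof (φ := fun n => PreHilbertModule.ip (A := A) (x n)) ℂ n v

theorem dirSumIp_eq_sum (P : ℕ → PreCorr A) (x y : DirectSum ℕ fun n => (P n).carrier)
    (s : Finset ℕ) (hs : ∀ n, n ∉ s → y n = 0) :
    dirSumIp P x y = ∑ n ∈ s, ip A (x n) (y n) := by
  classical
  have hy : y = ∑ n ∈ s, DirectSum.lof ℂ ℕ (fun n => (P n).carrier) n (y n) := by
    refine DFinsupp.ext fun m => ?_
    rw [DFinsupp.finsetSum_apply]
    simp only [DirectSum.lof_eq_of]
    by_cases hm : m ∈ s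
    · rw [Finset.sum_eq_single_of_mem m hm fun n _ hn =>
        (DirectSum.of_eq_of_ne (β := fun n => (P n).carrier) n m (y n) hn.symm)]
      exact (DirectSum.of_eq_same (β := fun n => (P n).carrier) m (y m)).symm
    · rw [Finset.sum_eq_zero fun n hn => DirectSum.of_eq_of_ne (β := fun n => (P n).carrier) n m
        (y n) (fun h => hm (h ▸ hn)), hs m hm]
  conv_lhs => rw [hy]
  rw [map_sum]
  exact Finset.sum_congr rfl fun n _ => dirSumIp_lof P x n _

theorem exists_support (P : ℕ → PreCorr A) (x y : DirectSum ℕ fun n => (P n).carrier) :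
    ∃ s : Finset ℕ, ∀ n, n ∉ s → x n = 0 ∧ y n = 0 := by
  classical
  refine ⟨DFinsupp.support x ∪ DFinsupp.support y, fun n hn => ?_⟩
  rw [Finset.mem_union, not_or, DFinsupp.notMem_support_iff, DFinsupp.notMem_support_iff] at hn
  exact hn

/-- The algebraic direct sum of a sequence of modules. -/
def dirSum (P : ℕ → PreCorr A) : PreCorr A where
  carrier := DirectSum ℕ fun n => (P n).carrier
  preHilbert :=
    { ract :=
        { toFun := fun a => DirectSum.lmap fun n => PreHilbertModule.ract a
          map_add' := fun a b => by
            refine DirectSum.linearMap_ext ℂ fun n => LinearMap.ext fun v => ?_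
            simp
          map_smul' := fun c a => by
            refine DirectSum.linearMap_ext ℂ fun n => LinearMap.ext fun v => ?_
            simp }
      ract_mul := fun a b x => DFinsupp.ext fun n => by
        simp [DirectSum.lmap_apply, PreHilbertModule.ract_mul]
      ip := dirSumIp P
      ip_ract := fun a x y => by
        obtain ⟨s, hs⟩ := exists_support P x y
        rw [dirSumIp_eq_sum P x y s fun n hn => (hs n hn).2,
          dirSumIp_eq_sum P x _ s fun n hn => by simp [(hs n hn).2], Finset.sum_mul]
        exact Finset.sum_congr rfl fun n _ => ip_rmul_right a (x n) (y n)
      star_ip := fun x y => by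
        obtain ⟨s, hs⟩ := exists_support P x y
        rw [dirSumIp_eq_sum P x y s fun n hn => (hs n hn).2,
          dirSumIp_eq_sum P y x s fun n hn => (hs n hn).1, star_sum]
        exact Finset.sum_congr rfl fun n _ => star_ip (x n) (y n)
      ip_self_nonneg := fun x => by
        obtain ⟨s, hs⟩ := exists_support P x x
        rw [dirSumIp_eq_sum P x x s fun n hn => (hs n hn).2]
        exact Finset.sum_nonneg fun n _ => ip_self_nonneg (x n) }
  lact :=
    { toFun := fun a => DirectSum.lmap fun n => (P n).lact a
      map_add' := fun a b => by
        refine DirectSum.linearMap_ext ℂ fun n => LinearMap.ext fun v => ?_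
        simp
      map_smul' := fun c a => by
        refine DirectSum.linearMap_ext ℂ fun n => LinearMap.ext fun v => ?_
        simp }
  lact_mul a b x := DFinsupp.ext fun n => by
    simp [DirectSum.lmap_apply, (P n).lact_mul]
  ip_lact a x y := by
    obtain ⟨s, hs⟩ := exists_support P x y
    refine (dirSumIp_eq_sum P _ y s fun n hn => (hs n hn).2).trans ?_
    refine Eq.trans ?_ (dirSumIp_eq_sum P x _ s fun n hn => ?_).symm
    · exact Finset.sum_congr rfl fun n _ => (P n).ip_lact a (x n) (y n)
    · simp [(hs n hn).2]

end PreCorr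
end Correspondence

theorem le_of_pow_two_pow_le {a b C : ℝ} (ha : 0 ≤ a) (hb : 0 ≤ b)
    (h : ∀ j : ℕ, a ^ 2 ^ j ≤ C * b ^ 2 ^ j) : a ≤ b := by
  by_contra! hab
  rcases hb.eq_or_lt with rfl | hb
  · have := h 0
    simp at this
    linarith
  · have hr : 1 < a / b := (one_lt_div hb).2 hab
    obtain ⟨n, hn⟩ := pow_unbounded_of_one_lt C hr
    have h1 := h n
    have h2 : (a / b) ^ n ≤ (a / b) ^ 2 ^ n :=
      pow_le_pow_right₀ hr.le Nat.lt_two_pow_self.le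
    rw [← div_le_iff₀ (by positivity), ← div_pow] at h1
    linarith

section Extension

variable {A V : Type*} [NonUnitalCStarAlgebra A] [PartialOrder A] [StarOrderedRing A]
  [AddCommGroup V] [Module ℂ V] [PreHilbertModule A V]

theorem norm_toCompl_sq (x : V) : ‖toCompl A x‖ ^ 2 = ‖ip A x x‖ := by
  rw [norm_sq_eq_ip A, ip_toCompl]

theorem norm_ip_le_toCompl (x y : V) : ‖ip A x y‖ ≤ ‖toCompl A x‖ * ‖toCompl A y‖ := by
  rw [← ip_toCompl]
  exact norm_ip_le _ _

theorem adjoint_bound {S T : V →ₗ[ℂ] V} (h : ∀ x y : V, ip A (S x) y = ip A x (T y)) {C : ℝ}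
    (hC : 0 ≤ C) (hS : ∀ x : V, ‖toCompl A (S x)‖ ≤ C * ‖toCompl A x‖) (y : V) :
    ‖toCompl A (T y)‖ ≤ C * ‖toCompl A y‖ := by
  have h1 : ‖toCompl A (T y)‖ ^ 2 ≤ C * ‖toCompl A (T y)‖ * ‖toCompl A y‖ := by
    rw [norm_toCompl_sq, ← h]
    exact (norm_ip_le_toCompl _ _).trans (by gcongr; exact hS _)
  rcases (norm_nonneg (toCompl A (T y))).eq_or_lt with h0 | h0
  · rw [← h0]; positivity
  · refine le_of_mul_le_mul_right ?_ h0
    linarith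

/-- The bounded operator on the completion which extends a bounded linear map. -/
def extL (A : Type*) {V : Type*} [NonUnitalCStarAlgebra A] [PartialOrder A] [StarOrderedRing A]
    [AddCommGroup V] [Module ℂ V] [PreHilbertModule A V] (S : V →ₗ[ℂ] V) :
    Compl A V →L[ℂ] Compl A V :=
  ((toCompl A).comp S).extendOfNorm (toCompl A)

theorem extL_toCompl {S : V →ₗ[ℂ] V} {C : ℝ}
    (hS : ∀ x : V, ‖toCompl A (S x)‖ ≤ C * ‖toCompl A x‖) (x : V) :
    extL A S (toCompl A x) = toCompl A (S x) :=
  LinearMap.extendOfNorm_eq denseRange_toCompl ⟨C, hS⟩ x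

/-- The adjointable operator on the completion which extends a bounded linear map `S` with
adjoint `T`. -/
def extAdj (S T : V →ₗ[ℂ] V) (h : ∀ x y : V, ip A (S x) y = ip A x (T y)) {C : ℝ}
    (hC : 0 ≤ C) (hS : ∀ x : V, ‖toCompl A (S x)‖ ≤ C * ‖toCompl A x‖) : Adj A (Compl A V) :=
  Adj.mk (extL A S) (extL A T) fun x y => by
    refine denseRange_toCompl.induction_on₂ (p := fun x y : Compl A V =>
      ip A (extL A S x) y = ip A x (extL A T y)) ?_ (fun v w => ?_) x y
    · exact isClosed_eq (continuous_ip.comp (by fun_prop : Continuous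
        fun p : Compl A V × Compl A V => (extL A S p.1, p.2)))
        (continuous_ip.comp (by fun_prop : Continuous
        fun p : Compl A V × Compl A V => (p.1, extL A T p.2)))
    · rw [extL_toCompl hS, extL_toCompl (adjoint_bound h hC hS), ip_toCompl, ip_toCompl, h]

theorem extAdj_toCompl (S T : V →ₗ[ℂ] V) (h : ∀ x y : V, ip A (S x) y = ip A x (T y)) {C : ℝ}
    (hC : 0 ≤ C) (hS : ∀ x : V, ‖toCompl A (S x)‖ ≤ C * ‖toCompl A x‖) (x : V) :
    extAdj S T h hC hS (toCompl A x) = toCompl A (S x) :=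
  extL_toCompl hS x

theorem star_extAdj_toCompl (S T : V →ₗ[ℂ] V) (h : ∀ x y : V, ip A (S x) y = ip A x (T y)) {C : ℝ}
    (hC : 0 ≤ C) (hS : ∀ x : V, ‖toCompl A (S x)‖ ≤ C * ‖toCompl A x‖) (x : V) :
    star (extAdj S T h hC hS) (toCompl A x) = toCompl A (T x) := by
  rw [extAdj, Adj.star_mk, extL_toCompl (adjoint_bound h hC hS)]

theorem Adj.ext_toCompl {S T : Adj A (Compl A V)} (h : ∀ v : V, S (toCompl A v) = T (toCompl A v)) :
    S = T :=
  Subtype.ext (complExt_unique h)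

end Extension

section LeftAction

variable {A : Type u} [NonUnitalCStarAlgebra A] [PartialOrder A] [StarOrderedRing A]

namespace PreCorr

theorem norm_lact_sq (P : PreCorr A) (a : A) (x : P.carrier) :
    ‖toCompl A (P.lact a x)‖ ^ 2 = ‖ip A x (P.lact (star a * a) x)‖ := by
  rw [norm_toCompl_sq, P.ip_lact, P.lact_mul]

theorem norm_lact_le_aux (P : PreCorr A) (x : P.carrier) :
    ∃ K : ℝ, 0 ≤ K ∧ ∀ a : A, ‖toCompl A (P.lact a x)‖ ≤ K * ‖a‖ := by
  let f : A →ₗ[ℂ] A := (PreHilbertModule.ip x).comp (P.lact.flip x)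
  have hf : ∀ a, f a = ip A x (P.lact a x) := fun a => rfl
  obtain ⟨C, hC⟩ := PositiveLinearMap.exists_norm_apply_le (PositiveLinearMap.mk₀ f fun a ha => by
    obtain ⟨b, rfl⟩ := CStarAlgebra.nonneg_iff_eq_star_mul_self.1 ha
    rw [hf, P.lact_mul, ← P.ip_lact]
    exact ip_self_nonneg _)
  refine ⟨√C, by positivity, fun a => ?_⟩
  refine (sq_le_sq₀ (by positivity) (by positivity)).1 ?_
  rw [norm_lact_sq, mul_pow, Real.sq_sqrt (NNReal.coe_nonneg C)]
  refine (hC (star a * a)).trans_eq ?_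
  rw [CStarRing.norm_star_mul_self, sq]

theorem norm_lact_le (P : PreCorr A) (a : A) (x : P.carrier) :
    ‖toCompl A (P.lact a x)‖ ≤ ‖a‖ * ‖toCompl A x‖ := by
  obtain ⟨K, hK, hKa⟩ := P.norm_lact_le_aux x
  have step : ∀ b : A, star b = b →
      ‖toCompl A (P.lact b x)‖ ^ 2 ≤ ‖toCompl A x‖ * ‖toCompl A (P.lact (b * b) x)‖ := by
    intro b hb
    rw [norm_lact_sq, hb]
    exact norm_ip_le_toCompl _ _
  have main : ∀ (j : ℕ) (b : A), star b = b → ‖toCompl A (P.lact b x)‖ ^ 2 ^ j * ‖toCompl A x‖ ≤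
      ‖toCompl A x‖ ^ 2 ^ j * (K * ‖b‖ ^ 2 ^ j) := by
    intro j
    induction j with
    | zero =>
      intro b hb
      simp only [pow_zero, pow_one]
      rw [mul_comm]
      gcongr
      exact hKa b
    | succ j ih =>
      intro b hb
      have hbb : star (b * b) = b * b := by rw [star_mul, hb]
      calc ‖toCompl A (P.lact b x)‖ ^ 2 ^ (j + 1) * ‖toCompl A x‖
          = (‖toCompl A (P.lact b x)‖ ^ 2) ^ 2 ^ j * ‖toCompl A x‖ := by
            rw [← pow_mul, pow_succ']
        _ ≤ (‖toCompl A x‖ * ‖toCompl A (P.lact (b * b) x)‖) ^ 2 ^ j * ‖toCompl A x‖ := by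
            gcongr; exact step b hb
        _ = ‖toCompl A x‖ ^ 2 ^ j * (‖toCompl A (P.lact (b * b) x)‖ ^ 2 ^ j * ‖toCompl A x‖) := by
            rw [mul_pow, mul_assoc]
        _ ≤ ‖toCompl A x‖ ^ 2 ^ j * (‖toCompl A x‖ ^ 2 ^ j * (K * ‖b * b‖ ^ 2 ^ j)) := by
            gcongr ?_ * ?_; exact ih _ hbb
        _ ≤ ‖toCompl A x‖ ^ 2 ^ j * (‖toCompl A x‖ ^ 2 ^ j * (K * (‖b‖ * ‖b‖) ^ 2 ^ j)) := by
            gcongr; exact norm_mul_le b b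
        _ = _ := by rw [pow_succ, pow_mul, pow_mul]; ring
  have hsa : ∀ b : A, star b = b → ‖toCompl A (P.lact b x)‖ ≤ ‖toCompl A x‖ * ‖b‖ := by
    intro b hb
    rcases (norm_nonneg (toCompl A x)).eq_or_lt with h0 | h0
    · have := step b hb
      rw [← h0, zero_mul] at this
      rw [← h0, zero_mul]
      exact (pow_eq_zero_iff two_ne_zero |>.1 (le_antisymm this (sq_nonneg _))).le
    · refine le_of_pow_two_pow_le (C := K / ‖toCompl A x‖) (norm_nonneg _) (by positivity)
        fun j => ?_
      rw [div_mul_eq_mul_div, le_div_iff₀ h0, mul_pow]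
      exact (main j b hb).trans_eq (by ring)
  refine (sq_le_sq₀ (norm_nonneg _) (by positivity)).1 ?_
  rw [norm_lact_sq]
  calc _ ≤ ‖toCompl A x‖ * ‖toCompl A (P.lact (star a * a) x)‖ := norm_ip_le_toCompl _ _
    _ ≤ ‖toCompl A x‖ * (‖toCompl A x‖ * ‖star a * a‖) := by
      gcongr; exact hsa _ (by rw [star_mul, star_star])
    _ = _ := by rw [CStarRing.norm_star_mul_self]; ring

/-- The left action of `A` by adjointable operators on the completion. -/
def leftAction (P : PreCorr A) : A →⋆ₙₐ[ℂ] Adj A (Compl A P.carrier) where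
  toFun a := extAdj (P.lact a) (P.lact (star a)) (P.ip_lact a) (norm_nonneg a) (P.norm_lact_le a)
  map_smul' c a := Adj.ext_toCompl fun v => by
    simp only [Adj.smul_apply, extAdj_toCompl]
    simp
  map_zero' := Adj.ext_toCompl fun v => by
    simp only [Adj.zero_apply, extAdj_toCompl]
    simp
  map_add' a b := Adj.ext_toCompl fun v => by
    simp only [Adj.add_apply, extAdj_toCompl]
    simp
  map_mul' a b := Adj.ext_toCompl fun v => by
    simp only [Adj.mul_apply, extAdj_toCompl, P.lact_mul]
  map_star' a := Adj.ext_toCompl fun v => by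
    rw [star_extAdj_toCompl, extAdj_toCompl]

theorem leftAction_toCompl (P : PreCorr A) (a : A) (x : P.carrier) :
    P.leftAction a (toCompl A x) = toCompl A (P.lact a x) :=
  extAdj_toCompl (P.lact a) (P.lact (star a)) (P.ip_lact a) (norm_nonneg a) (P.norm_lact_le a) x

end PreCorr

end LeftAction

section Compact

variable {A X : Type*} [NonUnitalCStarAlgebra A] [PartialOrder A] [StarOrderedRing A]
  [NormedAddCommGroup X] [NormedSpace ℂ X] [CompleteSpace X] [HilbertModule A X]

theorem norm_rmul_le (x : X) (a : A) : ‖rmul x a‖ ≤ ‖x‖ * ‖a‖ := by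
  refine (sq_le_sq₀ (norm_nonneg _) (by positivity)).1 ?_
  rw [norm_sq_eq_ip A (rmul x a), mul_pow, norm_sq_eq_ip A x, ip_rmul_left, ip_rmul_right]
  calc _ ≤ ‖star a‖ * (‖ip A x x‖ * ‖a‖) :=
        (norm_mul_le _ _).trans (by gcongr; exact norm_mul_le _ _)
    _ = _ := by rw [norm_star]; ring

/-- The map `ζ ↦ ξ ⟨η, ζ⟩`. -/
def thetaL (A : Type*) {X : Type*} [NonUnitalCStarAlgebra A] [PartialOrder A] [StarOrderedRing A]
    [NormedAddCommGroup X] [NormedSpace ℂ X] [CompleteSpace X] [HilbertModule A X] (ξ η : X) :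
    X →L[ℂ] X :=
  LinearMap.mkContinuous
    ((PreHilbertModule.ract (A := A) (V := X)).flip ξ ∘ₗ PreHilbertModule.ip (A := A) η)
    (‖ξ‖ * ‖η‖) fun ζ => (norm_rmul_le ξ (ip A η ζ)).trans (by
      rw [mul_assoc]; gcongr; exact norm_ip_le η ζ)

theorem thetaL_apply (ξ η ζ : X) : thetaL A ξ η ζ = rmul ξ (ip A η ζ) := rfl

/-- The rank one operator `θ_{ξ, η} ζ = ξ ⟨η, ζ⟩`. -/
def theta (A : Type*) {X : Type*} [NonUnitalCStarAlgebra A] [PartialOrder A] [StarOrderedRing A]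
    [NormedAddCommGroup X] [NormedSpace ℂ X] [CompleteSpace X] [HilbertModule A X] (ξ η : X) :
    Adj A X :=
  Adj.mk (thetaL A ξ η) (thetaL A η ξ) fun x y => by
    rw [thetaL_apply, thetaL_apply, ip_rmul_left, ip_rmul_right, star_ip]

@[simp] theorem theta_apply (ξ η ζ : X) : theta A ξ η ζ = rmul ξ (ip A η ζ) := rfl

theorem star_theta (ξ η : X) : star (theta A ξ η) = theta A η ξ :=
  Adj.ext fun x => Adj.star_mk _ _ _ x

theorem mul_theta (T : Adj A X) (ξ η : X) : T * theta A ξ η = theta A (T ξ) η :=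
  Adj.ext fun x => by rw [Adj.mul_apply, theta_apply, theta_apply, Adj.map_rmul]

/-- The closed linear span of the rank one operators. -/
def thetaSpan (A X : Type*) [NonUnitalCStarAlgebra A] [PartialOrder A] [StarOrderedRing A]
    [NormedAddCommGroup X] [NormedSpace ℂ X] [CompleteSpace X] [HilbertModule A X] :
    Submodule ℂ (Adj A X) :=
  (Submodule.span ℂ (Set.range fun p : X × X => theta A p.1 p.2)).topologicalClosure

theorem thetaSpan_induction {p : Adj A X → Prop} (hθ : ∀ ξ η : X, p (theta A ξ η)) (h0 : p 0)
    (hadd : ∀ S T, p S → p T → p (S + T)) (hsmul : ∀ (c : ℂ) (S), p S → p (c • S))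
    (hcl : IsClosed {S | p S}) {S : Adj A X} (hS : S ∈ thetaSpan A X) : p S := by
  refine closure_minimal (fun T hT => ?_) hcl hS
  refine Submodule.span_induction ?_ h0 (fun _ _ _ _ => hadd _ _) (fun c _ _ => hsmul c _) hT
  rintro _ ⟨q, rfl⟩
  exact hθ _ _

theorem theta_mem_thetaSpan (ξ η : X) : theta A ξ η ∈ thetaSpan A X :=
  subset_closure (Submodule.subset_span ⟨(ξ, η), rfl⟩)

theorem isClosed_thetaSpan : IsClosed (thetaSpan A X : Set (Adj A X)) := isClosed_closure

/-- The C*-algebra `K(X)` of compact operators on `X`: the closed linear span of the rank one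
operators. -/
def compacts (A X : Type*) [NonUnitalCStarAlgebra A] [PartialOrder A] [StarOrderedRing A]
    [NormedAddCommGroup X] [NormedSpace ℂ X] [CompleteSpace X] [HilbertModule A X] :
    NonUnitalStarSubalgebra ℂ (Adj A X) where
  carrier := thetaSpan A X
  add_mem' := (thetaSpan A X).add_mem
  zero_mem' := (thetaSpan A X).zero_mem
  smul_mem' c _ := (thetaSpan A X).smul_mem c
  mul_mem' {S T} _ hT := thetaSpan_induction (p := fun T => S * T ∈ thetaSpan A X)
    (fun ξ η => by rw [mul_theta]; exact theta_mem_thetaSpan _ _)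
    (by rw [mul_zero]; exact zero_mem _)
    (fun _ _ h h' => by rw [mul_add]; exact add_mem h h')
    (fun c _ h => by rw [mul_smul_comm]; exact Submodule.smul_mem _ c h)
    (isClosed_thetaSpan.preimage (continuous_const.mul continuous_id)) hT
  star_mem' {S} hS := thetaSpan_induction (p := fun T => star T ∈ thetaSpan A X)
    (fun ξ η => by rw [star_theta]; exact theta_mem_thetaSpan _ _)
    (by rw [star_zero]; exact zero_mem _)
    (fun _ _ h h' => by rw [star_add]; exact add_mem h h')
    (fun c _ h => by rw [star_smul]; exact Submodule.smul_mem _ _ h)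
    (isClosed_thetaSpan.preimage continuous_star) hS

/-- The rank one operator `θ_{ξ, η}` as an element of `K(X)`. -/
def thetaK (A : Type*) {X : Type*} [NonUnitalCStarAlgebra A] [PartialOrder A] [StarOrderedRing A]
    [NormedAddCommGroup X] [NormedSpace ℂ X] [CompleteSpace X] [HilbertModule A X] (ξ η : X) :
    compacts A X :=
  ⟨theta A ξ η, theta_mem_thetaSpan ξ η⟩

variable (A X) in
/-- The linear map from formal linear combinations of pairs `(ξ, η)` to `K(X)` which sends
`(ξ, η)` to `θ_{ξ, η}`. -/
def thetaSum : (X × X →₀ ℂ) →ₗ[ℂ] compacts A X :=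
  Finsupp.linearCombination ℂ fun p => thetaK A p.1 p.2

theorem coe_thetaSum (d : X × X →₀ ℂ) : (thetaSum A X d : Adj A X) =
    Finsupp.linearCombination ℂ (fun p : X × X => theta A p.1 p.2) d := by
  induction d using Finsupp.induction_linear with
  | zero => simp
  | add f g hf hg => rw [map_add, map_add, ← hf, ← hg]; rfl
  | single p c => rw [thetaSum, Finsupp.linearCombination_single, Finsupp.linearCombination_single]; rfl

theorem denseRange_thetaSum : DenseRange (thetaSum A X) := by
  rintro ⟨S, hS⟩
  rw [Metric.mem_closure_iff]
  intro ε hε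
  obtain ⟨T, hT, hd⟩ := Metric.mem_closure_iff.1 hS ε hε
  have hT' : T ∈ Set.range (Finsupp.linearCombination ℂ fun p : X × X => theta A p.1 p.2) := by
    rw [SetLike.mem_coe, ← Finsupp.range_linearCombination] at hT
    exact hT
  obtain ⟨d, rfl⟩ := hT'
  refine ⟨thetaSum A X d, ⟨d, rfl⟩, ?_⟩
  have : ((thetaSum A X d : compacts A X) : Adj A X) =
      Finsupp.linearCombination ℂ (fun p : X × X => theta A p.1 p.2) d := by
    rw [← coe_thetaSum]
  rw [Subtype.dist_eq, this]
  exact hd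

/-- A Hilbert module is full if the values of its inner product span a dense subspace of `A`. -/
def IsFull (A X : Type*) [NonUnitalCStarAlgebra A] [PartialOrder A]
    [NormedAddCommGroup X] [NormedSpace ℂ X] [CompleteSpace X] [HilbertModule A X] : Prop :=
  Dense (Submodule.span ℂ (Set.range fun p : X × X => ip A p.1 p.2) : Set A)

end Compact

section Fock

variable {A E : Type u} [NonUnitalCStarAlgebra A] [PartialOrder A] [StarOrderedRing A]
  [NormedAddCommGroup E] [NormedSpace ℂ E] [CompleteSpace E] [HilbertModule A E]

/-- The `n`-fold interior tensor power `E ⊗_A ⋯ ⊗_A E`, and `A` for `n = 0`.  Here `E ⊗_A A` is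
identified with `E` by `ξ ⊗ a ↦ ξ a`. -/
abbrev TensorPow (φ : A →⋆ₙₐ[ℂ] Adj A E) (n : ℕ) : Type u :=
  Compl A (PreCorr.tpow φ n).carrier

/-- The algebraic direct sum of the algebraic tensor powers. -/
abbrev algFock (φ : A →⋆ₙₐ[ℂ] Adj A E) : PreCorr A := PreCorr.dirSum (PreCorr.tpow φ)

/-- The Fock space, the Hilbert module direct sum of the `n`-fold tensor powers for `n ≥ 0`. -/
abbrev Fock (φ : A →⋆ₙₐ[ℂ] Adj A E) : Type u := Compl A (algFock φ).carrier

/-- The left action of `A` on the Fock space, `a (ξ₁ ⊗ ⋯ ⊗ ξₙ) = φ(a) ξ₁ ⊗ ⋯ ⊗ ξₙ`. -/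
abbrev fockAction (φ : A →⋆ₙₐ[ℂ] Adj A E) : A →⋆ₙₐ[ℂ] Adj A (Fock φ) := (algFock φ).leftAction

/-- The inclusion of the `n`-th summand. -/
def single (φ : A →⋆ₙₐ[ℂ] Adj A E) (n : ℕ) :
    (PreCorr.tpow φ n).carrier →ₗ[ℂ] (algFock φ).carrier :=
  DirectSum.lof ℂ ℕ (fun n => (PreCorr.tpow φ n).carrier) n

/-- The map `x ↦ ξ ⊗ x` from the `n`-th to the `(n + 1)`-st tensor power. -/
def tmulLeft (φ : A →⋆ₙₐ[ℂ] Adj A E) (ξ : E) (n : ℕ) :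
    (PreCorr.tpow φ n).carrier →ₗ[ℂ] (PreCorr.tpow φ (n + 1)).carrier :=
  TensorProduct.mk ℂ E (PreCorr.tpow φ n).carrier ξ

/-- The map `η ⊗ x ↦ ⟨ξ, η⟩ x` from the `(n + 1)`-st to the `n`-th tensor power. -/
def contractLeft (φ : A →⋆ₙₐ[ℂ] Adj A E) (ξ : E) (n : ℕ) :
    (PreCorr.tpow φ (n + 1)).carrier →ₗ[ℂ] (PreCorr.tpow φ n).carrier :=
  TensorProduct.lift ((PreCorr.tpow φ n).lact ∘ₗ PreHilbertModule.ip (A := A) ξ)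

/-- The creation operator `x ↦ ξ ⊗ x`. -/
def createAlg (φ : A →⋆ₙₐ[ℂ] Adj A E) (ξ : E) :
    (algFock φ).carrier →ₗ[ℂ] (algFock φ).carrier :=
  DirectSum.toModule ℂ ℕ _ fun n => single φ (n + 1) ∘ₗ tmulLeft φ ξ n

/-- The components of the annihilation operator. -/
def annihilateComp (φ : A →⋆ₙₐ[ℂ] Adj A E) (ξ : E) :
    ∀ n, (PreCorr.tpow φ n).carrier →ₗ[ℂ] (algFock φ).carrier
  | 0 => 0
  | n + 1 => single φ n ∘ₗ contractLeft φ ξ n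

/-- The annihilation operator, `η ⊗ x ↦ ⟨ξ, η⟩ x` and `a ↦ 0` for `a ∈ A`. -/
def annihilateAlg (φ : A →⋆ₙₐ[ℂ] Adj A E) (ξ : E) :
    (algFock φ).carrier →ₗ[ℂ] (algFock φ).carrier :=
  DirectSum.toModule ℂ ℕ _ (annihilateComp φ ξ)

theorem algFock_induction (φ : A →⋆ₙₐ[ℂ] Adj A E) {p : (algFock φ).carrier → Prop} (h0 : p 0)
    (hs : ∀ n x, p (single φ n x)) (ha : ∀ x y, p x → p y → p (x + y)) (x : (algFock φ).carrier) :
    p x :=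
  DirectSum.induction_on x h0 hs ha

theorem createAlg_single (φ : A →⋆ₙₐ[ℂ] Adj A E) (ξ : E) (n : ℕ) (x : (PreCorr.tpow φ n).carrier) :
    createAlg φ ξ (single φ n x) = single φ (n + 1) (tmulLeft φ ξ n x) :=
  DirectSum.toModule_lof (φ := fun n => single φ (n + 1) ∘ₗ tmulLeft φ ξ n) ℂ n x

theorem annihilateAlg_single_zero (φ : A →⋆ₙₐ[ℂ] Adj A E) (ξ : E)
    (x : (PreCorr.tpow φ 0).carrier) : annihilateAlg φ ξ (single φ 0 x) = 0 :=
  DirectSum.toModule_lof (φ := annihilateComp φ ξ) ℂ 0 x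

theorem annihilateAlg_single_succ (φ : A →⋆ₙₐ[ℂ] Adj A E) (ξ : E) (n : ℕ)
    (x : (PreCorr.tpow φ (n + 1)).carrier) :
    annihilateAlg φ ξ (single φ (n + 1) x) = single φ n (contractLeft φ ξ n x) :=
  DirectSum.toModule_lof (φ := annihilateComp φ ξ) ℂ (n + 1) x

theorem ip_single_same (φ : A →⋆ₙₐ[ℂ] Adj A E) (n : ℕ) (x y : (PreCorr.tpow φ n).carrier) :
    ip A (single φ n x) (single φ n y) = ip A x y := by
  refine (PreCorr.dirSumIp_lof (PreCorr.tpow φ) (single φ n x) n y).trans ?_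
  congr 1
  exact DirectSum.lof_apply (M := fun n => (PreCorr.tpow φ n).carrier) ℂ n x

theorem ip_single_ne (φ : A →⋆ₙₐ[ℂ] Adj A E) {m n : ℕ} (h : m ≠ n)
    (x : (PreCorr.tpow φ m).carrier) (y : (PreCorr.tpow φ n).carrier) :
    ip A (single φ m x) (single φ n y) = 0 := by
  refine (PreCorr.dirSumIp_lof (PreCorr.tpow φ) (single φ m x) n y).trans ?_
  refine Eq.trans (congrArg (fun z => ip A z y) ?_) (ip_zero_left y)
  exact DirectSum.of_eq_of_ne (β := fun n => (PreCorr.tpow φ n).carrier) m n x h.symm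

theorem lact_single (φ : A →⋆ₙₐ[ℂ] Adj A E) (a : A) (n : ℕ) (x : (PreCorr.tpow φ n).carrier) :
    (algFock φ).lact a (single φ n x) = single φ n ((PreCorr.tpow φ n).lact a x) :=
  DirectSum.lmap_lof (fun n => (PreCorr.tpow φ n).lact a) n x

theorem ip_tmulLeft (φ : A →⋆ₙₐ[ℂ] Adj A E) (ξ : E) (n : ℕ) (x : (PreCorr.tpow φ n).carrier)
    (y : (PreCorr.tpow φ (n + 1)).carrier) :
    ip A (tmulLeft φ ξ n x) y = ip A x (contractLeft φ ξ n y) := by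
  refine TensorProduct.induction_on (motive := fun y : E ⊗[ℂ] (PreCorr.tpow φ n).carrier =>
    @ip A (PreCorr.tpow φ (n + 1)).carrier _ _ _ _ _ (tmulLeft φ ξ n x) y =
      ip A x (contractLeft φ ξ n y)) y ?_ (fun η z => ?_) (fun y z hy hz => ?_)
  · exact (ip_zero_right _).trans (by
      rw [show contractLeft φ ξ n (0 : E ⊗[ℂ] (PreCorr.tpow φ n).carrier) = 0 from map_zero _,
        ip_zero_right])
  · exact PreCorr.tensor_ip_tmul φ _ ξ η x z
  · refine (ip_add_right _ _ _).trans ?_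
    rw [show contractLeft φ ξ n (y + z : E ⊗[ℂ] (PreCorr.tpow φ n).carrier) =
      contractLeft φ ξ n y + contractLeft φ ξ n z from map_add _ _ _, ip_add_right, ← hy, ← hz]

theorem ip_createAlg (φ : A →⋆ₙₐ[ℂ] Adj A E) (ξ : E) (x y : (algFock φ).carrier) :
    ip A (createAlg φ ξ x) y = ip A x (annihilateAlg φ ξ y) := by
  induction x using algFock_induction φ with
  | h0 => rw [map_zero, ip_zero_left, ip_zero_left]
  | ha x x' hx hx' => rw [map_add, ip_add_left, ip_add_left, hx, hx']
  | hs m x =>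
    induction y using algFock_induction φ with
    | h0 => rw [map_zero, ip_zero_right, ip_zero_right]
    | ha y y' hy hy' => rw [map_add, ip_add_right, ip_add_right, hy, hy']
    | hs n y =>
      rw [createAlg_single]
      rcases n with _ | n
      · rw [annihilateAlg_single_zero, ip_zero_right, ip_single_ne φ (by omega)]
      · rw [annihilateAlg_single_succ]
        rcases eq_or_ne m n with rfl | h
        · rw [ip_single_same, ip_single_same, ip_tmulLeft]
        · rw [ip_single_ne φ h, ip_single_ne φ (by omega)]

theorem contract_tmulLeft (φ : A →⋆ₙₐ[ℂ] Adj A E) (ξ η : E) (n : ℕ)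
    (x : (PreCorr.tpow φ n).carrier) :
    contractLeft φ ξ n (tmulLeft φ η n x) = (PreCorr.tpow φ n).lact (ip A ξ η) x := rfl

theorem annihilate_createAlg (φ : A →⋆ₙₐ[ℂ] Adj A E) (ξ η : E) (x : (algFock φ).carrier) :
    annihilateAlg φ ξ (createAlg φ η x) = (algFock φ).lact (ip A ξ η) x := by
  induction x using algFock_induction φ with
  | h0 => simp only [map_zero]
  | ha x x' hx hx' => simp only [map_add, hx, hx']
  | hs m x =>
    rw [createAlg_single, annihilateAlg_single_succ, contract_tmulLeft, lact_single]

theorem norm_createAlg_le (φ : A →⋆ₙₐ[ℂ] Adj A E) (ξ : E) (x : (algFock φ).carrier) :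
    ‖toCompl A (createAlg φ ξ x)‖ ≤ ‖ξ‖ * ‖toCompl A x‖ := by
  refine (sq_le_sq₀ (norm_nonneg _) (by positivity)).1 ?_
  rw [norm_toCompl_sq, ip_createAlg, annihilate_createAlg]
  calc _ ≤ ‖toCompl A x‖ * (‖ip A ξ ξ‖ * ‖toCompl A x‖) :=
        (norm_ip_le_toCompl _ _).trans (by gcongr; exact PreCorr.norm_lact_le _ _ _)
    _ = _ := by rw [← norm_sq_eq_ip A ξ]; ring

/-- The creation operator `T_ξ` on the Fock space, `T_ξ a = ξ a` for `a ∈ A` and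
`T_ξ (ξ₁ ⊗ ⋯ ⊗ ξₙ) = ξ ⊗ ξ₁ ⊗ ⋯ ⊗ ξₙ`. -/
def creation (φ : A →⋆ₙₐ[ℂ] Adj A E) : E →ₗ[ℂ] Adj A (Fock φ) where
  toFun ξ := extAdj (createAlg φ ξ) (annihilateAlg φ ξ) (ip_createAlg φ ξ) (norm_nonneg ξ)
    (norm_createAlg_le φ ξ)
  map_add' ξ η := Adj.ext_toCompl fun v => by
    rw [Adj.add_apply, extAdj_toCompl, extAdj_toCompl, extAdj_toCompl, ← map_add]
    congr 1
    induction v using algFock_induction φ with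
    | h0 => simp only [map_zero, add_zero]
    | ha x x' hx hx' => simp only [map_add, hx, hx']; abel
    | hs m x =>
      have h : tmulLeft φ (ξ + η) m x = tmulLeft φ ξ m x + tmulLeft φ η m x :=
        TensorProduct.add_tmul ξ η x
      simp only [createAlg_single, h, map_add]
  map_smul' c ξ := Adj.ext_toCompl fun v => by
    rw [RingHom.id_apply, Adj.smul_apply, extAdj_toCompl, extAdj_toCompl, ← map_smul]
    congr 1
    induction v using algFock_induction φ with
    | h0 => simp only [map_zero, smul_zero]
    | ha x x' hx hx' => simp only [map_add, hx, hx', smul_add]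
    | hs m x =>
      have h : tmulLeft φ (c • ξ) m x = c • tmulLeft φ ξ m x := TensorProduct.smul_tmul' c ξ x
      simp only [createAlg_single, h, map_smul]

theorem creation_toCompl (φ : A →⋆ₙₐ[ℂ] Adj A E) (ξ : E) (x : (algFock φ).carrier) :
    creation φ ξ (toCompl A x) = toCompl A (createAlg φ ξ x) :=
  extAdj_toCompl (createAlg φ ξ) (annihilateAlg φ ξ) (ip_createAlg φ ξ) (norm_nonneg ξ)
    (norm_createAlg_le φ ξ) x

theorem star_creation_toCompl (φ : A →⋆ₙₐ[ℂ] Adj A E) (ξ : E) (x : (algFock φ).carrier) :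
    star (creation φ ξ) (toCompl A x) = toCompl A (annihilateAlg φ ξ x) :=
  star_extAdj_toCompl (createAlg φ ξ) (annihilateAlg φ ξ) (ip_createAlg φ ξ) (norm_nonneg ξ)
    (norm_createAlg_le φ ξ) x

theorem star_creation_mul (φ : A →⋆ₙₐ[ℂ] Adj A E) (ξ η : E) :
    star (creation φ ξ) * creation φ η = fockAction φ (ip A ξ η) :=
  Adj.ext_toCompl fun v => by
    rw [Adj.mul_apply, creation_toCompl, star_creation_toCompl, annihilate_createAlg,
      PreCorr.leftAction_toCompl]

theorem fockAction_mul_creation (φ : A →⋆ₙₐ[ℂ] Adj A E) (a : A) (ξ : E) :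
    fockAction φ a * creation φ ξ = creation φ (φ a ξ) :=
  Adj.ext_toCompl fun v => by
    rw [Adj.mul_apply, creation_toCompl, creation_toCompl, PreCorr.leftAction_toCompl]
    congr 1
    induction v using algFock_induction φ with
    | h0 => simp only [map_zero]
    | ha x x' hx hx' => simp only [map_add, hx, hx']
    | hs m x =>
      rw [createAlg_single, createAlg_single, lact_single]
      rfl

end Fock

section CreationTensor

variable {A E : Type u} [NonUnitalCStarAlgebra A] [PartialOrder A] [StarOrderedRing A]
  [NormedAddCommGroup E] [NormedSpace ℂ E] [CompleteSpace E] [HilbertModule A E]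

/-- The creation operators of algebraic tensors: `T_a` is the left action of `a` for `a ∈ A`, and
`T_{ξ ⊗ x} = T_ξ T_x`. -/
def creationAlg (φ : A →⋆ₙₐ[ℂ] Adj A E) :
    ∀ n : ℕ, (PreCorr.tpow φ n).carrier →ₗ[ℂ] Adj A (Fock φ)
  | 0 => (fockAction φ : A →ₗ[ℂ] Adj A (Fock φ))
  | n + 1 => TensorProduct.lift
      ((LinearMap.mul ℂ (Adj A (Fock φ))).compl₁₂ (creation φ) (creationAlg φ n))

theorem creationAlg_zero (φ : A →⋆ₙₐ[ℂ] Adj A E) (a : A) :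
    creationAlg φ 0 a = fockAction φ a := rfl

theorem creationAlg_tmul (φ : A →⋆ₙₐ[ℂ] Adj A E) (n : ℕ) (ξ : E) (x : (PreCorr.tpow φ n).carrier) :
    creationAlg φ (n + 1) (tmulLeft φ ξ n x) =
      creation φ ξ * creationAlg φ n x := rfl

theorem tpow_succ_induction (φ : A →⋆ₙₐ[ℂ] Adj A E) (n : ℕ)
    {p : (PreCorr.tpow φ (n + 1)).carrier → Prop} (h0 : p 0)
    (ht : ∀ (ξ : E) (x : (PreCorr.tpow φ n).carrier),
      p (tmulLeft φ ξ n x))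
    (ha : ∀ x y, p x → p y → p (x + y)) (x : (PreCorr.tpow φ (n + 1)).carrier) : p x :=
  TensorProduct.induction_on (motive := p) x h0 ht ha

theorem fockAction_mul_creationAlg (φ : A →⋆ₙₐ[ℂ] Adj A E) (a : A) (n : ℕ)
    (x : (PreCorr.tpow φ n).carrier) :
    fockAction φ a * creationAlg φ n x = creationAlg φ n ((PreCorr.tpow φ n).lact a x) := by
  rcases n with _ | n
  · exact (map_mul (fockAction φ) a x).symm
  · induction x using tpow_succ_induction φ n with
    | h0 => simp only [map_zero, mul_zero]
    | ha x y hx hy => simp only [map_add, mul_add, hx, hy]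
    | ht ξ x =>
      rw [creationAlg_tmul, ← mul_assoc, fockAction_mul_creation]
      rfl

theorem star_creationAlg_mul (φ : A →⋆ₙₐ[ℂ] Adj A E) (n : ℕ) (x y : (PreCorr.tpow φ n).carrier) :
    star (creationAlg φ n x) * creationAlg φ n y = fockAction φ (ip A x y) := by
  induction n with
  | zero =>
    have h (a b : A) : star (fockAction φ a) * fockAction φ b = fockAction φ (star a * b) := by
      rw [map_mul, map_star]
    exact h x y
  | succ n ih =>
    induction x using tpow_succ_induction φ n with
    | h0 => simp only [map_zero, star_zero, zero_mul, ip_zero_left]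
    | ha x x' hx hx' => simp only [map_add, star_add, add_mul, ip_add_left, hx, hx']
    | ht ξ x =>
      induction y using tpow_succ_induction φ n with
      | h0 => rw [map_zero, mul_zero, ip_zero_right, map_zero]
      | ha y y' hy hy' => rw [map_add, mul_add, ip_add_right, hy, hy', map_add]
      | ht η y =>
        rw [ip_tmulLeft, contract_tmulLeft, creationAlg_tmul, creationAlg_tmul, star_mul, mul_assoc,
          ← mul_assoc (star (creation φ ξ)), star_creation_mul, fockAction_mul_creationAlg, ih]

theorem creationAlg_rmul (φ : A →⋆ₙₐ[ℂ] Adj A E) (n : ℕ) (x : (PreCorr.tpow φ n).carrier) (a : A) :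
    creationAlg φ n (rmul x a) = creationAlg φ n x * fockAction φ a := by
  induction n with
  | zero =>
    have h (a b : A) : fockAction φ (a * b) = fockAction φ a * fockAction φ b := map_mul _ a b
    exact h x a
  | succ n ih =>
    induction x using tpow_succ_induction φ n with
    | h0 => simp only [rmul, map_zero, zero_mul]
    | ha x x' hx hx' =>
      simp only [rmul, map_add, add_mul] at hx hx' ⊢
      rw [hx, hx']
    | ht ξ x =>
      have e : rmul (tmulLeft φ ξ n x) a = tmulLeft φ ξ n (rmul x a) := rfl
      rw [e, creationAlg_tmul, creationAlg_tmul, ih, mul_assoc]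

theorem norm_creationAlg_le (φ : A →⋆ₙₐ[ℂ] Adj A E) (n : ℕ) (x : (PreCorr.tpow φ n).carrier) :
    ‖creationAlg φ n x‖ ≤ 1 * ‖toCompl A x‖ := by
  refine (sq_le_sq₀ (norm_nonneg _) (by positivity)).1 ?_
  rw [one_mul, sq, ← CStarRing.norm_star_mul_self, star_creationAlg_mul, norm_toCompl_sq]
  exact NonUnitalStarAlgHom.norm_apply_le (fockAction φ) _

/-- The creation operator `T_ξ` for `ξ` in the `n`-fold tensor power: the continuous linear map
with `T_{ξ₁ ⊗ ⋯ ⊗ ξₙ} = T_{ξ₁} ⋯ T_{ξₙ}`; for `n = 0`, `T_a` is the left action of `a ∈ A`. -/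
def creationTensor (φ : A →⋆ₙₐ[ℂ] Adj A E) (n : ℕ) : TensorPow φ n →L[ℂ] Adj A (Fock φ) :=
  (creationAlg φ n).extendOfNorm (toCompl A)

theorem creationTensor_toCompl (φ : A →⋆ₙₐ[ℂ] Adj A E) (n : ℕ) (x : (PreCorr.tpow φ n).carrier) :
    creationTensor φ n (toCompl A x) = creationAlg φ n x :=
  LinearMap.extendOfNorm_eq denseRange_toCompl ⟨1, norm_creationAlg_le φ n⟩ x

theorem norm_creationTensor_le (φ : A →⋆ₙₐ[ℂ] Adj A E) (n : ℕ) (ξ : TensorPow φ n) :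
    ‖creationTensor φ n ξ‖ ≤ ‖ξ‖ :=
  (LinearMap.norm_extendOfNorm_apply_le denseRange_toCompl 1 (norm_creationAlg_le φ n) ξ).trans_eq
    (one_mul _)

theorem star_creationTensor_mul (φ : A →⋆ₙₐ[ℂ] Adj A E) (n : ℕ) (ξ η : TensorPow φ n) :
    star (creationTensor φ n ξ) * creationTensor φ n η = fockAction φ (ip A ξ η) := by
  have hc : Continuous (fockAction φ) :=
    (AddMonoidHomClass.lipschitz_of_bound (fockAction φ) 1
      fun a => by simpa using NonUnitalStarAlgHom.norm_apply_le (fockAction φ) a).continuous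
  refine denseRange_toCompl.induction_on₂ (p := fun ξ η : TensorPow φ n =>
    star (creationTensor φ n ξ) * creationTensor φ n η = fockAction φ (ip A ξ η))
    (isClosed_eq (by fun_prop) (hc.comp continuous_ip)) (fun x y => ?_) ξ η
  rw [creationTensor_toCompl, creationTensor_toCompl, ip_toCompl, star_creationAlg_mul]

theorem creationTensor_rmul (φ : A →⋆ₙₐ[ℂ] Adj A E) (n : ℕ) (ξ : TensorPow φ n) (a : A) :
    creationTensor φ n (rmul ξ a) = creationTensor φ n ξ * fockAction φ a := by
  refine denseRange_toCompl.induction_on (p := fun ξ : TensorPow φ n =>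
    creationTensor φ n (rmul ξ a) = creationTensor φ n ξ * fockAction φ a) ξ
    (isClosed_eq ((creationTensor φ n).continuous.comp (complRact a).continuous)
      (by fun_prop)) fun x => ?_
  rw [creationTensor_toCompl, ← creationAlg_rmul, ← creationTensor_toCompl]
  exact congrArg _ (complRact_toCompl a x)

/-- The linear map from formal linear combinations of pairs `(ξ, η)` to operators on the Fock space
which sends `(ξ, η)` to `T_ξ T_η*`. -/
def creationSum (φ : A →⋆ₙₐ[ℂ] Adj A E) (n : ℕ) :
    (TensorPow φ n × TensorPow φ n →₀ ℂ) →ₗ[ℂ] Adj A (Fock φ) :=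
  Finsupp.linearCombination ℂ fun p => creationTensor φ n p.1 * star (creationTensor φ n p.2)

theorem creationSum_mul (φ : A →⋆ₙₐ[ℂ] Adj A E) (n : ℕ) (d : TensorPow φ n × TensorPow φ n →₀ ℂ)
    (ζ : TensorPow φ n) : creationSum φ n d * creationTensor φ n ζ =
      creationTensor φ n ((thetaSum A _ d : Adj A (TensorPow φ n)) ζ) := by
  rw [coe_thetaSum]
  induction d using Finsupp.induction_linear with
  | zero => simp
  | add f g hf hg => rw [map_add, map_add, add_mul, hf, hg, Adj.add_apply, map_add]
  | single p c =>
    rw [creationSum, Finsupp.linearCombination_single, Finsupp.linearCombination_single,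
      smul_mul_assoc, mul_assoc, star_creationTensor_mul, ← creationTensor_rmul, Adj.smul_apply,
      map_smul, theta_apply]

theorem star_creationSum_mul (φ : A →⋆ₙₐ[ℂ] Adj A E) (n : ℕ)
    (d : TensorPow φ n × TensorPow φ n →₀ ℂ) (ζ : TensorPow φ n) :
    star (creationSum φ n d) * creationTensor φ n ζ =
      creationTensor φ n (star (thetaSum A _ d : Adj A (TensorPow φ n)) ζ) := by
  rw [coe_thetaSum]
  induction d using Finsupp.induction_linear with
  | zero => simp
  | add f g hf hg => rw [map_add, map_add, star_add, star_add, add_mul, hf, hg, Adj.add_apply, map_add]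
  | single p c =>
    rw [creationSum, Finsupp.linearCombination_single, Finsupp.linearCombination_single,
      star_smul, star_smul, star_mul, star_star, star_theta,
      smul_mul_assoc, mul_assoc, star_creationTensor_mul, ← creationTensor_rmul, Adj.smul_apply,
      map_smul, theta_apply]

theorem norm_creationSum_le (φ : A →⋆ₙₐ[ℂ] Adj A E) (n : ℕ)
    (d : TensorPow φ n × TensorPow φ n →₀ ℂ) :
    ‖creationSum φ n d‖ ≤ 1 * ‖thetaSum A _ d‖ := by
  rw [one_mul]
  set R := creationSum φ n d with hR
  set S : Adj A (TensorPow φ n) := (thetaSum A (TensorPow φ n) d).1 with hS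
  change ‖R‖ ≤ ‖S‖
  have hRT : ∀ ζ, R * creationTensor φ n ζ = creationTensor φ n (S ζ) := creationSum_mul φ n d
  have hRT' : ∀ ζ, star R * creationTensor φ n ζ = creationTensor φ n (star S ζ) :=
    star_creationSum_mul φ n d
  -- `R` is a bounded combination of the `T_ξ T_η*`, so operators are controlled on the `T_ξ`
  have hbound : ∃ K : ℝ, ∀ (Q : Adj A (Fock φ)) (L : Adj A (TensorPow φ n)),
      (∀ ζ, Q * creationTensor φ n ζ = creationTensor φ n (L ζ)) → ‖Q * R‖ ≤ K * ‖L‖ := by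
    rw [hR]
    clear_value R S
    clear hRT hRT' hR hS
    induction d using Finsupp.induction_linear with
    | zero => exact ⟨0, fun Q L _ => by simp⟩
    | add f g hf hg =>
      obtain ⟨K, hK⟩ := hf
      obtain ⟨K', hK'⟩ := hg
      refine ⟨K + K', fun Q L h => ?_⟩
      rw [map_add, mul_add, add_mul]
      exact (norm_add_le _ _).trans (add_le_add (hK Q L h) (hK' Q L h))
    | single p c =>
      refine ⟨‖c‖ * ‖p.1‖ * ‖p.2‖, fun Q L h => ?_⟩
      rw [creationSum, Finsupp.linearCombination_single, mul_smul_comm, ← mul_assoc, h, norm_smul]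
      calc _ ≤ ‖c‖ * (‖L p.1‖ * ‖p.2‖) := by
            gcongr
            refine (norm_mul_le _ _).trans ?_
            rw [norm_star]
            gcongr <;> exact norm_creationTensor_le φ n _
        _ ≤ ‖c‖ * (‖L‖ * ‖p.1‖ * ‖p.2‖) := by
            gcongr; exact (Adj.toCLM L).le_opNorm p.1
        _ = _ := by ring
  obtain ⟨K, hK⟩ := hbound
  have hpow : ∀ m : ℕ, ∀ ζ, (star R * R) ^ m * creationTensor φ n ζ =
      creationTensor φ n (((star S * S) ^ m) ζ) := by
    intro m
    induction m with
    | zero => intro ζ; simp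
    | succ m ih =>
      intro ζ
      rw [pow_succ, pow_succ, mul_assoc, mul_assoc, hRT, hRT', ih]
      rfl
  have hkey : ∀ m : ℕ, ‖(star R * R) ^ (m + 1)‖ ≤ K * ‖(star S * S) ^ m * star S‖ := by
    intro m
    rw [pow_succ, ← mul_assoc]
    refine hK _ _ fun ζ => ?_
    rw [mul_assoc, hRT', hpow]
    rfl
  have hsa : ∀ {B : Type u} [CStarAlgebra B] (b : B) (j : ℕ),
      ‖(star b * b) ^ 2 ^ j‖ = ‖b‖ ^ 2 ^ j * ‖b‖ ^ 2 ^ j := by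
    intro B _ b j
    have h1 := (IsSelfAdjoint.star_mul_self b).nnnorm_pow_two_pow j
    have h2 : ‖(star b * b) ^ 2 ^ j‖ = ‖star b * b‖ ^ 2 ^ j := by
      simpa only [coe_nnnorm, NNReal.coe_pow] using congrArg NNReal.toReal h1
    rw [h2, CStarRing.norm_star_mul_self, mul_pow]
  have hQ : ∀ m : ℕ, ‖(star S * S) ^ m * star S‖ ≤ ‖star S * S‖ ^ m * ‖star S‖ := by
    intro m
    induction m with
    | zero => simp
    | succ m ih =>
      rw [pow_succ' (star S * S), pow_succ' ‖star S * S‖, mul_assoc (star S * S), mul_assoc ‖_‖]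
      exact (norm_mul_le _ _).trans (by gcongr)
  rcases (norm_nonneg S).eq_or_lt with h0 | h0
  · have hS0 : S = 0 := norm_eq_zero.1 h0.symm
    have := hkey 0
    rw [hS0, star_zero, mul_zero, norm_zero, mul_zero, zero_add, pow_one,
      CStarRing.norm_star_mul_self] at this
    rw [← h0]
    nlinarith [norm_nonneg R]
  · have : ‖R‖ * ‖R‖ ≤ ‖S‖ * ‖S‖ := by
      refine le_of_pow_two_pow_le (C := |K| / ‖S‖) (by positivity) (by positivity) fun j => ?_
      obtain ⟨m, hm⟩ : ∃ m, 2 ^ j = m + 1 := ⟨2 ^ j - 1, by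
        have := Nat.one_le_two_pow (n := j); omega⟩
      rw [mul_pow, ← hsa R j, hm]
      calc _ ≤ |K| * (‖star S * S‖ ^ m * ‖star S‖) := by
            refine (hkey m).trans ?_
            gcongr
            · exact le_abs_self K
            · exact hQ m
        _ = _ := by
            rw [CStarRing.norm_star_mul_self, norm_star, pow_succ]
            field_simp
    exact (mul_self_le_mul_self_iff (norm_nonneg _) (norm_nonneg _)).2 this

/-- The embedding `ι_n` of `K(E^{⊗n})` into the operators on the Fock space: the continuous linear
map with `ι_n(θ_{ξ, η}) = T_ξ T_η*`. -/
def iota (φ : A →⋆ₙₐ[ℂ] Adj A E) (n : ℕ) : compacts A (TensorPow φ n) →L[ℂ] Adj A (Fock φ) :=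
  (creationSum φ n).extendOfNorm (thetaSum A (TensorPow φ n))

theorem iota_theta (φ : A →⋆ₙₐ[ℂ] Adj A E) (n : ℕ) (ξ η : TensorPow φ n) :
    iota φ n (thetaK A ξ η) = creationTensor φ n ξ * star (creationTensor φ n η) := by
  have h := LinearMap.extendOfNorm_eq (f := creationSum φ n) (e := thetaSum A (TensorPow φ n))
    denseRange_thetaSum ⟨1, norm_creationSum_le φ n⟩ (Finsupp.single (ξ, η) 1)
  simpa [creationSum, thetaSum, iota] using h

end CreationTensor

section Subalgebras

variable {B : Type*} [CStarAlgebra B]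

/-- The C*-subalgebra generated by a set. -/
def cstarGen (s : Set B) : NonUnitalStarSubalgebra ℂ B :=
  (NonUnitalStarAlgebra.adjoin ℂ s).topologicalClosure

/-- `J` is a two-sided ideal of `S`. -/
structure IsIdealIn (J S : NonUnitalStarSubalgebra ℂ B) : Prop where
  le : J ≤ S
  mul_mem_left : ∀ x ∈ S, ∀ y ∈ J, x * y ∈ J
  mul_mem_right : ∀ x ∈ S, ∀ y ∈ J, y * x ∈ J

/-- The ideal `J` of `S` is essential: `x J = 0` only for `x = 0`. -/
def IsEssentialIn (J S : NonUnitalStarSubalgebra ℂ B) : Prop :=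
  ∀ x ∈ S, (∀ y ∈ J, x * y = 0) → x = 0

/-- `J ∩ S` as a linear subspace of `S`. -/
def subspaceIn (J S : NonUnitalStarSubalgebra ℂ B) : Submodule ℂ S where
  carrier := {x | (x : B) ∈ J}
  add_mem' h h' := J.add_mem h h'
  zero_mem' := J.zero_mem
  smul_mem' c _ h := SMulMemClass.smul_mem (s := J) c h

theorem mem_subspaceIn {J S : NonUnitalStarSubalgebra ℂ B} {x : S} :
    x ∈ subspaceIn J S ↔ (x : B) ∈ J := Iff.rfl

/-- The quotient *-algebra `S / J` by an ideal `J` of `S`. -/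
def QuotientAlg {J S : NonUnitalStarSubalgebra ℂ B} (_h : IsIdealIn J S) : Type _ :=
  S ⧸ subspaceIn J S

namespace QuotientAlg

variable {J S : NonUnitalStarSubalgebra ℂ B} (h : IsIdealIn J S)

instance : AddCommGroup (QuotientAlg h) := inferInstanceAs (AddCommGroup (S ⧸ subspaceIn J S))
instance : Module ℂ (QuotientAlg h) := inferInstanceAs (Module ℂ (S ⧸ subspaceIn J S))

/-- The quotient map. -/
def mkL : S →ₗ[ℂ] QuotientAlg h := (subspaceIn J S).mkQ

theorem mkL_surjective : Function.Surjective (mkL h) := (subspaceIn J S).mkQ_surjective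

theorem mkL_eq_iff {x y : S} : mkL h x = mkL h y ↔ (x : B) - y ∈ J :=
  (Submodule.Quotient.eq (subspaceIn J S)).trans mem_subspaceIn

instance : Mul (QuotientAlg h) where
  mul := Quotient.map₂ (fun x y : S => x * y) fun x x' hx y y' hy => by
    have hx' : (x : B) - x' ∈ J := mem_subspaceIn.1 ((Submodule.quotientRel_def _).1 hx)
    have hy' : (y : B) - y' ∈ J := mem_subspaceIn.1 ((Submodule.quotientRel_def _).1 hy)
    refine (Submodule.quotientRel_def _).2 (mem_subspaceIn.2 ?_)
    change (x : B) * y - x' * y' ∈ J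
    have e : (x : B) * y - x' * y' = x * (y - y') + (x - x') * y' := by noncomm_ring
    rw [e]
    exact J.add_mem (h.mul_mem_left _ x.2 _ hy') (h.mul_mem_right _ y'.2 _ hx')

instance : Star (QuotientAlg h) where
  star := Quotient.map (fun x : S => star x) fun x x' hx => by
    have hx' : (x : B) - x' ∈ J := mem_subspaceIn.1 ((Submodule.quotientRel_def _).1 hx)
    refine (Submodule.quotientRel_def _).2 (mem_subspaceIn.2 ?_)
    change star (x : B) - star (x' : B) ∈ J
    rw [← star_sub]
    exact star_mem hx'

theorem mkL_mul (x y : S) : mkL h (x * y) = mkL h x * mkL h y := rfl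
theorem mkL_star (x : S) : mkL h (star x) = star (mkL h x) := rfl

instance : NonUnitalRing (QuotientAlg h) where
  left_distrib := (mkL_surjective h).forall₃.2 fun x y z => by
    simp only [← map_add, ← mkL_mul, mul_add]
  right_distrib := (mkL_surjective h).forall₃.2 fun x y z => by
    simp only [← map_add, ← mkL_mul, add_mul]
  zero_mul := (mkL_surjective h).forall.2 fun x => by
    rw [← map_zero (mkL h), ← mkL_mul, zero_mul]
  mul_zero := (mkL_surjective h).forall.2 fun x => by
    rw [← map_zero (mkL h), ← mkL_mul, mul_zero]
  mul_assoc := (mkL_surjective h).forall₃.2 fun x y z => by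
    simp only [← mkL_mul, mul_assoc]

instance : StarRing (QuotientAlg h) where
  star_involutive := (mkL_surjective h).forall.2 fun x => by rw [← mkL_star, ← mkL_star, star_star]
  star_mul := (mkL_surjective h).forall₂.2 fun x y => by
    simp only [← mkL_mul, ← mkL_star, star_mul]
  star_add := (mkL_surjective h).forall₂.2 fun x y => by
    simp only [← map_add, ← mkL_star, star_add]

/-- The quotient map as a *-homomorphism. -/
def mk : S →⋆ₙₐ[ℂ] QuotientAlg h where
  toFun := mkL h
  map_smul' := map_smul (mkL h)
  map_zero' := map_zero (mkL h)
  map_add' := map_add (mkL h)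
  map_mul' := mkL_mul h
  map_star' := mkL_star h

end QuotientAlg

end Subalgebras

/-- Strong Morita equivalence of `B` with the C*-algebra `A`: there is a full right Hilbert
`A`-module `X` with `B ≅ K(X)`. -/
def IsStronglyMoritaEquivalent (B : Type*) [NonUnitalRing B] [Module ℂ B] [Star B]
    (A : Type u) [NonUnitalCStarAlgebra A] [PartialOrder A] [StarOrderedRing A] : Prop :=
  ∃ (X : Type u) (_ : NormedAddCommGroup X) (_ : NormedSpace ℂ X) (_ : CompleteSpace X)
    (_ : HilbertModule A X), IsFull A X ∧ Nonempty (B ≃⋆ₐ[ℂ] compacts A X)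

section Algebras

variable {A E : Type u} [NonUnitalCStarAlgebra A] [PartialOrder A] [StarOrderedRing A]
  [NormedAddCommGroup E] [NormedSpace ℂ E] [CompleteSpace E] [HilbertModule A E]

/-- The left action is nondegenerate: `φ(A) E` spans a dense subspace of `E`. -/
def IsNondegenerate (φ : A →⋆ₙₐ[ℂ] Adj A E) : Prop :=
  Dense (Submodule.span ℂ (Set.range fun p : A × E => φ p.1 p.2) : Set E)

/-- The C*-algebra `T_E` generated by the creation operators `T_ξ`, `ξ ∈ E`. -/
def toeplitz (φ : A →⋆ₙₐ[ℂ] Adj A E) : NonUnitalStarSubalgebra ℂ (Adj A (Fock φ)) :=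
  cstarGen (Set.range (creation φ))

/-- The C*-algebra `C_n` generated by the `T_ξ T_η*` with `ξ, η ∈ E^{⊗k}`, `k ≤ n`. -/
def coreStage (φ : A →⋆ₙₐ[ℂ] Adj A E) (n : ℕ) : NonUnitalStarSubalgebra ℂ (Adj A (Fock φ)) :=
  cstarGen {R | ∃ k ≤ n, ∃ ξ η : TensorPow φ k,
    R = creationTensor φ k ξ * star (creationTensor φ k η)}

/-- The C*-algebra `F_E`, the closure of the union of the increasing sequence `C_n`. -/
def core (φ : A →⋆ₙₐ[ℂ] Adj A E) : NonUnitalStarSubalgebra ℂ (Adj A (Fock φ)) :=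
  (⨆ n, coreStage φ n).topologicalClosure

theorem coreStage_le_core (φ : A →⋆ₙₐ[ℂ] Adj A E) (n : ℕ) : coreStage φ n ≤ core φ :=
  (le_iSup (coreStage φ) n).trans (NonUnitalStarSubalgebra.le_topologicalClosure _)

/-- The C*-algebra `J_n` generated by the `ι_k(K(E^{⊗k}))` with `k ≥ n`. -/
def idealJ (φ : A →⋆ₙₐ[ℂ] Adj A E) (n : ℕ) : NonUnitalStarSubalgebra ℂ (Adj A (Fock φ)) :=
  cstarGen {R | ∃ k ≥ n, ∃ S : compacts A (TensorPow φ k), R = iota φ k S}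

end Algebras

end CuntzPimsner

end

open CuntzPimsner

open CuntzPimsner

noncomputable section

set_option linter.unusedSectionVars false

namespace CuntzPimsner

/-! Each generator T_ξ T_η* with ξ, η ∈ E^{⊗k} preserves the grading of the Fock space, so F_E is
block diagonal: its elements x commute with every projection `level φ m`, and the compressions x ↦
x_m to E^{⊗m} (`rho φ m`) are multiplicative on F_E and jointly faithful. A generator of degree k
vanishes on E^{⊗m} for m < k and is the rank one operator θ_{ξ,η} on E^{⊗k}. A product of generators
of degrees k and l is a generator of degree max k l (`mul_mem_coreSet`), so each algebra in question
is the closed linear span of its generators. Hence the J_n are ideals, J_n vanishes below level n,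
and the intersection is zero.

The assumptions on φ enter at one point only. For ξ, η ∈ E^{⊗k} the compression of T_ξ* x T_η to
E^{⊗1} ≅ E is φ(⟨ξ, x_k η⟩) modulo compact operators (`rho_sub_mem_compacts`). If x_{k+1} = 0, the
compression is zero, so φ(⟨ξ, x_k η⟩) is compact and ⟨ξ, x_k η⟩ = 0 by φ(A) ∩ K(E) = 0 and
injectivity. So vanishing descends from level k + 1 to level k (`rho_eq_zero_of_succ`). For x in C_n
and ζ ∈ E^{⊗n} one has x T_ζ = T_{x_n ζ}, which controls the higher levels as well. Therefore x ↦
x_n is injective, hence isometric, on C_n (`eq_zero_of_mem_Iic`, `norm_rho_of_mem`).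

Isometry makes C_n + J_{n+1} closed, so that it is all of F_E (`exists_sub_mem`), and J_{n+1} is the
kernel of x ↦ x_n on F_E (`mem_Ici_iff`). This gives C_n ≅ F_E / J_{n+1}. On J_n the same map has
image K(E^{⊗n}), with section ι_n, which gives J_n / J_{n+1}. If x J_n = 0, then x kills T_ξ for
every ξ of degree at least n, so its high compressions vanish, and by descent all of them do: J_n is
essential. Morita equivalence with A is fullness of E^{⊗n}, where ⟨ξ ⊗ x, η ⊗ y⟩ = ⟨x, ⟨ξ, η⟩ y⟩
reduces degree n + 1 to degree n once A acts nondegenerately. -/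

/-- An injective *-homomorphism of C*-algebras is isometric. -/
theorem norm_map_of_injective {B C : Type*} [NonUnitalCStarAlgebra B] [NonUnitalCStarAlgebra C]
    (f : B →⋆ₙₐ[ℂ] C) (hf : Function.Injective f) (b : B) : ‖f b‖ = ‖b‖ := by
  have hsa : ∀ a : B, IsSelfAdjoint a → ‖a‖ ≤ ‖f a‖ := by
    intro a ha
    have hfa : IsSelfAdjoint (f a) := ha.map f
    -- The function g vanishes exactly on [-‖f a‖, ‖f a‖], an interval which contains the spectrum
    -- of f a. So f (g(a)) = g(f a) = 0, injectivity gives g(a) = 0, and the spectrum of a lies in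
    -- the same interval. The condition g 0 = 0 is what the nonunital calculus requires.
    set g : ℝ → ℝ := fun t => max (|t| - ‖f a‖) 0 with hg
    have hgc : Continuous g := by fun_prop
    have hg0 : g 0 = 0 := by simp [hg]
    have hcont : Continuous f :=
      (AddMonoidHomClass.lipschitz_of_bound f 1
        fun a => by simpa using NonUnitalStarAlgHom.norm_apply_le f a).continuous
    have h1 : f (cfcₙ g a) = cfcₙ g (f a) :=
      NonUnitalStarAlgHom.map_cfcₙ (R := ℝ) (S := ℂ) f g a hgc.continuousOn hg0 hcont ha hfa
    have h2 : cfcₙ g (f a) = 0 := by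
      rw [← cfcₙ_zero ℝ (f a)]
      refine cfcₙ_congr fun t ht => ?_
      have : ‖t‖ ≤ ‖f a‖ := by
        exact NonUnitalIsometricContinuousFunctionalCalculus.norm_quasispectrum_le (𝕜 := ℝ)
          (f a) ht hfa
      simpa [hg] using this
    have h3 : cfcₙ g a = cfcₙ (0 : ℝ → ℝ) a := by
      rw [cfcₙ_zero ℝ a]
      exact hf (by rw [h1, h2, map_zero])
    have h4 := (cfcₙ_eq_cfcₙ_iff_eqOn ha hgc.continuousOn hg0 continuousOn_const rfl).1 h3
    conv_lhs => rw [← cfcₙ_id ℝ a]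
    refine norm_cfcₙ_le fun t ht => ?_
    have := h4 ht
    simpa [hg] using this
  refine le_antisymm (NonUnitalStarAlgHom.norm_apply_le f b) ?_
  refine (mul_self_le_mul_self_iff (norm_nonneg _) (norm_nonneg _)).2 ?_
  rw [← CStarRing.norm_star_mul_self, ← CStarRing.norm_star_mul_self, ← map_star, ← map_mul]
  exact hsa _ (IsSelfAdjoint.star_mul_self b)

/-! ### Compressions and compact operators -/

section Compress

variable {A X Y : Type*} [NonUnitalCStarAlgebra A] [PartialOrder A] [StarOrderedRing A]
  [NormedAddCommGroup X] [NormedSpace ℂ X] [CompleteSpace X] [HilbertModule A X]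
  [NormedAddCommGroup Y] [NormedSpace ℂ Y] [CompleteSpace Y] [HilbertModule A Y]

/-- The compression `x ↦ V* x V` for a bounded operator `V : X → Y` with adjoint `W`. -/
def compress (V : X →L[ℂ] Y) (W : Y →L[ℂ] X) (h : ∀ x y, ip A (V x) y = ip A x (W y)) :
    Adj A Y →L[ℂ] Adj A X :=
  LinearMap.mkContinuous
    { toFun := fun T => Adj.mk (W ∘L Adj.toCLM T ∘L V) (W ∘L Adj.toCLM (star T) ∘L V)
        fun x y => by
          change ip A (W (T (V x))) y = ip A x (W (star T (V y)))
          rw [← h, Adj.ip_star_right, ← star_ip, ← h, star_ip]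
      map_add' := fun S T => Adj.ext fun x => by simp
      map_smul' := fun c T => Adj.ext fun x => by simp }
    (‖W‖ * ‖V‖) fun T => by
      refine (ContinuousLinearMap.opNorm_comp_le _ _).trans ?_
      rw [mul_assoc, mul_comm ‖V‖]
      gcongr
      exact ContinuousLinearMap.opNorm_comp_le _ _

variable {V : X →L[ℂ] Y} {W : Y →L[ℂ] X} (h : ∀ x y, ip A (V x) y = ip A x (W y))

@[simp] theorem compress_apply (T : Adj A Y) (x : X) : compress V W h T x = W (T (V x)) := rfl

theorem compress_star (T : Adj A Y) : compress V W h (star T) = star (compress V W h T) :=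
  (Adj.star_eq_of fun x y => by
    rw [compress_apply, compress_apply, ← h, Adj.ip_star_right, ← star_ip, ← h, star_ip]).symm

theorem adjoint_map_rmul {V : X →L[ℂ] Y} {W : Y →L[ℂ] X}
    (h : ∀ x y, ip A (V x) y = ip A x (W y)) (x : X) (a : A) : V (rmul x a) = rmul (V x) a :=
  ip_ext (A := A) fun z => by
    rw [← star_ip, h, star_ip, ip_rmul_right, ip_rmul_right, ← star_ip x (W z), ← h, star_ip]

theorem compress_theta (ξ η : Y) : compress V W h (theta A ξ η) = theta A (W ξ) (W η) :=
  Adj.ext fun x => by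
    -- The adjoint relation read backwards, so that `adjoint_map_rmul` applies to W as well as to V.
    have h' : ∀ y x, ip A (W y) x = ip A y (V x) := fun y x => by
      rw [← star_ip, ← h, star_ip]
    rw [compress_apply, theta_apply, theta_apply, adjoint_map_rmul h', h']

/-- Compression carries θ_{ξ,η} to θ_{Wξ,Wη} and is continuous and linear. V need not be isometric;
the lemma serves both the summands of the Fock space and the identification E^{⊗1} ≅ E. -/
theorem compress_mem_compacts {T : Adj A Y} (hT : T ∈ compacts A Y) :
    compress V W h T ∈ compacts A X :=
  thetaSpan_induction (p := fun T => compress V W h T ∈ compacts A X)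
    (fun ξ η => by rw [compress_theta]; exact theta_mem_thetaSpan _ _)
    (by rw [map_zero]; exact zero_mem _)
    (fun _ _ h h' => by rw [map_add]; exact add_mem h h')
    (fun c _ h => by rw [map_smul]; exact SMulMemClass.smul_mem c h)
    (isClosed_thetaSpan.preimage (compress V W h).continuous) hT

theorem mul_mem_compacts_left (T : Adj A X) {S : Adj A X} (hS : S ∈ compacts A X) :
    T * S ∈ compacts A X :=
  thetaSpan_induction (p := fun S => T * S ∈ compacts A X)
    (fun ξ η => by rw [mul_theta]; exact theta_mem_thetaSpan _ _)
    (by rw [mul_zero]; exact zero_mem _)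
    (fun _ _ h h' => by rw [mul_add]; exact add_mem h h')
    (fun c _ h => by rw [mul_smul_comm]; exact SMulMemClass.smul_mem c h)
    (isClosed_thetaSpan.preimage (by fun_prop)) hS

theorem mul_mem_compacts_right (T : Adj A X) {S : Adj A X} (hS : S ∈ compacts A X) :
    S * T ∈ compacts A X := by
  have := mul_mem_compacts_left (star T) (star_mem hS)
  rw [← star_mul] at this
  simpa using star_mem this

end Compress

/-! ### Testing without a unit -/

section Basic

variable {A X : Type*} [NonUnitalCStarAlgebra A] [PartialOrder A] [StarOrderedRing A]
  [NormedAddCommGroup X] [NormedSpace ℂ X] [CompleteSpace X] [HilbertModule A X]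

theorem continuous_of_starAlgHom {B C : Type*} [NonUnitalCStarAlgebra B] [NonUnitalCStarAlgebra C]
    (f : B →⋆ₙₐ[ℂ] C) : Continuous f :=
  (AddMonoidHomClass.lipschitz_of_bound f 1
    fun a => by simpa using NonUnitalStarAlgHom.norm_apply_le f a).continuous

/-- The choice c = (a - b)* suffices, so no unit or approximate unit is needed. -/
theorem eq_of_mul_right_eq {a b : A} (h : ∀ c : A, a * c = b * c) : a = b := by
  have : (a - b) * star (a - b) = 0 := by rw [sub_mul, h, sub_self]
  exact sub_eq_zero.1 ((CStarRing.mul_star_self_eq_zero_iff _).1 this)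

/-- Creation operators are evaluated on vectors a ∈ A = E^{⊗0}, which only reveals the multiples ξ
a; this lemma recovers ξ from them. -/
theorem eq_of_rmul_eq {x y : X} (h : ∀ a : A, rmul x a = rmul y a) : x = y :=
  ip_ext fun z => eq_of_mul_right_eq fun a : A => by
    rw [← ip_rmul_right, ← ip_rmul_right, h]

theorem continuous_rmul : Continuous fun p : X × A => rmul p.1 p.2 := by
  have h : Continuous fun p : X × A => LinearMap.mkContinuous₂
      (PreHilbertModule.ract (A := A) (V := X)) 1 (fun a x => (norm_rmul_le x a).trans_eq
        (by rw [one_mul, mul_comm])) p.2 p.1 := by fun_prop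
  exact h

/-- Every vector is a limit of vectors `x a`. -/
theorem mem_closure_rmul (x : X) : x ∈ closure (Set.range fun a : A => rmul x a) := by
  have hl := CStarAlgebra.increasingApproximateUnit A
  have := hl.neBot
  refine mem_closure_of_tendsto (b := CStarAlgebra.approximateUnit A) (f := fun e => rmul x e) ?_
    (Filter.Eventually.of_forall fun e => ⟨e, rfl⟩)
  rw [tendsto_iff_norm_sub_tendsto_zero]
  -- The quantity is ⟨xe - x, xe - x⟩ expanded. Both brackets are governed by ⟨x, x⟩ e - ⟨x, x⟩, the
  -- first because ‖e‖ ≤ 1 eventually; hence the factor 2.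
  have hc : Filter.Tendsto (fun e : A => ‖(star e * ip A x x * e - star e * ip A x x) -
      (ip A x x * e - ip A x x)‖) (CStarAlgebra.approximateUnit A) (nhds 0) := by
    have h1 := hl.tendsto_mul_left (ip A x x)
    have h2 := tendsto_iff_norm_sub_tendsto_zero.1 h1
    refine squeeze_zero' (Filter.Eventually.of_forall fun _ => norm_nonneg _)
      (g := fun e => 2 * ‖ip A x x * e - ip A x x‖) ?_ (by simpa using h2.const_mul 2)
    filter_upwards [hl.eventually_norm] with e he
    have e1 : star e * ip A x x * e - star e * ip A x x = star e * (ip A x x * e - ip A x x) := by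
      rw [mul_sub, mul_assoc]
    rw [e1]
    refine (norm_sub_le _ _).trans ?_
    have := norm_mul_le (star e) (ip A x x * e - ip A x x)
    rw [norm_star] at this
    nlinarith [norm_nonneg (ip A x x * e - ip A x x)]
  have h3 : ∀ e : A, ‖rmul x e - x‖ = √‖(star e * ip A x x * e - star e * ip A x x) -
      (ip A x x * e - ip A x x)‖ := by
    intro e
    rw [← Real.sqrt_sq (norm_nonneg (rmul x e - x)), norm_sq_eq_ip A]
    congr 2
    simp only [ip_sub_left, ip_sub_right, ip_rmul_left, ip_rmul_right, sub_mul, mul_assoc]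
    abel
  simp only [h3]
  simpa using hc.sqrt

end Basic

/-! ### The grading of the Fock space -/

section Grading

variable {A E : Type u} [NonUnitalCStarAlgebra A] [PartialOrder A] [StarOrderedRing A]
  [NormedAddCommGroup E] [NormedSpace ℂ E] [CompleteSpace E] [HilbertModule A E]
  (φ : A →⋆ₙₐ[ℂ] Adj A E)

/-- The projection of the algebraic Fock space onto the `m`-th summand. -/
def component (m : ℕ) : (algFock φ).carrier →ₗ[ℂ] (PreCorr.tpow φ m).carrier :=
  DirectSum.component ℂ ℕ (fun n => (PreCorr.tpow φ n).carrier) m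

theorem component_single_same (m : ℕ) (x : (PreCorr.tpow φ m).carrier) :
    component φ m (single φ m x) = x :=
  DirectSum.lof_apply (M := fun n => (PreCorr.tpow φ n).carrier) ℂ m x

theorem component_single_ne {m n : ℕ} (h : m ≠ n) (x : (PreCorr.tpow φ m).carrier) :
    component φ n (single φ m x) = 0 :=
  DirectSum.of_eq_of_ne (β := fun n => (PreCorr.tpow φ n).carrier) m n x h.symm

theorem ip_single (m : ℕ) (x : (PreCorr.tpow φ m).carrier) (y : (algFock φ).carrier) :
    ip A (single φ m x) y = ip A x (component φ m y) := by
  induction y using algFock_induction φ with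
  | h0 => rw [map_zero, ip_zero_right, ip_zero_right]
  | ha y y' hy hy' => rw [map_add, ip_add_right, ip_add_right, hy, hy']
  | hs n y =>
    rcases eq_or_ne m n with rfl | h
    · rw [ip_single_same, component_single_same]
    · rw [ip_single_ne φ h, component_single_ne φ h.symm, ip_zero_right]

theorem norm_toCompl_single (m : ℕ) (x : (PreCorr.tpow φ m).carrier) :
    ‖toCompl A (single φ m x)‖ = ‖toCompl A x‖ := by
  refine (sq_eq_sq₀ (norm_nonneg _) (norm_nonneg _)).1 ?_
  rw [norm_toCompl_sq, norm_toCompl_sq, ip_single_same]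

/-- The component map is adjoint to the isometric inclusion, so Cauchy-Schwarz makes it a
contraction. This bound is what extends it to the completion. -/
theorem norm_toCompl_component (m : ℕ) (y : (algFock φ).carrier) :
    ‖toCompl A (component φ m y)‖ ≤ ‖toCompl A y‖ := by
  have h : ‖toCompl A (component φ m y)‖ ^ 2 ≤
      ‖toCompl A (component φ m y)‖ * ‖toCompl A y‖ := by
    rw [norm_toCompl_sq, ← ip_single, ← norm_toCompl_single φ m]
    exact norm_ip_le_toCompl _ _
  nlinarith [norm_nonneg (toCompl A (component φ m y)), norm_nonneg (toCompl A y)]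

/-- The inclusion of `E^{⊗m}` in the Fock space. -/
def incl (m : ℕ) : TensorPow φ m →L[ℂ] Fock φ :=
  ((toCompl A).comp (single φ m)).extendOfNorm (toCompl A)

/-- The projection of the Fock space onto `E^{⊗m}`. -/
def proj (m : ℕ) : Fock φ →L[ℂ] TensorPow φ m :=
  ((toCompl A).comp (component φ m)).extendOfNorm (toCompl A)

@[simp] theorem incl_toCompl (m : ℕ) (x : (PreCorr.tpow φ m).carrier) :
    incl φ m (toCompl A x) = toCompl A (single φ m x) :=
  LinearMap.extendOfNorm_eq denseRange_toCompl
    ⟨1, fun x => ((norm_toCompl_single φ m x).trans (one_mul _).symm).le⟩ x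

@[simp] theorem proj_toCompl (m : ℕ) (y : (algFock φ).carrier) :
    proj φ m (toCompl A y) = toCompl A (component φ m y) :=
  LinearMap.extendOfNorm_eq denseRange_toCompl
    ⟨1, fun y => (norm_toCompl_component φ m y).trans_eq (one_mul _).symm⟩ y

theorem ip_incl (m : ℕ) (x : TensorPow φ m) (y : Fock φ) :
    ip A (incl φ m x) y = ip A x (proj φ m y) := by
  refine denseRange_toCompl.induction_on (p := fun x : TensorPow φ m =>
    ip A (incl φ m x) y = ip A x (proj φ m y)) x ?_ fun x => ?_
  · exact isClosed_eq (continuous_ip.comp (by fun_prop : Continuous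
      fun x : TensorPow φ m => (incl φ m x, y)))
      (continuous_ip.comp (by fun_prop : Continuous fun x : TensorPow φ m => (x, proj φ m y)))
  · refine denseRange_toCompl.induction_on (p := fun y : Fock φ =>
      ip A (incl φ m (toCompl A x)) y = ip A (toCompl A x) (proj φ m y)) y ?_ fun y => ?_
    · exact isClosed_eq (continuous_ip.comp (by fun_prop : Continuous
        fun y : Fock φ => (incl φ m (toCompl A x), y)))
        (continuous_ip.comp (by fun_prop : Continuous
          fun y : Fock φ => (toCompl A x, proj φ m y)))
    · rw [incl_toCompl, proj_toCompl, ip_toCompl, ip_toCompl, ip_single]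

theorem ip_proj (m : ℕ) (y : Fock φ) (x : TensorPow φ m) :
    ip A (proj φ m y) x = ip A y (incl φ m x) := by
  rw [← star_ip, ← ip_incl, star_ip]

@[simp] theorem proj_incl (m : ℕ) (x : TensorPow φ m) : proj φ m (incl φ m x) = x :=
  denseRange_toCompl.induction_on (p := fun x : TensorPow φ m => proj φ m (incl φ m x) = x) x
    (isClosed_eq (by fun_prop) (by fun_prop)) fun x => by
      rw [incl_toCompl, proj_toCompl, component_single_same]

/-- Operators on the Fock space which agree on all summands are equal. -/
theorem fock_ext {S T : Adj A (Fock φ)} (h : ∀ m x, S (incl φ m x) = T (incl φ m x)) : S = T :=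
  Adj.ext_toCompl fun v => by
    induction v using algFock_induction φ with
    | h0 => simp only [map_zero]
    | ha x y hx hy => simp only [map_add, hx, hy]
    | hs m x => rw [← incl_toCompl, h]

/-- The compression of operators on the Fock space to `E^{⊗m}`. -/
def rho (m : ℕ) : Adj A (Fock φ) →L[ℂ] Adj A (TensorPow φ m) :=
  compress (incl φ m) (proj φ m) (ip_incl φ m)

@[simp] theorem rho_apply (m : ℕ) (T : Adj A (Fock φ)) (x : TensorPow φ m) :
    rho φ m T x = proj φ m (T (incl φ m x)) := rfl

theorem rho_star (m : ℕ) (T : Adj A (Fock φ)) : rho φ m (star T) = star (rho φ m T) :=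
  compress_star _ T

/-- The orthogonal projection onto the `m`-th summand of the Fock space. -/
def level (m : ℕ) : Adj A (Fock φ) :=
  Adj.mk (incl φ m ∘L proj φ m) (incl φ m ∘L proj φ m) fun x y => by
    change ip A (incl φ m (proj φ m x)) y = ip A x (incl φ m (proj φ m y))
    rw [ip_incl, ip_proj]

theorem level_apply (m : ℕ) (x : Fock φ) : level φ m x = incl φ m (proj φ m x) := rfl

@[simp] theorem level_incl (m : ℕ) (x : TensorPow φ m) :
    level φ m (incl φ m x) = incl φ m x := by rw [level_apply, proj_incl]

@[simp] theorem star_level (m : ℕ) : star (level φ m) = level φ m :=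
  Adj.ext fun x => Adj.star_mk _ _ _ x

theorem level_single_same (m : ℕ) (x : (PreCorr.tpow φ m).carrier) :
    level φ m (toCompl A (single φ m x)) = toCompl A (single φ m x) := by
  rw [level_apply, proj_toCompl, incl_toCompl, component_single_same]

theorem level_single_ne {m n : ℕ} (h : m ≠ n) (x : (PreCorr.tpow φ m).carrier) :
    level φ n (toCompl A (single φ m x)) = 0 := by
  rw [level_apply, proj_toCompl, component_single_ne φ h, map_zero, map_zero]

theorem level_mul_fockAction (m : ℕ) (a : A) :
    level φ m * fockAction φ a = fockAction φ a * level φ m :=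
  Adj.ext_toCompl fun v => by
    induction v using algFock_induction φ with
    | h0 => simp only [map_zero]
    | ha x y hx hy => simp only [map_add, hx, hy]
    | hs n x =>
      rw [Adj.mul_apply, Adj.mul_apply, PreCorr.leftAction_toCompl, lact_single]
      rcases eq_or_ne n m with rfl | h
      · rw [level_single_same, level_single_same, PreCorr.leftAction_toCompl, lact_single]
      · rw [level_single_ne φ h, level_single_ne φ h, map_zero]

theorem level_succ_mul_creation (m : ℕ) (ξ : E) :
    level φ (m + 1) * creation φ ξ = creation φ ξ * level φ m :=
  Adj.ext_toCompl fun v => by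
    induction v using algFock_induction φ with
    | h0 => simp only [map_zero]
    | ha x y hx hy => simp only [map_add, hx, hy]
    | hs n x =>
      rw [Adj.mul_apply, Adj.mul_apply, creation_toCompl, createAlg_single]
      rcases eq_or_ne n m with rfl | h
      · rw [level_single_same, level_single_same, creation_toCompl, createAlg_single]
      · rw [level_single_ne φ h, level_single_ne φ (by omega), map_zero]

theorem level_zero_mul_creation (ξ : E) : level φ 0 * creation φ ξ = 0 :=
  Adj.ext_toCompl fun v => by
    induction v using algFock_induction φ with
    | h0 => simp only [map_zero]
    | ha x y hx hy => simp only [map_add, hx, hy]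
    | hs n x =>
      rw [Adj.mul_apply, creation_toCompl, createAlg_single, level_single_ne φ (by omega)]
      rfl

/-- Identities between operators which are continuous and linear in the creation operator of a
tensor need only be checked on algebraic tensors. -/
theorem creationTensor_induction (n : ℕ) {p : Adj A (Fock φ) → Prop}
    (hp : IsClosed {S | p S}) (h : ∀ x, p (creationAlg φ n x)) (ξ : TensorPow φ n) :
    p (creationTensor φ n ξ) :=
  denseRange_toCompl.induction_on (p := fun ξ : TensorPow φ n => p (creationTensor φ n ξ)) ξ
    (hp.preimage (creationTensor φ n).continuous) fun x => by
      rw [creationTensor_toCompl]; exact h x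

/-- T_ξ raises the degree by n: the left action has degree 0, each creation operator has degree 1,
and T of an elementary tensor is a product of these. -/
theorem level_add_mul_creationTensor (n m : ℕ) (ξ : TensorPow φ n) :
    level φ (m + n) * creationTensor φ n ξ = creationTensor φ n ξ * level φ m := by
  refine creationTensor_induction φ n (p := fun S => level φ (m + n) * S = S * level φ m)
    (isClosed_eq (by fun_prop) (by fun_prop)) (fun x => ?_) ξ
  induction n with
  | zero => exact level_mul_fockAction φ m x
  | succ n ih =>
    induction x using tpow_succ_induction φ n with
    | h0 => simp
    | ha x y hx hy => rw [map_add, mul_add, add_mul, hx, hy]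
    | ht η x =>
      rw [creationAlg_tmul, ← mul_assoc, ← add_assoc, level_succ_mul_creation, mul_assoc, mul_assoc,
        ih 0]

/-- Raising the degree by n leaves nothing below level n. -/
theorem level_mul_creationTensor_of_lt {n m : ℕ} (h : m < n) (ξ : TensorPow φ n) :
    level φ m * creationTensor φ n ξ = 0 := by
  refine creationTensor_induction φ n (p := fun S => level φ m * S = 0)
    (isClosed_eq (by fun_prop) (by fun_prop)) (fun x => ?_) ξ
  induction n generalizing m with
  | zero => omega
  | succ n ih =>
    induction x using tpow_succ_induction φ n with
    | h0 => simp
    | ha x y hx hy => rw [map_add, mul_add, hx, hy, add_zero]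
    | ht η x =>
      rw [creationAlg_tmul, ← mul_assoc]
      rcases m with _ | m
      · rw [level_zero_mul_creation, zero_mul]
      · rw [level_succ_mul_creation, mul_assoc, ih (by omega) 0, mul_zero]

theorem star_creationTensor_mul_level_of_lt {n m : ℕ} (h : m < n) (ξ : TensorPow φ n) :
    star (creationTensor φ n ξ) * level φ m = 0 := by
  have := congrArg star (level_mul_creationTensor_of_lt φ h ξ)
  simpa using this

theorem star_creationTensor_mul_level (n m : ℕ) (ξ : TensorPow φ n) :
    star (creationTensor φ n ξ) * level φ (m + n) = level φ m * star (creationTensor φ n ξ) := by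
  have := congrArg star (level_add_mul_creationTensor φ n m ξ)
  simpa using this

/-- T_η* lowers the degree by n and T_ξ raises it again; below level n both sides are zero. This is
the origin of the block diagonal form of F_E. -/
theorem level_mul_creation_mul_star (n m : ℕ) (ξ η : TensorPow φ n) :
    level φ m * (creationTensor φ n ξ * star (creationTensor φ n η)) =
      creationTensor φ n ξ * star (creationTensor φ n η) * level φ m := by
  rcases lt_or_ge m n with h | h
  · rw [← mul_assoc, level_mul_creationTensor_of_lt φ h, mul_assoc,
      star_creationTensor_mul_level_of_lt φ h, zero_mul, mul_zero]
  · obtain ⟨k, rfl⟩ := Nat.exists_eq_add_of_le' h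
    rw [← mul_assoc, level_add_mul_creationTensor, mul_assoc, mul_assoc,
      star_creationTensor_mul_level]

/-- The element `a` of `A = E^{⊗0}`. -/
def base (a : A) : (PreCorr.tpow φ 0).carrier := a

/-- The carrier of degree 0 is A only by unfolding; naming its elements through `base` lets the
rewriting lemmas apply. -/
theorem exists_base (x : (PreCorr.tpow φ 0).carrier) : ∃ a, x = base φ a := ⟨x, rfl⟩

theorem creationAlg_base (a : A) : creationAlg φ 0 (base φ a) = fockAction φ a := rfl

theorem lact_base (a b : A) : (PreCorr.tpow φ 0).lact a (base φ b) = base φ (a * b) := rfl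

theorem rmul_base (a b : A) : rmul (base φ a) b = base φ (a * b) := rfl

theorem ip_base (a b : A) : ip A (base φ a) (base φ b) = star a * b := rfl

/-- The creation operator of `ξ ∈ E^{⊗n}` sends `a ∈ A = E^{⊗0}` to `ξ a`. -/
theorem creationTensor_incl_zero (n : ℕ) (ξ : TensorPow φ n) (a : A) :
    creationTensor φ n ξ (incl φ 0 (toCompl A (base φ a))) =
      incl φ n (rmul ξ a) := by
  refine denseRange_toCompl.induction_on (p := fun ξ : TensorPow φ n =>
    creationTensor φ n ξ (incl φ 0 (toCompl A (base φ a))) =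
      incl φ n (rmul ξ a)) ξ (isClosed_eq ?_ ?_) fun x => ?_
  · have : Continuous fun ξ : TensorPow φ n => Adj.toCLM (creationTensor φ n ξ) :=
      (continuous_subtype_val (p := fun T => T ∈ adjointable A (Fock φ))).comp
        (creationTensor φ n).continuous
    fun_prop
  · exact (incl φ n).continuous.comp
      (continuous_rmul.comp (by fun_prop : Continuous fun ξ : TensorPow φ n => (ξ, a)))
  · rw [creationTensor_toCompl, incl_toCompl]
    have e : rmul (toCompl A x) a = toCompl A (rmul x a) := complRact_toCompl a x
    rw [e, incl_toCompl]
    induction n with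
    | zero =>
      obtain ⟨b, hb⟩ := exists_base φ x
      rw [hb, creationAlg_base, PreCorr.leftAction_toCompl, lact_single, lact_base, rmul_base]
    | succ n ih =>
      induction x using tpow_succ_induction φ n with
      | h0 => simp [rmul]
      | ha x y hx hy =>
        -- The equation `e` mentions the vector, so the induction turns it into a premise, to be
        -- supplied for each summand.
        have e1 := complRact_toCompl (A := A) a x
        have e2 := complRact_toCompl (A := A) a y
        rw [map_add, Adj.add_apply, hx e1, hy e2]
        simp only [rmul, map_add]
      | ht η x =>
        rw [creationAlg_tmul, Adj.mul_apply, ih 0 x (complRact_toCompl a x), creation_toCompl,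
          createAlg_single]
        rfl

/-- On `E^{⊗n}` the operator `T_ξ T_η*` is the rank one operator `θ_{ξ, η}`. -/
theorem creation_mul_star_mul_level (n : ℕ) (ξ η : TensorPow φ n) :
    creationTensor φ n ξ * star (creationTensor φ n η) * level φ n =
      theta A (incl φ n ξ) (incl φ n η) := by
  have h0 := star_creationTensor_mul_level φ n 0 η
  rw [zero_add] at h0
  rw [mul_assoc, h0]
  refine Adj.ext fun y => ?_
  rw [Adj.mul_apply, Adj.mul_apply, level_apply, theta_apply]
  -- On its degree 0 part T_η* y is the element ⟨η, y⟩ of A: pairing with b ∈ A gives ⟨T_η b, y⟩ =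
  -- ⟨η b, y⟩ = b* ⟨η, y⟩.
  have key : proj φ 0 (star (creationTensor φ n η) y) =
      toCompl A (base φ (ip A (incl φ n η) y)) := by
    refine ip_ext (A := A) fun z => ?_
    refine denseRange_toCompl.induction_on (p := fun z : TensorPow φ 0 =>
      ip A z (proj φ 0 (star (creationTensor φ n η) y)) =
      ip A z (toCompl A (base φ (ip A (incl φ n η) y)))) z
      (isClosed_eq
        (continuous_ip.comp (by fun_prop : Continuous fun z : TensorPow φ 0 => (z, _)))
        (continuous_ip.comp (by fun_prop : Continuous fun z : TensorPow φ 0 => (z, _))))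
      fun z => ?_
    obtain ⟨b, hb⟩ := exists_base φ z
    rw [hb, ← ip_incl, Adj.ip_star_right, creationTensor_incl_zero, ip_toCompl, ip_base,
      adjoint_map_rmul (ip_incl φ n), ip_rmul_left]
  rw [key, creationTensor_incl_zero, adjoint_map_rmul (ip_incl φ n)]

theorem rho_creation_mul_star (n : ℕ) (ξ η : TensorPow φ n) :
    rho φ n (creationTensor φ n ξ * star (creationTensor φ n η)) = theta A ξ η :=
  Adj.ext fun x => by
    rw [rho_apply, ← level_incl, ← Adj.mul_apply, creation_mul_star_mul_level, theta_apply,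
      theta_apply, ← adjoint_map_rmul (ip_incl φ n), proj_incl, ip_incl, proj_incl]

/-- T_η* annihilates all levels below its degree. -/
theorem rho_creation_mul_star_of_lt {n m : ℕ} (h : m < n) (ξ η : TensorPow φ n) :
    rho φ m (creationTensor φ n ξ * star (creationTensor φ n η)) = 0 :=
  Adj.ext fun x => by
    rw [rho_apply, ← level_incl, ← Adj.mul_apply, mul_assoc,
      star_creationTensor_mul_level_of_lt φ h, mul_zero, Adj.zero_apply, map_zero, Adj.zero_apply]

end Grading

/-! ### Creation operators as an isometric image of the tensor powers -/

section Products

variable {A E : Type u} [NonUnitalCStarAlgebra A] [PartialOrder A] [StarOrderedRing A]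
  [NormedAddCommGroup E] [NormedSpace ℂ E] [CompleteSpace E] [HilbertModule A E]
  (φ : A →⋆ₙₐ[ℂ] Adj A E)

theorem incl_injective (m : ℕ) : Function.Injective (incl φ m) :=
  Function.LeftInverse.injective (proj_incl φ m)

theorem fockAction_incl_base (a b : A) : fockAction φ a (incl φ 0 (toCompl A (base φ b))) =
    incl φ 0 (toCompl A (base φ (a * b))) := by
  rw [incl_toCompl, PreCorr.leftAction_toCompl, lact_single, lact_base, incl_toCompl]

theorem toCompl_base_injective : Function.Injective fun a : A => toCompl A (base φ a) := by
  refine fun a b h => star_injective (eq_of_mul_right_eq fun c => ?_)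
  rw [← ip_base φ a, ← ip_base φ b, ← ip_toCompl (base φ a), ← ip_toCompl (base φ b)]
  exact congrArg (fun z => ip A z (toCompl A (base φ c))) h

/-- Already on the summand E^{⊗0} = A the action is left multiplication, which is faithful. -/
theorem fockAction_injective : Function.Injective (fockAction φ) := fun a b h =>
  eq_of_mul_right_eq fun c => toCompl_base_injective φ (incl_injective φ 0 (by
    simp only [← fockAction_incl_base, h]))

/-- T_ξ* T_ξ is the left action of ⟨ξ, ξ⟩, and the faithful left action is isometric. As a
consequence the set of all T_ξ of degree n is closed, and membership in it passes to limits. -/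
theorem norm_creationTensor (n : ℕ) (ξ : TensorPow φ n) : ‖creationTensor φ n ξ‖ = ‖ξ‖ := by
  refine (sq_eq_sq₀ (norm_nonneg _) (norm_nonneg _)).1 ?_
  rw [sq, ← CStarRing.norm_star_mul_self, star_creationTensor_mul,
    norm_map_of_injective _ (fockAction_injective φ), norm_sq_eq_ip A]

/-- The creation operators of the elements of `E^{⊗n}`. -/
def creationRange (n : ℕ) : Submodule ℂ (Adj A (Fock φ)) :=
  LinearMap.range (creationTensor φ n).toLinearMap

theorem creationTensor_mem (n : ℕ) (ξ : TensorPow φ n) :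
    creationTensor φ n ξ ∈ creationRange φ n := ⟨ξ, rfl⟩

theorem creationAlg_mem (n : ℕ) (x : (PreCorr.tpow φ n).carrier) :
    creationAlg φ n x ∈ creationRange φ n := ⟨toCompl A x, creationTensor_toCompl φ n x⟩

theorem isClosed_creationRange (n : ℕ) : IsClosed (creationRange φ n : Set (Adj A (Fock φ))) :=
  (AddMonoidHomClass.isometry_of_norm (creationTensor φ n)
    (norm_creationTensor φ n)).isClosedEmbedding.isClosed_range

theorem fockAction_mul_mem (a : A) (n : ℕ) {S : Adj A (Fock φ)} (hS : S ∈ creationRange φ n) :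
    fockAction φ a * S ∈ creationRange φ n := by
  obtain ⟨ξ, rfl⟩ := hS
  refine creationTensor_induction φ n (p := fun S => fockAction φ a * S ∈ creationRange φ n)
    ((isClosed_creationRange φ n).preimage (by fun_prop)) (fun x => ?_) ξ
  rw [fockAction_mul_creationAlg]
  exact creationAlg_mem φ n _

theorem creation_mul_mem (ξ : E) (n : ℕ) {S : Adj A (Fock φ)} (hS : S ∈ creationRange φ n) :
    creation φ ξ * S ∈ creationRange φ (n + 1) := by
  obtain ⟨η, rfl⟩ := hS
  refine creationTensor_induction φ n (p := fun S => creation φ ξ * S ∈ creationRange φ (n + 1))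
    ((isClosed_creationRange φ (n + 1)).preimage (by fun_prop)) (fun x => ?_) η
  rw [← creationAlg_tmul]
  exact creationAlg_mem φ (n + 1) _

/-- The first factors cancel: T_{ξ⊗x} T_{η⊗y}* T_{ζ⊗z} = T_ξ (T_x T_y* T_{⟨η,ζ⟩z}), where the
bracket is the same statement one degree lower. At k = 0 only the left action of A remains. -/
theorem creationAlg_mul_mem (k n : ℕ) (x y : (PreCorr.tpow φ k).carrier)
    (z : (PreCorr.tpow φ (n + k)).carrier) :
    creationAlg φ k x * star (creationAlg φ k y) * creationAlg φ (n + k) z ∈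
      creationRange φ (n + k) := by
  induction k with
  | zero =>
    obtain ⟨a, ha⟩ := exists_base φ x
    obtain ⟨b, hb⟩ := exists_base φ y
    rw [ha, hb, creationAlg_base, creationAlg_base, ← map_star, ← map_mul]
    exact fockAction_mul_mem φ _ _ (creationAlg_mem φ _ z)
  | succ k ih =>
    induction x using tpow_succ_induction φ k with
    | h0 => rw [map_zero, zero_mul, zero_mul]; exact zero_mem _
    | ha x x' hx hx' => rw [map_add, add_mul, add_mul]; exact add_mem hx hx'
    | ht ξ x =>
      induction y using tpow_succ_induction φ k with
      | h0 => rw [map_zero, star_zero, mul_zero, zero_mul]; exact zero_mem _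
      | ha y y' hy hy' => rw [map_add, star_add, mul_add, add_mul]; exact add_mem hy hy'
      | ht η y =>
        induction z using tpow_succ_induction φ (n + k) with
        | h0 => rw [map_zero, mul_zero]; exact zero_mem _
        | ha z z' hz hz' => rw [map_add, mul_add]; exact add_mem hz hz'
        | ht ζ z =>
          have e : creationAlg φ (k + 1) (tmulLeft φ ξ k x) *
              star (creationAlg φ (k + 1) (tmulLeft φ η k y)) *
              creationAlg φ (n + k + 1) (tmulLeft φ ζ (n + k) z) =
              creation φ ξ * (creationAlg φ k x * star (creationAlg φ k y) *
                creationAlg φ (n + k) ((PreCorr.tpow φ (n + k)).lact (ip A η ζ) z)) := by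
            rw [creationAlg_tmul, creationAlg_tmul, creationAlg_tmul, star_mul,
              ← fockAction_mul_creationAlg, ← star_creation_mul]
            simp only [mul_assoc]
          exact e ▸ creation_mul_mem φ ξ _ (ih _ _ _)

theorem creation_mul_star_mul_mem {k n : ℕ} (h : k ≤ n) (ξ η : TensorPow φ k)
    {S : Adj A (Fock φ)} (hS : S ∈ creationRange φ n) :
    creationTensor φ k ξ * star (creationTensor φ k η) * S ∈ creationRange φ n := by
  obtain ⟨m, rfl⟩ := Nat.exists_eq_add_of_le' h
  obtain ⟨ζ, rfl⟩ := hS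
  have hc := isClosed_creationRange φ (m + k)
  -- The algebraic case extends to the completed tensor powers in one variable at a time, each time
  -- by closedness of the range.
  refine creationTensor_induction φ k (p := fun S =>
    S * star (creationTensor φ k η) * creationTensor φ (m + k) ζ ∈ creationRange φ (m + k))
    (hc.preimage (by fun_prop)) (fun x => ?_) ξ
  refine creationTensor_induction φ k (p := fun S =>
    creationAlg φ k x * star S * creationTensor φ (m + k) ζ ∈ creationRange φ (m + k))
    (hc.preimage (by fun_prop)) (fun y => ?_) η
  refine creationTensor_induction φ (m + k) (p := fun S =>
    creationAlg φ k x * star (creationAlg φ k y) * S ∈ creationRange φ (m + k))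
    (hc.preimage (by fun_prop)) (fun z => ?_) ζ
  exact creationAlg_mul_mem φ k m x y z

/-! ### Products of generators and closed linear spans -/

/-- The operators `T_ξ T_η*` with `ξ, η ∈ E^{⊗k}`, `k ∈ I`. -/
def coreSet (I : Set ℕ) : Set (Adj A (Fock φ)) :=
  {R | ∃ k ∈ I, ∃ ξ η : TensorPow φ k, R = creationTensor φ k ξ * star (creationTensor φ k η)}

/-- The factor of higher degree absorbs the other: if k ≤ l, then T_ξ T_η* T_ζ is a single T_ζ', and
if l ≤ k the same holds for the adjoints. The product is a generator itself, not just a combination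
of generators. -/
theorem mul_mem_coreSet {k l : ℕ} (ξ η : TensorPow φ k) (ζ ω : TensorPow φ l) :
    creationTensor φ k ξ * star (creationTensor φ k η) *
      (creationTensor φ l ζ * star (creationTensor φ l ω)) ∈ coreSet φ {max k l} := by
  rcases le_total k l with h | h
  · obtain ⟨ζ', hζ'⟩ := creation_mul_star_mul_mem φ h ξ η (creationTensor_mem φ l ζ)
    refine ⟨l, (max_eq_right h).symm, ζ', ω, ?_⟩
    rw [← mul_assoc, ← hζ']
    rfl
  · obtain ⟨η', hη'⟩ := creation_mul_star_mul_mem φ h ω ζ (creationTensor_mem φ k η)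
    refine ⟨k, (max_eq_left h).symm, ξ, η', ?_⟩
    have e : creationTensor φ k η' =
      creationTensor φ l ω * star (creationTensor φ l ζ) * creationTensor φ k η := hη'
    rw [e]
    simp only [star_mul, star_star, mul_assoc]

/-- The C*-algebra generated by the `T_ξ T_η*` with `ξ, η ∈ E^{⊗k}`, `k ∈ I`. -/
def coreAlg (I : Set ℕ) : NonUnitalStarSubalgebra ℂ (Adj A (Fock φ)) := cstarGen (coreSet φ I)

theorem isClosed_coreAlg (I : Set ℕ) : IsClosed (coreAlg φ I : Set (Adj A (Fock φ))) :=
  NonUnitalStarSubalgebra.isClosed_topologicalClosure _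

variable {φ}

theorem coreSet_mono {I I' : Set ℕ} (h : I ⊆ I') : coreSet φ I ⊆ coreSet φ I' := by
  rintro R ⟨k, hk, ξ, η, rfl⟩
  exact ⟨k, h hk, ξ, η, rfl⟩

theorem subset_cstarGen {B : Type*} [CStarAlgebra B] (s : Set B) : s ⊆ cstarGen s :=
  (NonUnitalStarAlgebra.subset_adjoin ℂ s).trans
    (NonUnitalStarSubalgebra.le_topologicalClosure _)

theorem cstarGen_le {B : Type*} [CStarAlgebra B] {s : Set B} {S : NonUnitalStarSubalgebra ℂ B}
    (hS : IsClosed (S : Set B)) (h : s ⊆ S) : cstarGen s ≤ S :=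
  NonUnitalStarSubalgebra.topologicalClosure_minimal _ (NonUnitalStarAlgebra.adjoin_le h) hS

theorem mem_coreAlg {I : Set ℕ} {k : ℕ} (hk : k ∈ I) (ξ η : TensorPow φ k) :
    creationTensor φ k ξ * star (creationTensor φ k η) ∈ coreAlg φ I :=
  subset_cstarGen _ ⟨k, hk, ξ, η, rfl⟩

theorem coreAlg_mono {I I' : Set ℕ} (h : I ⊆ I') : coreAlg φ I ≤ coreAlg φ I' :=
  cstarGen_le (isClosed_coreAlg φ I') ((coreSet_mono h).trans (subset_cstarGen _))

theorem closure_span_induction {B : Type*} [NormedAddCommGroup B] [NormedSpace ℂ B] {s : Set B}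
    (p : Submodule ℂ B) (hp : IsClosed (p : Set B)) (h : s ⊆ p) {x : B}
    (hx : x ∈ (Submodule.span ℂ s).topologicalClosure) : x ∈ p :=
  Submodule.topologicalClosure_minimal _ (Submodule.span_le.2 h) hp hx

/-- The C*-algebra generated by a set which is closed under products and adjoints is its closed
linear span. -/
theorem cstarGen_induction {B : Type*} [CStarAlgebra B] {s : Set B}
    (hmul : ∀ x ∈ s, ∀ y ∈ s, x * y ∈ s) (hstar : ∀ x ∈ s, star x ∈ s)
    (p : Submodule ℂ B) (hp : IsClosed (p : Set B)) (h : s ⊆ p) {x : B}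
    (hx : x ∈ cstarGen s) : x ∈ p := by
  set M := (Submodule.span ℂ s).topologicalClosure with hM
  have hMc : IsClosed (M : Set B) := Submodule.isClosed_topologicalClosure _
  have hsM : s ⊆ M := Submodule.subset_span.trans (Submodule.le_topologicalClosure _)
  -- Closure of M under products, first with the left factor in s and then with both factors in M,
  -- by separate continuity.
  have h1 : ∀ x ∈ s, ∀ y ∈ M, x * y ∈ M := fun x hx y hy =>
    closure_span_induction (M.comap (LinearMap.mulLeft ℂ x))
      (hMc.preimage (continuous_const.mul continuous_id)) (fun y hy => hsM (hmul x hx y hy)) hy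
  have h2 : ∀ x ∈ M, ∀ y ∈ M, x * y ∈ M := fun x hx y hy =>
    closure_span_induction (M.comap (LinearMap.mulRight ℂ y))
      (hMc.preimage (continuous_id.mul continuous_const)) (fun x hx => h1 x hx y hy) hx
  have h3 : ∀ x ∈ M, star x ∈ M := fun x hx =>
    closure_span_induction (s := s)
      { carrier := {x | star x ∈ M}
        add_mem' := fun {x y} hx hy => by
          change star (x + y) ∈ M
          rw [star_add]; exact add_mem hx hy
        zero_mem' := by change star (0 : B) ∈ M; rw [star_zero]; exact zero_mem _
        smul_mem' := fun c x hx => by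
          change star (c • x) ∈ M
          rw [star_smul]; exact M.smul_mem _ hx }
      (hMc.preimage continuous_star) (fun x hx => hsM (hstar x hx)) hx
  let S : NonUnitalStarSubalgebra ℂ B :=
    { carrier := M
      add_mem' := M.add_mem
      zero_mem' := M.zero_mem
      smul_mem' := fun c _ => M.smul_mem c
      mul_mem' := fun {x y} hx hy => h2 x hx y hy
      star_mem' := fun {x} hx => h3 x hx }
  exact closure_span_induction p hp h (cstarGen_le (S := S) hMc hsM hx)

/-- The C*-algebra `coreAlg φ I` is the closed linear span of its generators. -/
theorem coreAlg_induction {I : Set ℕ} (p : Submodule ℂ (Adj A (Fock φ)))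
    (hp : IsClosed (p : Set (Adj A (Fock φ))))
    (h : ∀ k ∈ I, ∀ ξ η : TensorPow φ k,
      creationTensor φ k ξ * star (creationTensor φ k η) ∈ p) {x : Adj A (Fock φ)}
    (hx : x ∈ coreAlg φ I) : x ∈ p := by
  refine cstarGen_induction (s := coreSet φ I) ?_ ?_ p hp ?_ hx
  · rintro _ ⟨k, hk, ξ, η, rfl⟩ _ ⟨l, hl, ζ, ω, rfl⟩
    refine coreSet_mono ?_ (mul_mem_coreSet φ ξ η ζ ω)
    rw [Set.singleton_subset_iff]
    rcases max_choice k l with h | h <;> rw [h] <;> assumption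
  · rintro _ ⟨k, hk, ξ, η, rfl⟩
    exact ⟨k, hk, η, ξ, by rw [star_mul, star_star]⟩
  · rintro _ ⟨k, hk, ξ, η, rfl⟩
    exact h k hk ξ η

/-- Generators of degrees k and l ≥ n multiply to one of degree max k l ≥ n. Both factors may be
taken to be generators by linearity and continuity. -/
theorem mul_mem_coreAlg_Ici {I : Set ℕ} {n : ℕ} {x y : Adj A (Fock φ)} (hx : x ∈ coreAlg φ I)
    (hy : y ∈ coreAlg φ (Set.Ici n)) : x * y ∈ coreAlg φ (Set.Ici n) := by
  set J := coreAlg φ (Set.Ici n)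
  have hJ : IsClosed (J : Set (Adj A (Fock φ))) := isClosed_coreAlg φ _
  refine coreAlg_induction (J.toSubmodule.comap (LinearMap.mulRight ℂ y))
    (hJ.preimage (continuous_id.mul continuous_const)) (fun k hk ξ η => ?_) hx
  refine coreAlg_induction (J.toSubmodule.comap (LinearMap.mulLeft ℂ _))
    (hJ.preimage (continuous_const.mul continuous_id)) (fun l hl ζ ω => ?_) hy
  refine subset_cstarGen _ (coreSet_mono ?_ (mul_mem_coreSet φ ξ η ζ ω))
  rw [Set.singleton_subset_iff]
  exact Set.mem_Ici.2 (le_trans (Set.mem_Ici.1 hl) (le_max_right _ _))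

theorem isIdealIn_coreAlg {I : Set ℕ} {n : ℕ} (h : Set.Ici n ⊆ I) :
    IsIdealIn (coreAlg φ (Set.Ici n)) (coreAlg φ I) where
  le := coreAlg_mono h
  mul_mem_left _ hx _ hy := mul_mem_coreAlg_Ici hx hy
  mul_mem_right x hx y hy := by
    have := mul_mem_coreAlg_Ici (star_mem hx) (star_mem hy)
    rw [← star_mul] at this
    simpa using star_mem this

/-! ### Block diagonal form -/

theorem level_mul_of_mem {I : Set ℕ} {x : Adj A (Fock φ)} (hx : x ∈ coreAlg φ I) (m : ℕ) :
    level φ m * x = x * level φ m := by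
  have := coreAlg_induction (LinearMap.ker (LinearMap.mulLeft ℂ (level φ m) -
    LinearMap.mulRight ℂ (level φ m))) (isClosed_eq (by
      change Continuous fun x => level φ m * x - x * level φ m
      fun_prop) continuous_const) (fun k _ ξ η => by
        simp [level_mul_creation_mul_star]) hx
  simpa [sub_eq_zero] using this

theorem apply_incl_of_mem {I : Set ℕ} {x : Adj A (Fock φ)} (hx : x ∈ coreAlg φ I) (m : ℕ)
    (u : TensorPow φ m) : x (incl φ m u) = incl φ m (rho φ m x u) := by
  rw [rho_apply, ← level_apply, ← Adj.mul_apply, level_mul_of_mem hx, Adj.mul_apply, level_incl]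

/-- It is enough that the right factor maps the summand into itself, so nothing is asked of x. -/
theorem rho_mul_of_mem {I : Set ℕ} (x : Adj A (Fock φ)) {y : Adj A (Fock φ)}
    (hy : y ∈ coreAlg φ I) (m : ℕ) :
    rho φ m (x * y) = rho φ m x * rho φ m y :=
  Adj.ext fun u => by
    rw [Adj.mul_apply, rho_apply, Adj.mul_apply, apply_incl_of_mem hy, rho_apply φ m x]

/-- A block diagonal operator is determined by its blocks, as the summands span a dense subspace. -/
theorem eq_zero_of_rho_eq_zero {I : Set ℕ} {x : Adj A (Fock φ)} (hx : x ∈ coreAlg φ I)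
    (h : ∀ m, rho φ m x = 0) : x = 0 :=
  fock_ext φ fun m u => by
    rw [apply_incl_of_mem hx, h, Adj.zero_apply, map_zero, Adj.zero_apply]

theorem rho_eq_zero_of_mem {n m : ℕ} (h : m < n) {x : Adj A (Fock φ)}
    (hx : x ∈ coreAlg φ (Set.Ici n)) : rho φ m x = 0 := by
  have := coreAlg_induction (LinearMap.ker (rho φ m).toLinearMap)
    (isClosed_eq (rho φ m).continuous continuous_const) (fun k hk ξ η =>
      rho_creation_mul_star_of_lt φ (lt_of_lt_of_le h hk) ξ η) hx
  exact this

/-- At level n only the generators of degree exactly n survive, and these act as rank one operators.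
-/
theorem rho_mem_compacts {n : ℕ} {x : Adj A (Fock φ)}
    (hx : x ∈ coreAlg φ (Set.Ici n)) : rho φ n x ∈ compacts A (TensorPow φ n) := by
  have := coreAlg_induction ((compacts A (TensorPow φ n)).toSubmodule.comap (rho φ n).toLinearMap)
    (isClosed_thetaSpan.preimage (rho φ n).continuous) (fun k hk ξ η => by
      change rho φ n _ ∈ compacts A (TensorPow φ n)
      rcases (Set.mem_Ici.1 hk).eq_or_lt with rfl | h
      · rw [rho_creation_mul_star]; exact theta_mem_thetaSpan _ _
      · rw [rho_creation_mul_star_of_lt φ h]; exact zero_mem _) hx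
  exact this

/-- An element of `C_n` acts on the creation operators of `E^{⊗n}`. -/
theorem mul_creationTensor_of_mem {n : ℕ} {x : Adj A (Fock φ)} (hx : x ∈ coreAlg φ (Set.Iic n))
    (ζ : TensorPow φ n) : x * creationTensor φ n ζ = creationTensor φ n (rho φ n x ζ) := by
  have hmem : x * creationTensor φ n ζ ∈ creationRange φ n := by
    have := coreAlg_induction ((creationRange φ n).comap
      (LinearMap.mulRight ℂ (creationTensor φ n ζ)))
      ((isClosed_creationRange φ n).preimage (continuous_id.mul continuous_const))
      (fun k hk ξ η => creation_mul_star_mul_mem φ hk ξ η (creationTensor_mem φ n ζ)) hx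
    exact this
  obtain ⟨ζ', hζ'⟩ := hmem
  have e : creationTensor φ n ζ' = x * creationTensor φ n ζ := hζ'
  rw [← e]
  congr 1
  -- The tensor ζ' with x T_ζ = T_ζ' is identified by applying both operators to a ∈ A = E^{⊗0}:
  -- this gives ζ' a = (x_n ζ) a for all a.
  refine eq_of_rmul_eq (A := A) fun a => incl_injective φ n ?_
  rw [← creationTensor_incl_zero, e, Adj.mul_apply, creationTensor_incl_zero,
    apply_incl_of_mem hx, Adj.map_rmul]

end Products

/-! ### The first tensor power and the descent of vanishing -/

section Kernel

variable {A E : Type u} [NonUnitalCStarAlgebra A] [PartialOrder A] [StarOrderedRing A]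
  [NormedAddCommGroup E] [NormedSpace ℂ E] [CompleteSpace E] [HilbertModule A E]
  (φ : A →⋆ₙₐ[ℂ] Adj A E)

/-- The map `ξ ⊗ a ↦ ξ a` from `E ⊗ A` to `E`. -/
def tensorOneAlg : (PreCorr.tpow φ 1).carrier →ₗ[ℂ] E :=
  TensorProduct.lift (PreHilbertModule.ract (A := A) (V := E)).flip

theorem tensorOneAlg_tmul (ξ : E) (a : A) :
    tensorOneAlg φ (tmulLeft φ ξ 0 (base φ a)) = rmul ξ a := rfl

theorem tpow_one_induction {p : (PreCorr.tpow φ 1).carrier → Prop} (h0 : p 0)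
    (ht : ∀ (ξ : E) (a : A), p (tmulLeft φ ξ 0 (base φ a)))
    (ha : ∀ x y, p x → p y → p (x + y)) (x : (PreCorr.tpow φ 1).carrier) : p x :=
  tpow_succ_induction φ 0 h0 ht ha x

theorem ip_tensorOneAlg (x y : (PreCorr.tpow φ 1).carrier) :
    ip A (tensorOneAlg φ x) (tensorOneAlg φ y) = ip A x y := by
  induction x using tpow_one_induction φ with
  | h0 => rw [map_zero, ip_zero_left, ip_zero_left]
  | ha x x' hx hx' => rw [map_add, ip_add_left, ip_add_left, hx, hx']
  | ht ξ a =>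
    induction y using tpow_one_induction φ with
    | h0 => rw [map_zero, ip_zero_right, ip_zero_right]
    | ha y y' hy hy' => rw [map_add, ip_add_right, ip_add_right, hy, hy']
    | ht η b =>
      rw [tensorOneAlg_tmul, tensorOneAlg_tmul, ip_tmulLeft, contract_tmulLeft, lact_base, ip_base,
        ip_rmul_left, ip_rmul_right]

theorem norm_tensorOneAlg (x : (PreCorr.tpow φ 1).carrier) :
    ‖tensorOneAlg φ x‖ = ‖toCompl A x‖ := by
  refine (sq_eq_sq₀ (norm_nonneg _) (norm_nonneg _)).1 ?_
  rw [norm_toCompl_sq, norm_sq_eq_ip A, ip_tensorOneAlg]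

/-- The bounded operator `ξ ⊗ a ↦ ξ a` from `E^{⊗1}` to `E`. -/
def tensorOneL : TensorPow φ 1 →L[ℂ] E := (tensorOneAlg φ).extendOfNorm (toCompl A)

theorem tensorOneL_toCompl (x : (PreCorr.tpow φ 1).carrier) :
    tensorOneL φ (toCompl A x) = tensorOneAlg φ x :=
  LinearMap.extendOfNorm_eq denseRange_toCompl
    ⟨1, fun x => ((norm_tensorOneAlg φ x).trans (one_mul _).symm).le⟩ x

theorem ip_tensorOneL (x y : TensorPow φ 1) :
    ip A (tensorOneL φ x) (tensorOneL φ y) = ip A x y := by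
  refine denseRange_toCompl.induction_on₂ (p := fun x y : TensorPow φ 1 =>
    ip A (tensorOneL φ x) (tensorOneL φ y) = ip A x y) ?_ (fun x y => ?_) x y
  · exact isClosed_eq (continuous_ip.comp (by fun_prop : Continuous
      fun p : TensorPow φ 1 × TensorPow φ 1 => (tensorOneL φ p.1, tensorOneL φ p.2))) continuous_ip
  · rw [tensorOneL_toCompl, tensorOneL_toCompl, ip_toCompl, ip_tensorOneAlg]

theorem norm_tensorOneL (x : TensorPow φ 1) : ‖tensorOneL φ x‖ = ‖x‖ := by
  refine (sq_eq_sq₀ (norm_nonneg _) (norm_nonneg _)).1 ?_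
  rw [norm_sq_eq_ip A, ip_tensorOneL, ← norm_sq_eq_ip A]

/-- The image contains all ξ a, which accumulate at ξ, and it is closed because the map is
isometric. -/
theorem tensorOneL_surjective : Function.Surjective (tensorOneL φ) := by
  have hcl : IsClosed (Set.range (tensorOneL φ)) :=
    (AddMonoidHomClass.isometry_of_norm (tensorOneL φ)
      (norm_tensorOneL φ)).isClosedEmbedding.isClosed_range
  refine fun ξ => closure_minimal ?_ hcl (mem_closure_rmul (A := A) ξ)
  rintro _ ⟨a, rfl⟩
  exact ⟨toCompl A (tmulLeft φ ξ 0 (base φ a)), tensorOneL_toCompl φ _⟩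

/-- The isomorphism `E^{⊗1} ≅ E`, `ξ ⊗ a ↦ ξ a`. -/
def tensorOne : TensorPow φ 1 ≃ₗᵢ[ℂ] E :=
  LinearIsometryEquiv.ofSurjective ⟨(tensorOneL φ).toLinearMap, norm_tensorOneL φ⟩
    (tensorOneL_surjective φ)

theorem tensorOne_apply (x : TensorPow φ 1) : tensorOne φ x = tensorOneL φ x := rfl

theorem ip_tensorOne_symm (ξ : E) (x : TensorPow φ 1) :
    ip A ((tensorOne φ).symm ξ) x = ip A ξ (tensorOne φ x) := by
  rw [← ip_tensorOneL, ← tensorOne_apply, ← tensorOne_apply, LinearIsometryEquiv.apply_symm_apply]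

theorem tensorOne_rho_fockAction (a : A) (x : TensorPow φ 1) :
    tensorOne φ (rho φ 1 (fockAction φ a) x) = φ a (tensorOne φ x) := by
  simp only [tensorOne_apply, rho_apply]
  refine denseRange_toCompl.induction_on (p := fun x : TensorPow φ 1 =>
    tensorOneL φ (proj φ 1 (fockAction φ a (incl φ 1 x))) = φ a (tensorOneL φ x)) x
    (isClosed_eq (by fun_prop) (by fun_prop)) fun x => ?_
  rw [incl_toCompl, PreCorr.leftAction_toCompl, lact_single, proj_toCompl, component_single_same,
    tensorOneL_toCompl, tensorOneL_toCompl]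
  induction x using tpow_one_induction φ with
  | h0 => simp only [map_zero]
  | ha x y hx hy => simp only [map_add, hx, hy]
  | ht ξ b => rw [tensorOneAlg_tmul, Adj.map_rmul]; rfl

-- Conjugation by E^{⊗1} ≅ E turns the action of a on E^{⊗1} into φ(a) and preserves compactness.
-- The assumptions on φ are used here and only passed along afterwards.
variable {φ} in
theorem eq_zero_of_rho_fockAction_mem_compacts (hφ : Function.Injective φ)
    (hK : Set.range φ ∩ (compacts A E : Set (Adj A E)) = {0}) {a : A}
    (ha : rho φ 1 (fockAction φ a) ∈ compacts A (TensorPow φ 1)) : a = 0 := by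
  have h := compress_mem_compacts
    (V := ((tensorOne φ).symm.toContinuousLinearEquiv : E →L[ℂ] TensorPow φ 1))
    (W := ((tensorOne φ).toContinuousLinearEquiv : TensorPow φ 1 →L[ℂ] E))
    (ip_tensorOne_symm φ) ha
  have e : compress ((tensorOne φ).symm.toContinuousLinearEquiv : E →L[ℂ] TensorPow φ 1)
      ((tensorOne φ).toContinuousLinearEquiv : TensorPow φ 1 →L[ℂ] E)
      (ip_tensorOne_symm φ) (rho φ 1 (fockAction φ a)) = φ a :=
    Adj.ext fun ξ => (tensorOne_rho_fockAction φ a _).trans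
      (congrArg (φ a) ((tensorOne φ).apply_symm_apply ξ))
  rw [e] at h
  have h0 : φ a ∈ ({0} : Set (Adj A E)) := hK ▸ ⟨⟨a, rfl⟩, h⟩
  exact hφ (h0.trans (map_zero φ).symm)

/-- T_η carries level 1 into level 1 + k, so the compression sees x only on that level. -/
theorem rho_mul_creationTensor (k : ℕ) (S x : Adj A (Fock φ)) (η : TensorPow φ k) :
    rho φ 1 (S * x * creationTensor φ k η) =
      rho φ 1 (S * (x * level φ (1 + k)) * creationTensor φ k η) :=
  Adj.ext fun u => by
    rw [← mul_assoc, mul_assoc _ (level φ (1 + k)), level_add_mul_creationTensor, rho_apply,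
      rho_apply, ← mul_assoc, Adj.mul_apply _ (level φ 1), level_incl]

variable {φ}

theorem mul_level_eq_zero {I : Set ℕ} {x : Adj A (Fock φ)} (hx : x ∈ coreAlg φ I) {m : ℕ}
    (h : rho φ m x = 0) : x * level φ m = 0 :=
  Adj.ext fun y => by
    rw [Adj.mul_apply, level_apply, apply_incl_of_mem hx, h, Adj.zero_apply, map_zero,
      Adj.zero_apply]

/-- Modulo compact operators, the action of `x ∈ F_E` on `E^{⊗(k+1)}` is `x_k ⊗ 1`, where `x_k` is
the action of `x` on `E^{⊗k}`. -/
theorem rho_sub_mem_compacts {I : Set ℕ} {x : Adj A (Fock φ)} (hx : x ∈ coreAlg φ I) (k : ℕ)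
    (ξ η : TensorPow φ k) :
    rho φ 1 (star (creationTensor φ k ξ) * x * creationTensor φ k η) -
      rho φ 1 (fockAction φ (ip A ξ (rho φ k x η))) ∈ compacts A (TensorPow φ 1) := by
  let f : Adj A (Fock φ) →ₗ[ℂ] Adj A (TensorPow φ 1) :=
    { toFun := fun x => rho φ 1 (star (creationTensor φ k ξ) * x * creationTensor φ k η) -
        rho φ 1 (fockAction φ (ip A ξ (rho φ k x η)))
      map_add' := fun x y => by
        rw [mul_add, add_mul, map_add, map_add, Adj.add_apply, ip_add_right, map_add, map_add]
        abel
      map_smul' := fun c x => by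
        rw [mul_smul_comm, smul_mul_assoc, map_smul, map_smul, Adj.smul_apply, ip_smul_right,
          map_smul, map_smul, RingHom.id_apply, smul_sub] }
  have hf : Continuous f := by
    have h1 : Continuous fun x => rho φ k x η := by
      have : Continuous fun x => Adj.toCLM (rho φ k x) :=
        (continuous_subtype_val (p := fun T => T ∈ adjointable A (TensorPow φ k))).comp
          (rho φ k).continuous
      fun_prop
    have h2 : Continuous fun x => fockAction φ (ip A ξ (rho φ k x η)) :=
      (continuous_of_starAlgHom (fockAction φ)).comp
        (continuous_ip.comp (by fun_prop : Continuous fun x => (ξ, rho φ k x η)))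
    exact ((rho φ 1).continuous.comp (by fun_prop)).sub ((rho φ 1).continuous.comp h2)
  refine coreAlg_induction ((compacts A (TensorPow φ 1)).toSubmodule.comap f)
    (isClosed_thetaSpan.preimage hf) (fun j _ ζ ω => ?_) hx
  change rho φ 1 _ - rho φ 1 _ ∈ compacts A (TensorPow φ 1)
  -- For j ≤ k the two terms agree: x T_η = T_{x_k η}, and T_ξ* T_{x_k η} is the action of ⟨ξ, x_k
  -- η⟩. For j > k the second term is zero, and the first involves only x on level 1 + k, which is
  -- rank one if j = 1 + k and zero if j is larger.
  rcases le_or_gt j k with h | h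
  · rw [mul_assoc, mul_creationTensor_of_mem (mem_coreAlg (Set.mem_Iic.2 h) ζ ω),
      star_creationTensor_mul, sub_self]
    exact zero_mem _
  · rw [rho_creation_mul_star_of_lt φ h, Adj.zero_apply, ip_zero_right, map_zero, map_zero,
      sub_zero, rho_mul_creationTensor]
    refine compress_mem_compacts _ (mul_mem_compacts_right _ (mul_mem_compacts_left _ ?_))
    rcases eq_or_ne j (1 + k) with rfl | h'
    · rw [creation_mul_star_mul_level]
      exact theta_mem_thetaSpan _ _
    · rw [mul_assoc, star_creationTensor_mul_level_of_lt φ (by omega), mul_zero]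
      exact zero_mem _

/-- When x vanishes on level k + 1, so does the compression of T_ξ* x T_η to level 1; what remains
is that the action of ⟨ξ, x_k η⟩ on E^{⊗1} is compact, which forces ⟨ξ, x_k η⟩ = 0. -/
theorem rho_eq_zero_of_succ (hφ : Function.Injective φ)
    (hK : Set.range φ ∩ (compacts A E : Set (Adj A E)) = {0}) {I : Set ℕ} {x : Adj A (Fock φ)}
    (hx : x ∈ coreAlg φ I) {k : ℕ} (h : rho φ (k + 1) x = 0) : rho φ k x = 0 := by
  refine Adj.ext fun η => ip_ext (A := A) fun ξ => ?_
  rw [Adj.zero_apply, ip_zero_right]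
  refine eq_zero_of_rho_fockAction_mem_compacts hφ hK ?_
  have := rho_sub_mem_compacts hx k ξ η
  rw [rho_mul_creationTensor, add_comm 1 k, mul_level_eq_zero hx h, mul_zero, zero_mul, map_zero,
    zero_sub] at this
  exact neg_mem_iff.1 this

theorem rho_eq_zero_of_le (hφ : Function.Injective φ)
    (hK : Set.range φ ∩ (compacts A E : Set (Adj A E)) = {0}) {I : Set ℕ} {x : Adj A (Fock φ)}
    (hx : x ∈ coreAlg φ I) {m n : ℕ} (hmn : m ≤ n) (h : rho φ n x = 0) : rho φ m x = 0 := by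
  induction n, hmn using Nat.le_induction with
  | base => exact h
  | succ n _ ih => exact ih (rho_eq_zero_of_succ hφ hK hx h)

/-! ### Faithfulness of C_n on E^{⊗n} -/

theorem creation_rmul (ξ : E) (a : A) : creation φ (rmul ξ a) = creation φ ξ * fockAction φ a := by
  -- For the difference D of the two sides, D* D expands by T_ξ* T_η = ⟨ξ, η⟩ into terms that
  -- cancel.
  rw [← sub_eq_zero, ← CStarRing.star_mul_self_eq_zero_iff]
  simp only [star_sub, star_mul, sub_mul, mul_sub, mul_assoc, star_creation_mul]
  simp only [← mul_assoc (star (creation φ _)), star_creation_mul, ← map_star, ← map_mul,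
    ip_rmul_left, ip_rmul_right, mul_assoc]
  abel

theorem norm_creation_le (ξ : E) : ‖creation φ ξ‖ ≤ ‖ξ‖ := by
  refine (sq_le_sq₀ (norm_nonneg _) (norm_nonneg _)).1 ?_
  rw [sq, ← CStarRing.norm_star_mul_self, star_creation_mul, norm_sq_eq_ip A]
  exact NonUnitalStarAlgHom.norm_apply_le (fockAction φ) _

/-- For ξ a the operator is T_{ξ⊗a}, of degree one by construction; ξ is a limit of such vectors,
and the range is closed. -/
theorem creation_mem (ξ : E) : creation φ ξ ∈ creationRange φ 1 := by
  have hc : Continuous (creation φ) :=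
    (AddMonoidHomClass.lipschitz_of_bound (creation φ) 1
      fun ξ => by simpa using norm_creation_le ξ).continuous
  refine closure_minimal ?_ ((isClosed_creationRange φ 1).preimage hc)
    (mem_closure_rmul (A := A) ξ)
  rintro _ ⟨a, rfl⟩
  change creation φ (rmul ξ a) ∈ creationRange φ 1
  rw [creation_rmul, ← creationAlg_base, ← creationAlg_tmul]
  exact creationAlg_mem φ 1 _

/-- An elementary tensor of degree j + n + 1 is T_{ξ_1} ⋯ T_{ξ_{n+1}} y, and S kills the product of
these operators. The induction moves one creation operator at a time into S. At least one factor
from E is required: in degree 0 only vectors a y could be reached, and these need not be dense. -/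
theorem apply_single_eq_zero (j n : ℕ) {S : Adj A (Fock φ)}
    (h : ∀ T ∈ creationRange φ (n + 1), S * T = 0)
    (z : (PreCorr.tpow φ (j + n + 1)).carrier) : S (toCompl A (single φ (j + n + 1) z)) = 0 := by
  induction z using tpow_succ_induction φ (j + n) with
  | h0 => simp only [map_zero]
  | ha x y hx hy => rw [map_add, map_add, map_add, hx, hy, add_zero]
  | ht ξ y =>
    rw [← createAlg_single, ← creation_toCompl, ← Adj.mul_apply]
    induction n generalizing S ξ with
    | zero => rw [h _ (creation_mem ξ), Adj.zero_apply]
    | succ n ih =>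
      have h' : ∀ T ∈ creationRange φ (n + 1), S * creation φ ξ * T = 0 := fun T hT => by
        rw [mul_assoc]; exact h _ (creation_mul_mem φ ξ _ hT)
      change (S * creation φ ξ) (toCompl A (single φ (j + n + 1) y)) = 0
      induction y using tpow_succ_induction φ (j + n) with
      | h0 => simp only [map_zero]
      | ha x y hx hy => rw [map_add, map_add, map_add, hx, hy, add_zero]
      | ht η y =>
        rw [← createAlg_single, ← creation_toCompl, ← Adj.mul_apply]
        exact ih h' η y

/-- An element of `C_n` is determined by its action on `E^{⊗n}`. -/
theorem eq_zero_of_mem_Iic (hφ : Function.Injective φ)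
    (hK : Set.range φ ∩ (compacts A E : Set (Adj A E)) = {0}) {n : ℕ} {x : Adj A (Fock φ)}
    (hx : x ∈ coreAlg φ (Set.Iic n)) (h : rho φ n x = 0) : x = 0 := by
  have hT : ∀ T ∈ creationRange φ n, x * T = 0 := by
    rintro _ ⟨ζ, rfl⟩
    refine (mul_creationTensor_of_mem hx ζ).trans ?_
    rw [h, Adj.zero_apply, map_zero]
  rcases n with _ | n
  -- For n = 0 the vectors a y need not span the higher summands, so the argument is algebraic: C_0
  -- is spanned by the T_a T_b*, whence x C_0 = 0 and in particular x x* = 0.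
  · have hy : ∀ y ∈ coreAlg φ (Set.Iic 0), x * y = 0 := fun y hy =>
      coreAlg_induction (LinearMap.ker (LinearMap.mulLeft ℂ x))
        (isClosed_eq (continuous_const.mul continuous_id) continuous_const) (fun k hk ξ η => by
          obtain rfl : k = 0 := Nat.le_zero.1 hk
          change x * (_ * _) = 0
          rw [← mul_assoc, hT _ (creationTensor_mem φ 0 ξ), zero_mul]) hy
    exact (CStarRing.mul_star_self_eq_zero_iff x).1 (hy _ (star_mem hx))
  · refine eq_zero_of_rho_eq_zero hx fun m => ?_
    -- Levels up to n + 1 are reached by descent, higher ones because x kills every T_ζ of degree n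
    -- + 1.
    rcases le_or_gt m (n + 1) with hm | hm
    · exact rho_eq_zero_of_le hφ hK hx hm h
    · obtain ⟨j, rfl⟩ : ∃ j, m = j + n + 1 := ⟨m - n - 1, by omega⟩
      refine Adj.ext_toCompl fun z => ?_
      rw [rho_apply, incl_toCompl, apply_single_eq_zero j n hT, map_zero, Adj.zero_apply]

end Kernel

/-! ### Kernels, essentiality and quotients -/

section Quotients

variable {A E : Type u} [NonUnitalCStarAlgebra A] [PartialOrder A] [StarOrderedRing A]
  [NormedAddCommGroup E] [NormedSpace ℂ E] [CompleteSpace E] [HilbertModule A E]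
  {φ : A →⋆ₙₐ[ℂ] Adj A E}

/-- Closedness makes these subalgebras C*-algebras, as the isometry of injective *-homomorphisms
requires. -/
instance (I : Set ℕ) : IsClosed (coreAlg φ I : Set (Adj A (Fock φ))) := isClosed_coreAlg φ I

variable (φ) in
/-- The action of `coreAlg φ I` on `E^{⊗n}`. -/
def rhoHom (I : Set ℕ) (n : ℕ) : coreAlg φ I →⋆ₙₐ[ℂ] Adj A (TensorPow φ n) where
  toFun x := rho φ n x
  map_smul' c x := (rho φ n).map_smul c x.1
  map_zero' := (rho φ n).map_zero
  map_add' x y := (rho φ n).map_add x.1 y.1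
  map_mul' x y := rho_mul_of_mem x.1 y.2 n
  map_star' x := rho_star φ n x.1

theorem norm_rho_of_mem (hφ : Function.Injective φ)
    (hK : Set.range φ ∩ (compacts A E : Set (Adj A E)) = {0}) {n : ℕ} {x : Adj A (Fock φ)}
    (hx : x ∈ coreAlg φ (Set.Iic n)) : ‖rho φ n x‖ = ‖x‖ :=
  norm_map_of_injective (rhoHom φ (Set.Iic n) n) ((injective_iff_map_eq_zero _).2 fun y hy =>
    Subtype.ext (eq_zero_of_mem_Iic hφ hK y.2 hy)) ⟨x, hx⟩

/-- `F_E = C_n + J_{n+1}`. -/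
theorem exists_sub_mem (hφ : Function.Injective φ)
    (hK : Set.range φ ∩ (compacts A E : Set (Adj A E)) = {0}) {I : Set ℕ} (n : ℕ)
    {x : Adj A (Fock φ)} (hx : x ∈ coreAlg φ I) :
    ∃ c ∈ coreAlg φ (Set.Iic n), x - c ∈ coreAlg φ (Set.Ici (n + 1)) := by
  let p : Submodule ℂ (Adj A (Fock φ)) :=
    { carrier := {x | ∃ c ∈ coreAlg φ (Set.Iic n), x - c ∈ coreAlg φ (Set.Ici (n + 1))}
      add_mem' := by
        rintro x y ⟨c, hc, hx⟩ ⟨d, hd, hy⟩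
        exact ⟨c + d, add_mem hc hd, by rw [add_sub_add_comm]; exact add_mem hx hy⟩
      zero_mem' := ⟨0, zero_mem _, by rw [sub_zero]; exact zero_mem _⟩
      smul_mem' := by
        rintro a x ⟨c, hc, hx⟩
        exact ⟨a • c, SMulMemClass.smul_mem a hc, by
          rw [← smul_sub]; exact SMulMemClass.smul_mem a hx⟩ }
  refine coreAlg_induction p (IsSeqClosed.isClosed fun u x hu hx => ?_) (fun k _ ξ η => ?_) hx
  · choose c hc hj using hu
    -- Closedness of the sum C_n + J_{n+1}: the second summand is invisible on level n, and C_n is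
    -- isometric there. So convergence of u_i forces the parts c_i to be Cauchy, and the remainders
    -- converge too.
    have hρ (i : ℕ) : rho φ n (u i) = rho φ n (c i) := by
      rw [← sub_eq_zero, ← map_sub]
      exact rho_eq_zero_of_mem (Nat.lt_succ_self n) (hj i)
    have hcauchy : CauchySeq c := by
      have h1 : CauchySeq fun i => rho φ n (u i) :=
        (((rho φ n).continuous.tendsto x).comp hx).cauchySeq
      rw [Metric.cauchySeq_iff] at h1 ⊢
      refine fun ε hε => (h1 ε hε).imp fun N hN i hi j hj => ?_
      have := hN i hi j hj
      rwa [dist_eq_norm, hρ, hρ, ← map_sub, norm_rho_of_mem hφ hK (sub_mem (hc i) (hc j)),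
        ← dist_eq_norm] at this
    obtain ⟨d, hd⟩ := cauchySeq_tendsto_of_complete hcauchy
    exact ⟨d, (isClosed_coreAlg φ _).mem_of_tendsto hd (Filter.Eventually.of_forall hc),
      (isClosed_coreAlg φ _).mem_of_tendsto (hx.sub hd) (Filter.Eventually.of_forall hj)⟩
  · rcases le_or_gt k n with h | h
    · exact ⟨_, mem_coreAlg (Set.mem_Iic.2 h) ξ η, by rw [sub_self]; exact zero_mem _⟩
    · exact ⟨0, zero_mem _, by rw [sub_zero]; exact mem_coreAlg (Set.mem_Ici.2 h) ξ η⟩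

/-- Write x = c + j with c in C_n and j in J_{n+1}. Since j vanishes on level n, x_n = c_n, and c_n
= 0 means c = 0. -/
theorem mem_Ici_iff (hφ : Function.Injective φ)
    (hK : Set.range φ ∩ (compacts A E : Set (Adj A E)) = {0}) {I : Set ℕ} {n : ℕ}
    {x : Adj A (Fock φ)} (hx : x ∈ coreAlg φ I) :
    x ∈ coreAlg φ (Set.Ici (n + 1)) ↔ rho φ n x = 0 := by
  refine ⟨rho_eq_zero_of_mem (Nat.lt_succ_self n), fun h => ?_⟩
  obtain ⟨c, hc, hj⟩ := exists_sub_mem hφ hK n hx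
  have h0 := rho_eq_zero_of_mem (Nat.lt_succ_self n) hj
  rw [map_sub, h, zero_sub, neg_eq_zero] at h0
  rw [eq_zero_of_mem_Iic hφ hK hc h0, sub_zero] at hj
  exact hj

theorem isEssentialIn_coreAlg (hφ : Function.Injective φ)
    (hK : Set.range φ ∩ (compacts A E : Set (Adj A E)) = {0}) (I : Set ℕ) (n : ℕ) :
    IsEssentialIn (coreAlg φ (Set.Ici n)) (coreAlg φ I) := by
  intro x hx h
  refine eq_zero_of_rho_eq_zero hx fun m => ?_
  -- Level m may lie below n, where J_n gives no information; the compression is shown to vanish on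
  -- level max m n and then descends.
  refine rho_eq_zero_of_le hφ hK hx (le_max_left m n) ?_
  refine Adj.ext fun ξ => eq_of_rmul_eq (A := A) fun a => ?_
  -- For T = T_ξ the element T T* lies in J_n, so (x T)(x T)* = x T T* x* = 0.
  have h0 : x * creationTensor φ (max m n) ξ = 0 := by
    rw [← CStarRing.mul_star_self_eq_zero_iff, star_mul, mul_assoc, ← mul_assoc _ _ (star x),
      ← mul_assoc, h _ (mem_coreAlg (Set.mem_Ici.2 (le_max_right m n)) ξ ξ), zero_mul]
  rw [← Adj.map_rmul, rho_apply, ← creationTensor_incl_zero, ← Adj.mul_apply, h0]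
  simp [rmul]

theorem iota_mem {k : ℕ} {I : Set ℕ} (hk : k ∈ I) (S : compacts A (TensorPow φ k)) :
    iota φ k S ∈ coreAlg φ I := by
  refine denseRange_thetaSum.induction_on (p := fun S => iota φ k S ∈ coreAlg φ I) S
    ((isClosed_coreAlg φ I).preimage (iota φ k).continuous) fun d => ?_
  induction d using Finsupp.induction_linear with
  | zero => rw [map_zero, map_zero]; exact zero_mem _
  | add f g hf hg => rw [map_add, map_add]; exact add_mem hf hg
  | single p c =>
    rw [thetaSum, Finsupp.linearCombination_single, map_smul, iota_theta]
    exact SMulMemClass.smul_mem c (mem_coreAlg hk p.1 p.2)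

/-- Thus ι_k is a section of the compression to level k, which makes the latter map J_k onto the
compact operators. -/
theorem rho_iota (k : ℕ) (S : compacts A (TensorPow φ k)) : rho φ k (iota φ k S) = S := by
  refine denseRange_thetaSum.induction_on (p := fun S => rho φ k (iota φ k S) = S) S
    (isClosed_eq (by fun_prop) continuous_subtype_val) fun d => ?_
  induction d using Finsupp.induction_linear with
  | zero => simp only [map_zero]; rfl
  | add f g hf hg => rw [map_add, map_add, map_add, hf, hg]; rfl
  | single p c =>
    rw [thetaSum, Finsupp.linearCombination_single, map_smul, map_smul, iota_theta,
      rho_creation_mul_star]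
    rfl

/-- ι_k is the continuous linear extension of θ_{ξ,η} ↦ T_ξ T_η*, so its image adds nothing to the
closed algebra generated by the T_ξ T_η*. -/
theorem idealJ_eq (n : ℕ) : idealJ φ n = coreAlg φ (Set.Ici n) := by
  refine le_antisymm (cstarGen_le (isClosed_coreAlg φ _) ?_) (cstarGen_le
    (NonUnitalStarSubalgebra.isClosed_topologicalClosure _) ?_)
  · rintro _ ⟨k, hk, S, rfl⟩
    exact iota_mem (Set.mem_Ici.2 hk) S
  · rintro _ ⟨k, hk, ξ, η, rfl⟩
    exact subset_cstarGen _ ⟨k, hk, thetaK A ξ η, (iota_theta φ k ξ η).symm⟩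

theorem core_eq : core φ = coreAlg φ Set.univ := by
  refine le_antisymm (NonUnitalStarSubalgebra.topologicalClosure_minimal _
    (iSup_le fun n => coreAlg_mono (Set.subset_univ (Set.Iic n))) (isClosed_coreAlg φ _))
    (cstarGen_le (NonUnitalStarSubalgebra.isClosed_topologicalClosure _) ?_)
  rintro _ ⟨k, _, ξ, η, rfl⟩
  exact coreStage_le_core φ k (mem_coreAlg (Set.mem_Iic.2 le_rfl) ξ η)

theorem core_eq_Ici_zero : core φ = coreAlg φ (Set.Ici 0) :=
  core_eq.trans (congrArg _ (Set.eq_univ_of_forall fun n => Nat.zero_le n).symm)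

/-- A surjective *-homomorphism with kernel `J` induces an isomorphism of the quotient. -/
theorem QuotientAlg.nonempty_starAlgEquiv {B : Type*} [CStarAlgebra B]
    {J S : NonUnitalStarSubalgebra ℂ B} (h : IsIdealIn J S) {C : Type*} [NonUnitalRing C]
    [Module ℂ C] [Star C] (f : S →⋆ₙₐ[ℂ] C) (hf : Function.Surjective f)
    (hker : ∀ x : S, f x = 0 ↔ (x : B) ∈ J) : Nonempty (QuotientAlg h ≃⋆ₐ[ℂ] C) := by
  let g : QuotientAlg h →ₗ[ℂ] C := (subspaceIn J S).liftQ (f : S →ₗ[ℂ] C) fun x hx =>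
    (hker x).2 hx
  have hg (x : S) : g (mkL h x) = f x := rfl
  have hbij : Function.Bijective g := by
    refine ⟨(injective_iff_map_eq_zero g).2 ((mkL_surjective h).forall.2 fun x hx => ?_),
      fun c => ?_⟩
    · rw [← map_zero (mkL h), mkL_eq_iff]
      simpa using (hker x).1 hx
    · obtain ⟨x, rfl⟩ := hf c
      exact ⟨mkL h x, rfl⟩
  let G : QuotientAlg h →⋆ₙₐ[ℂ] C :=
    { toFun := g
      map_smul' := map_smul g
      map_zero' := map_zero g
      map_add' := map_add g
      map_mul' := (mkL_surjective h).forall₂.2 fun x y => by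
        rw [← mkL_mul, hg, hg, hg, map_mul]
      map_star' := (mkL_surjective h).forall.2 fun x => by
        rw [← mkL_star, hg, hg, map_star] }
  exact ⟨StarAlgEquiv.ofBijective G hbij⟩

/-- The isomorphism is induced by compression to level n, which on J_n is a *-homomorphism onto the
compacts with kernel J_{n+1}. -/
theorem nonempty_quotient_equiv (hφ : Function.Injective φ)
    (hK : Set.range φ ∩ (compacts A E : Set (Adj A E)) = {0}) (n : ℕ)
    (h : IsIdealIn (coreAlg φ (Set.Ici (n + 1))) (coreAlg φ (Set.Ici n))) :
    Nonempty (QuotientAlg h ≃⋆ₐ[ℂ] compacts A (TensorPow φ n)) := by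
  refine QuotientAlg.nonempty_starAlgEquiv h
    (NonUnitalStarAlgHom.codRestrict (rhoHom φ (Set.Ici n) n) (compacts A (TensorPow φ n))
      fun x => rho_mem_compacts x.2) (fun S => ?_) fun x => ?_
  · exact ⟨⟨iota φ n S, iota_mem Set.self_mem_Ici S⟩, Subtype.ext (rho_iota n S)⟩
  · rw [mem_Ici_iff hφ hK x.2]
    exact Subtype.ext_iff

theorem isIdealIn_idealJ (n : ℕ) : IsIdealIn (idealJ φ n) (core φ) := by
  rw [idealJ_eq, core_eq]
  exact isIdealIn_coreAlg (Set.subset_univ _)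

/-- The composition of the inclusion of `S'` in `S` with the quotient map `S → S / J` is bijective
if `S' ∩ J = 0` and `S = S' + J`. -/
theorem QuotientAlg.exists_equiv {B : Type*} [CStarAlgebra B]
    {J S S' : NonUnitalStarSubalgebra ℂ B} (h : IsIdealIn J S) (hle : S' ≤ S)
    (hinj : ∀ x ∈ S', x ∈ J → x = 0) (hsurj : ∀ x ∈ S, ∃ c ∈ S', x - c ∈ J) :
    ∃ e : S' ≃⋆ₐ[ℂ] QuotientAlg h, ∀ c : S',
      e c = QuotientAlg.mk h (NonUnitalStarSubalgebra.inclusion hle c) := by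
  refine ⟨StarAlgEquiv.ofBijective
    ((QuotientAlg.mk h).comp (NonUnitalStarSubalgebra.inclusion hle)) ⟨?_, ?_⟩,
    fun c => StarAlgEquiv.ofBijective_apply _ c⟩
  · refine (injective_iff_map_eq_zero _).2 fun c hc => Subtype.ext (hinj c c.2 ?_)
    have hc' : (c : B) - ((0 : S) : B) ∈ J :=
      (mkL_eq_iff h (x := NonUnitalStarSubalgebra.inclusion hle c)).1
        (hc.trans (map_zero (mkL h)).symm)
    simpa using hc'
  · refine (mkL_surjective h).forall.2 fun x => ?_
    obtain ⟨c, hc, hxc⟩ := hsurj x x.2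
    exact ⟨⟨c, hc⟩, ((mkL_eq_iff h).2 hxc).symm⟩

theorem exists_coreStage_equiv (hφ : Function.Injective φ)
    (hK : Set.range φ ∩ (compacts A E : Set (Adj A E)) = {0}) (n : ℕ) :
    ∃ (h : IsIdealIn (idealJ φ (n + 1)) (core φ)) (e : coreStage φ n ≃⋆ₐ[ℂ] QuotientAlg h),
      ∀ c : coreStage φ n, e c = QuotientAlg.mk h
        (NonUnitalStarSubalgebra.inclusion (coreStage_le_core φ n) c) := by
  -- The two conditions are C_n ∩ J_{n+1} = 0, by faithfulness on level n, and F_E = C_n + J_{n+1}.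
  refine ⟨isIdealIn_idealJ (n + 1), QuotientAlg.exists_equiv _ _ (fun x hx hJ => ?_) fun x hx => ?_⟩
  · rw [idealJ_eq] at hJ
    exact eq_zero_of_mem_Iic hφ hK hx (rho_eq_zero_of_mem (Nat.lt_succ_self n) hJ)
  · rw [core_eq] at hx
    rw [idealJ_eq]
    exact exists_sub_mem hφ hK n hx

end Quotients

/-! ### Fullness of the tensor powers -/

section Full

variable {A E : Type u} [NonUnitalCStarAlgebra A] [PartialOrder A] [StarOrderedRing A]
  [NormedAddCommGroup E] [NormedSpace ℂ E] [CompleteSpace E] [HilbertModule A E]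

/-- The closed linear span of the values of the inner product of `X`. -/
def ipSpan (A X : Type*) [NonUnitalCStarAlgebra A] [PartialOrder A]
    [NormedAddCommGroup X] [NormedSpace ℂ X] [CompleteSpace X] [HilbertModule A X] :
    Submodule ℂ A :=
  (Submodule.span ℂ (Set.range fun p : X × X => ip A p.1 p.2)).topologicalClosure

theorem isClosed_ipSpan (A X : Type*) [NonUnitalCStarAlgebra A] [PartialOrder A]
    [NormedAddCommGroup X] [NormedSpace ℂ X] [CompleteSpace X] [HilbertModule A X] :
    IsClosed (ipSpan A X : Set A) := Submodule.isClosed_topologicalClosure _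

theorem ip_mem_ipSpan {X : Type*}
    [NormedAddCommGroup X] [NormedSpace ℂ X] [CompleteSpace X] [HilbertModule A X] (x y : X) :
    ip A x y ∈ ipSpan A X :=
  Submodule.le_topologicalClosure _ (Submodule.subset_span ⟨(x, y), rfl⟩)

/-- Products are dense in A, since a is the limit of a e along an approximate unit. -/
theorem isFull_of_mul_mem {X : Type*} [NormedAddCommGroup X] [NormedSpace ℂ X] [CompleteSpace X]
    [HilbertModule A X] (h : ∀ a b : A, a * b ∈ ipSpan A X) : IsFull A X := fun a =>
  have hl := CStarAlgebra.increasingApproximateUnit A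
  have := hl.neBot
  (isClosed_ipSpan A X).mem_of_tendsto (hl.tendsto_mul_left a)
    (Filter.Eventually.of_forall fun e => h a e)

theorem isFull_tensorPow_zero (φ : A →⋆ₙₐ[ℂ] Adj A E) : IsFull A (TensorPow φ 0) :=
  isFull_of_mul_mem fun a b => by
    have := ip_mem_ipSpan (A := A) (toCompl A (base φ (star a))) (toCompl A (base φ b))
    rwa [ip_toCompl, ip_base, star_star] at this

theorem isFull_tensorPow_one (hfull : IsFull A E) (φ : A →⋆ₙₐ[ℂ] Adj A E) :
    IsFull A (TensorPow φ 1) := fun a =>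
  closure_span_induction (ipSpan A (TensorPow φ 1)) (isClosed_ipSpan A (TensorPow φ 1)) (by
    rintro _ ⟨⟨ξ, η⟩, rfl⟩
    have := ip_mem_ipSpan (A := A) ((tensorOne φ).symm ξ) ((tensorOne φ).symm η)
    rwa [ip_tensorOne_symm, LinearIsometryEquiv.apply_symm_apply] at this) (hfull a)

/-- Nondegeneracy passes to every tensor power, because A acts on the first factor alone. In degree
0 an approximate unit takes its place. -/
theorem dense_lact (φ : A →⋆ₙₐ[ℂ] Adj A E) (h : IsNondegenerate φ) (n : ℕ)
    (p : Submodule ℂ (TensorPow φ n)) (hp : IsClosed (p : Set (TensorPow φ n)))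
    (hmem : ∀ a y, toCompl A ((PreCorr.tpow φ n).lact a y) ∈ p) (x : TensorPow φ n) : x ∈ p := by
  refine denseRange_toCompl.induction_on (p := fun x => x ∈ p) x hp fun x => ?_
  rcases n with _ | n
  · obtain ⟨a, ha⟩ := exists_base φ x
    rw [ha]
    let g : A →ₗ[ℂ] TensorPow φ 0 :=
      { toFun := fun a => toCompl A (base φ a)
        map_add' := fun a b => by rw [← map_add]; rfl
        map_smul' := fun c a => by rw [RingHom.id_apply, ← map_smul]; rfl }
    have hg : Continuous g := AddMonoidHomClass.continuous_of_bound g 1 fun a => by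
      refine (sq_le_sq₀ (norm_nonneg _) (by positivity)).1 ?_
      change ‖toCompl A (base φ a)‖ ^ 2 ≤ _
      rw [norm_toCompl_sq, ip_base, CStarRing.norm_star_mul_self, one_mul, sq]
    have hl := CStarAlgebra.increasingApproximateUnit A
    have := hl.neBot
    refine (hp.preimage hg).mem_of_tendsto (hl.tendsto_mul_left a)
      (Filter.Eventually.of_forall fun e => ?_)
    exact hmem a (base φ e)
  · induction x using tpow_succ_induction φ n with
    | h0 => rw [map_zero]; exact zero_mem _
    | ha x y hx hy => rw [map_add]; exact add_mem hx hy
    | ht ξ y =>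
      let f : E →ₗ[ℂ] TensorPow φ (n + 1) :=
        { toFun := fun ξ => toCompl A (tmulLeft φ ξ n y)
          map_add' := fun ξ η => by
            rw [← map_add]; exact congrArg _ (TensorProduct.add_tmul ξ η y)
          map_smul' := fun c ξ => by
            rw [RingHom.id_apply, ← map_smul]
            exact congrArg _ (TensorProduct.smul_tmul' c ξ y).symm }
      have hf : Continuous f := AddMonoidHomClass.continuous_of_bound f ‖toCompl A y‖ fun ξ => by
        change ‖toCompl A (tmulLeft φ ξ n y)‖ ≤ _
        rw [← norm_toCompl_single φ (n + 1), ← createAlg_single, ← norm_toCompl_single φ n,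
          mul_comm]
        exact norm_createAlg_le φ ξ _
      refine closure_span_induction (p.comap f) (hp.preimage hf) ?_ (h ξ)
      rintro _ ⟨⟨a, η⟩, rfl⟩
      exact hmem a (tmulLeft φ η n y)

theorem isFull_tensorPow_succ (hfull : IsFull A E) (φ : A →⋆ₙₐ[ℂ] Adj A E)
    (h : IsNondegenerate φ) (n : ℕ) (hn : IsFull A (TensorPow φ n)) :
    IsFull A (TensorPow φ (n + 1)) := by
  have hcl := isClosed_ipSpan A (TensorPow φ (n + 1))
  refine fun a => closure_span_induction (ipSpan A (TensorPow φ (n + 1))) hcl ?_ (hn a)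
  rintro _ ⟨⟨x, y⟩, rfl⟩
  change ip A x y ∈ ipSpan A (TensorPow φ (n + 1))
  refine denseRange_toCompl.induction_on (p := fun x : TensorPow φ n =>
    ip A x y ∈ ipSpan A (TensorPow φ (n + 1))) x
    (hcl.preimage (continuous_ip.comp (by fun_prop : Continuous fun x : TensorPow φ n => (x, y))))
    fun x => ?_
  -- By nondegeneracy y may be replaced by a y, and then, by fullness of E, a by ⟨ξ, η⟩; the
  -- resulting ⟨x, ⟨ξ, η⟩ y⟩ is ⟨ξ ⊗ x, η ⊗ y⟩.
  refine dense_lact φ h n ((ipSpan A (TensorPow φ (n + 1))).comap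
    (ipL A (TensorPow φ n) (toCompl A x)).toLinearMap)
    (hcl.preimage (ipL A (TensorPow φ n) (toCompl A x)).continuous) (fun a y => ?_) y
  change ip A (toCompl A x) (toCompl A ((PreCorr.tpow φ n).lact a y)) ∈
    ipSpan A (TensorPow φ (n + 1))
  rw [ip_toCompl]
  let f : A →ₗ[ℂ] A := (PreHilbertModule.ip (A := A) x).comp ((PreCorr.tpow φ n).lact.flip y)
  have hf : Continuous f := AddMonoidHomClass.continuous_of_bound f
    (‖toCompl A x‖ * ‖toCompl A y‖) fun a => by
      refine (norm_ip_le_toCompl x ((PreCorr.tpow φ n).lact a y)).trans ?_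
      rw [mul_assoc, mul_comm _ ‖a‖]
      gcongr
      exact PreCorr.norm_lact_le _ a y
  refine closure_span_induction ((ipSpan A (TensorPow φ (n + 1))).comap f) (hcl.preimage hf) ?_
    (hfull a)
  rintro _ ⟨⟨ξ, η⟩, rfl⟩
  change ip A x ((PreCorr.tpow φ n).lact (ip A ξ η) y) ∈ ipSpan A (TensorPow φ (n + 1))
  rw [← contract_tmulLeft, ← ip_tmulLeft, ← ip_toCompl]
  exact ip_mem_ipSpan _ _

theorem isFull_tensorPow (hfull : IsFull A E) (φ : A →⋆ₙₐ[ℂ] Adj A E) (n : ℕ)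
    (h : n ≤ 1 ∨ IsNondegenerate φ) : IsFull A (TensorPow φ n) := by
  rcases h with h | h
  · interval_cases n
    · exact isFull_tensorPow_zero φ
    · exact isFull_tensorPow_one hfull φ
  · induction n with
    | zero => exact isFull_tensorPow_zero φ
    | succ n ih => exact isFull_tensorPow_succ hfull φ h n ih

/-! ### The core inside the Toeplitz algebra -/

theorem fockAction_mem_toeplitz (hfull : IsFull A E) (φ : A →⋆ₙₐ[ℂ] Adj A E) (a : A) :
    fockAction φ a ∈ toeplitz φ := by
  refine closure_span_induction ((toeplitz φ).toSubmodule.comap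
    (fockAction φ : A →ₗ[ℂ] Adj A (Fock φ)))
    ((NonUnitalStarSubalgebra.isClosed_topologicalClosure _).preimage
      (continuous_of_starAlgHom (fockAction φ))) ?_ (hfull a)
  rintro _ ⟨⟨ξ, η⟩, rfl⟩
  change fockAction φ (ip A ξ η) ∈ toeplitz φ
  -- Fullness brings the left action of A into the algebra: the action of ⟨ξ, η⟩ is T_ξ* T_η.
  rw [← star_creation_mul]
  exact mul_mem (star_mem (subset_cstarGen _ ⟨ξ, rfl⟩)) (subset_cstarGen _ ⟨η, rfl⟩)

theorem creationTensor_mem_toeplitz (hfull : IsFull A E) (φ : A →⋆ₙₐ[ℂ] Adj A E) (n : ℕ)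
    (ξ : TensorPow φ n) : creationTensor φ n ξ ∈ toeplitz φ := by
  refine creationTensor_induction φ n (p := fun S => S ∈ toeplitz φ)
    (NonUnitalStarSubalgebra.isClosed_topologicalClosure _) (fun x => ?_) ξ
  induction n with
  | zero => exact fockAction_mem_toeplitz hfull φ x
  | succ n ih =>
    induction x using tpow_succ_induction φ n with
    | h0 => rw [map_zero]; exact zero_mem _
    | ha x y hx hy => rw [map_add]; exact add_mem hx hy
    | ht η x =>
      rw [creationAlg_tmul]
      exact mul_mem (subset_cstarGen _ ⟨η, rfl⟩) (ih 0 x)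

theorem core_le_toeplitz (hfull : IsFull A E) (φ : A →⋆ₙₐ[ℂ] Adj A E) : core φ ≤ toeplitz φ := by
  rw [core_eq]
  refine cstarGen_le (NonUnitalStarSubalgebra.isClosed_topologicalClosure _) ?_
  rintro _ ⟨k, _, ξ, η, rfl⟩
  exact mul_mem (creationTensor_mem_toeplitz hfull φ k ξ)
    (star_mem (creationTensor_mem_toeplitz hfull φ k η))

end Full

end CuntzPimsner

end

/-! ### Assembly -/

theorem mainTheorem6 {A E : Type u} [NonUnitalCStarAlgebra A] [PartialOrder A]
    [StarOrderedRing A] [NormedAddCommGroup E] [NormedSpace ℂ E] [CompleteSpace E]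
    [HilbertModule A E] (hfull : IsFull A E)
    (φ : A →⋆ₙₐ[ℂ] Adj A E) (hφ : Function.Injective φ)
    (hK : Set.range φ ∩ (compacts A E : Set (Adj A E)) = {0}) :
    core φ ≤ toeplitz φ ∧
    (∀ n, IsIdealIn (idealJ φ n) (core φ) ∧ IsEssentialIn (idealJ φ n) (core φ)) ∧
    Antitone (idealJ φ) ∧
    idealJ φ 0 = core φ ∧
    ⨅ n, idealJ φ n = ⊥ ∧
    (∀ n, ∃ h : IsIdealIn (idealJ φ (n + 1)) (idealJ φ n),
      Nonempty (QuotientAlg h ≃⋆ₐ[ℂ] compacts A (TensorPow φ n)) ∧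
      (n ≤ 1 ∨ IsNondegenerate φ → IsStronglyMoritaEquivalent (QuotientAlg h) A)) ∧
    (∀ n, ∃ (h : IsIdealIn (idealJ φ (n + 1)) (core φ))
      (e : coreStage φ n ≃⋆ₐ[ℂ] QuotientAlg h),
      ∀ c : coreStage φ n, e c = QuotientAlg.mk h
        (NonUnitalStarSubalgebra.inclusion (coreStage_le_core φ n) c)) := by
  refine ⟨core_le_toeplitz hfull φ, fun n => ⟨isIdealIn_idealJ n, ?_⟩, fun m n h => ?_, ?_, ?_,
    fun n => ?_, exists_coreStage_equiv hφ hK⟩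
  · rw [idealJ_eq, core_eq]
    exact isEssentialIn_coreAlg hφ hK _ n
  · rw [idealJ_eq, idealJ_eq]
    exact coreAlg_mono (Set.Ici_subset_Ici.2 h)
  · rw [idealJ_eq, core_eq_Ici_zero]
  · refine eq_bot_iff.2 fun x hx => ?_
    rw [NonUnitalStarAlgebra.mem_iInf] at hx
    simp only [idealJ_eq] at hx
    -- Membership in J_{m+1} makes the block on level m vanish, for each m.
    exact (NonUnitalStarAlgebra.mem_bot).2
      (eq_zero_of_rho_eq_zero (hx 0) fun m => rho_eq_zero_of_mem (Nat.lt_succ_self m) (hx (m + 1)))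
  -- The type of the quotient depends on the proof that J is an ideal, so the two algebras are
  -- replaced as variables and not by rewriting.
  · have key : ∀ J S, J = coreAlg φ (Set.Ici (n + 1)) → S = coreAlg φ (Set.Ici n) →
        ∃ h : IsIdealIn J S, Nonempty (QuotientAlg h ≃⋆ₐ[ℂ] compacts A (TensorPow φ n)) := by
      rintro _ _ rfl rfl
      exact ⟨isIdealIn_coreAlg (Set.Ici_subset_Ici.2 n.le_succ), nonempty_quotient_equiv hφ hK n _⟩
    obtain ⟨h, he⟩ := key _ _ (idealJ_eq (n + 1)) (idealJ_eq n)
    exact ⟨h, he, fun hn => ⟨TensorPow φ n, inferInstance, inferInstance, inferInstance,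
      inferInstance, isFull_tensorPow hfull φ n hn, he⟩⟩
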